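/- Let $K$ be a field of characteristic $0$. Let $\mathsf{As}$ be the (non-unital) associative operad over $K$: $\mathsf{As}(n)$, $n\ge 1$, has the basis $x_{\sigma(1)}\cdots x_{\sigma(n)}$, $\sigma\in S_n$. Let $\mathbb Z_2$ act on it by the automorphism $\tau(x_{\sigma(1)}\cdots x_{\sigma(n)})=(-1)^{n-1}x_{\sigma(n)}\cdots x_{\sigma(1)}$, and let $[\mathsf{As}]^{\mathbb Z_2}$ be the suboperad of $\tau$-invariants. **Theorem.** The operad $[\mathsf{As}]^{\mathbb Z_2}$ is generated by the skew-symmetric binary operation $\nu_2=x_1x_2-x_2x_1$ and the symmetric ternary operation $\mu_3=\sum_{\sigma\in S_3}x_{\sigma(1)}x_{\sigma(2)}x_{\sigma(3)}$. It is presented by these generators, with their symmetries, and the following relations (together with everything that follows from them by permuting inputs): that is, the morphism to $\mathsf{As}$ from the free symmetric operad on a skew-symmetric $\nu_2$ and a symmetric $\mu_3$ has image $[\mathsf{As}]^{\mathbb Z_2}$, and its kernel is the operadic ideal generated by the relations $$\nu_2(\nu_2(x_1,x_2),x_3)+\nu_2(\nu_2(x_2,x_3),x_1)+\nu_2(\nu_2(x_3,x_1),x_2)=0,$$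 $$\nu_2(\mu_3(x_1,x_2,x_3),x_4)=\mu_3(x_1,x_2,\nu_2(x_3,x_4))+\mu_3(x_1,\nu_2(x_2,x_4),x_3)+\mu_3(\nu_2(x_1,x_4),x_2,x_3),$$ $$\mu_3(\mu_3(x_1,x_2,x_4),x_3,x_5)-\mu_3(\mu_3(x_1,x_2,x_3),x_4,x_5)=B(x_1,x_2,x_4,x_3,x_5)-B(x_1,x_2,x_3,x_4,x_5),$$ where $B(x_1,\dots,x_5)$ is the multilinear operation, symmetric in its first three and in its last two arguments, that is determined by $$B(a,a,a,b,b)=3\mu_3(\nu_2(a,b),\nu_2(a,b),a)+6\mu_3(\nu_2(a,\nu_2(a,b)),a,b)+\tfrac65\,\nu_2(b,\nu_2(a,\nu_2(a,\nu_2(a,b))))+\tfrac{18}5\,\nu_2(a,\nu_2(b,\nu_2(a,\nu_2(b,a)))).$$ These relations and all their permutations by $S_3$, $S_4$, $S_5$, written in the free shuffle operad on $\nu_2,\mu_3$, form a Gröbner basis of the ideal they generate for the following degree-path-lexicographic order of shuffle tree monomials with $\nu_2>\mu_3$, which is a monomial order (a total order on the monomials of each arity, compatible with shuffle compositions). Two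 monomials of the same arity are compared first by degree: the one with fewer vertices is larger. If the degrees agree, compare lexicographically the sequences of words in $\nu_2,\mu_3$ read along the paths from the root to the leaves $1,\dots,n$. Of two words, the one with more letters $\nu_2$ is larger; if these numbers agree, the one with fewer letters $\mu_3$ is larger; if these agree too, the words are compared lexicographically with $\nu_2>\mu_3$. If the path sequences agree, the planar sequences of the leaf labels are compared by the reverse lexicographic order (the lexicographically smaller sequence is the larger one). -/

import Mathlib

/-!
Operads are treated as functors on finite label sets `S ⊂ ℕ`: the component of arity `n` is the
component of the label set `{1, …, n}`, bijections of label sets act by relabelling, and partial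
composition at `i ∈ S` replaces the input `i` by an operation whose label set `U` is disjoint from
`S \ {i}`, which gives an operation with label set `(S \ {i}) ∪ U`.
-/

noncomputable section

namespace FlipOperad

open Finset

/-- The label set `{1, …, n}`. -/
def std (n : ℕ) : Finset ℕ := Finset.Icc 1 n

/-! ### The associative operad and its flip invariants -/

section Associative

variable (K : Type*) [Field K]

/-- The generator `x_i` of the free associative algebra. -/
def X (i : ℕ) : FreeAlgebra K ℕ := FreeAlgebra.ι K i

/-- The component of the (nonunital) associative operad with label set `S`: the span of the
products `x_{l_1} ⋯ x_{l_n}` in which every element of `S` is used exactly once. -/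
def As (S : Finset ℕ) : Submodule K (FreeAlgebra K ℕ) :=
  Submodule.span K {w | ∃ l : List ℕ, l ≠ [] ∧ l.Nodup ∧ l.toFinset = S ∧ w = (l.map (X K)).prod}

/-- Relabelling `x_j ↦ x_{σ j}`. -/
def asRelabel (σ : Equiv.Perm ℕ) (p : FreeAlgebra K ℕ) : FreeAlgebra K ℕ :=
  FreeAlgebra.lift K (fun j => X K (σ j)) p

/-- Partial composition `p ∘_i q`: substitute `q` for `x_i` in `p`. -/
def asComp (i : ℕ) (p q : FreeAlgebra K ℕ) : FreeAlgebra K ℕ :=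
  FreeAlgebra.lift K (fun j => if j = i then q else X K j) p

/-- Reversal of words, `x_{l_1} ⋯ x_{l_n} ↦ x_{l_n} ⋯ x_{l_1}`. -/
def flip : FreeAlgebra K ℕ →ₗ[K] FreeAlgebra K ℕ :=
  (MulOpposite.opLinearEquiv K).symm.toLinearMap ∘ₗ
    (FreeAlgebra.starHom : FreeAlgebra K ℕ ≃ₐ[K] (FreeAlgebra K ℕ)ᵐᵒᵖ).toLinearMap

/-- The automorphism `τ` on the component with label set `S`, `n = |S|`:
`x_{l_1} ⋯ x_{l_n} ↦ (-1)^(n-1) x_{l_n} ⋯ x_{l_1}`. -/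
def tau (S : Finset ℕ) : FreeAlgebra K ℕ →ₗ[K] FreeAlgebra K ℕ :=
  ((-1 : K) ^ (S.card - 1)) • flip K

/-- The `τ`-invariants of the associative operad. -/
def asInv (S : Finset ℕ) : Submodule K (FreeAlgebra K ℕ) :=
  As K S ⊓ LinearMap.eqLocus (tau K S) LinearMap.id

/-- A family of subspaces of the components of the associative operad which is a suboperad. -/
structure IsSuboperad (P : Finset ℕ → Submodule K (FreeAlgebra K ℕ)) : Prop where
  le : ∀ S, P S ≤ As K S
  unit_mem : ∀ i, X K i ∈ P {i}
  relabel_mem : ∀ (σ : Equiv.Perm ℕ) (S : Finset ℕ), ∀ p ∈ P S, asRelabel K σ p ∈ P (S.image σ)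
  comp_mem : ∀ (S U : Finset ℕ) (i : ℕ), i ∈ S → Disjoint (S.erase i) U →
    ∀ p ∈ P S, ∀ q ∈ P U, asComp K i p q ∈ P (S.erase i ∪ U)

/-- The suboperad of the associative operad generated by the sets `G n` of operations of
arity `n`: the smallest suboperad that contains them. -/
def suboperadGen (G : ℕ → Set (FreeAlgebra K ℕ)) (S : Finset ℕ) :
    Submodule K (FreeAlgebra K ℕ) :=
  sInf {N | ∃ P : Finset ℕ → Submodule K (FreeAlgebra K ℕ),
    IsSuboperad K P ∧ (∀ n, ∀ g ∈ G n, g ∈ P (std n)) ∧ N = P S}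

variable {K}

/-- The commutator. -/
def comm2 (a b : FreeAlgebra K ℕ) : FreeAlgebra K ℕ := a * b - b * a

/-- The fully symmetrized triple product. -/
def sym3 (a b c : FreeAlgebra K ℕ) : FreeAlgebra K ℕ :=
  ∑ σ : Equiv.Perm (Fin 3), ![a, b, c] (σ 0) * ![a, b, c] (σ 1) * ![a, b, c] (σ 2)

variable (K)

/-- The two generating operations `ν₂ = x₁x₂ - x₂x₁` and `μ₃ = ∑_σ x_{σ1}x_{σ2}x_{σ3}`. -/
def generators : ℕ → Set (FreeAlgebra K ℕ)
  | 2 => {comm2 (X K 1) (X K 2)}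
  | 3 => {sym3 (X K 1) (X K 2) (X K 3)}
  | _ => ∅

end Associative

/-! ### Tree monomials in a binary operation `ν` and a ternary operation `μ` -/

/-- Planar rooted trees with binary vertices `ν`, ternary vertices `μ` and leaves labelled by
natural numbers. -/
inductive Tree : Type
  | leaf : ℕ → Tree
  | nu : Tree → Tree → Tree
  | mu : Tree → Tree → Tree → Tree

namespace Tree

/-- The labels of the leaves, in planar order. -/
def leaves : Tree → List ℕ
  | leaf i => [i]
  | nu a b => a.leaves ++ b.leaves
  | mu a b c => a.leaves ++ b.leaves ++ c.leaves

/-- The set of labels. -/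
def labels (t : Tree) : Finset ℕ := t.leaves.toFinset

/-- Substitution of trees for the leaves. -/
def bind (f : ℕ → Tree) : Tree → Tree
  | leaf i => f i
  | nu a b => nu (a.bind f) (b.bind f)
  | mu a b c => mu (a.bind f) (b.bind f) (c.bind f)

/-- Grafting of `u` at the leaf `i`. -/
def graft (i : ℕ) (t u : Tree) : Tree := t.bind fun j => if j = i then u else leaf j

/-- Relabelling. -/
def relabel (σ : Equiv.Perm ℕ) (t : Tree) : Tree := t.bind fun j => leaf (σ j)

/-- The number of internal vertices. -/
def degree : Tree → ℕ
  | leaf _ => 0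
  | nu a b => a.degree + b.degree + 1
  | mu a b c => a.degree + b.degree + c.degree + 1

/-- The smallest label. -/
def minLeaf : Tree → ℕ
  | leaf i => i
  | nu a b => min a.minLeaf b.minLeaf
  | mu a b c => min a.minLeaf (min b.minLeaf c.minLeaf)

/-- Shuffle trees: at every vertex the smallest labels of the subtrees of the inputs increase
from left to right. -/
def IsShuffle : Tree → Prop
  | leaf _ => True
  | nu a b => a.minLeaf < b.minLeaf ∧ a.IsShuffle ∧ b.IsShuffle
  | mu a b c => a.minLeaf < b.minLeaf ∧ b.minLeaf < c.minLeaf ∧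
      a.IsShuffle ∧ b.IsShuffle ∧ c.IsShuffle

/-- The tree `u` is the full subtree of `t` above some vertex or leaf of `t`. -/
def IsSubtree (u : Tree) : Tree → Prop
  | leaf i => u = leaf i
  | nu a b => u = nu a b ∨ IsSubtree u a ∨ IsSubtree u b
  | mu a b c => u = mu a b c ∨ IsSubtree u a ∨ IsSubtree u b ∨ IsSubtree u c

/-- Divisibility of shuffle tree monomials: `s` occurs in `t`. Some full subtree of `t` is
obtained from `s` by putting trees on the leaves of `s` in such a way that the order of their
smallest labels is the order of the leaves of `s`. -/
def Divides (s t : Tree) : Prop :=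
  ∃ f : ℕ → Tree, (∀ i ∈ s.labels, ∀ j ∈ s.labels, i < j → (f i).minLeaf < (f j).minLeaf) ∧
    IsSubtree (s.bind f) t

/-- The word of vertices on the path from the root to the leaf `i`; the letter `ν` is written
`true` and the letter `μ` is written `false`, so that `ν > μ`. -/
def path (i : ℕ) : Tree → List Bool
  | leaf _ => []
  | nu a b => true :: (if i ∈ a.leaves then a.path i else b.path i)
  | mu a b c => false ::
      (if i ∈ a.leaves then a.path i else if i ∈ b.leaves then b.path i else c.path i)

end Tree

/-- The tree monomials with label set `S`: every element of `S` labels exactly one leaf. -/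
def treeMonomials (S : Finset ℕ) : Set Tree := {t | t.leaves.Nodup ∧ t.labels = S}

/-- The shuffle tree monomials with label set `S`. -/
def shuffleMonomials (S : Finset ℕ) : Set Tree := {t | t ∈ treeMonomials S ∧ t.IsShuffle}

/-! ### The degree-path-lexicographic order -/

/-- Words in `ν`, `μ` are compared as follows: the word with more letters `ν` is larger; if the
numbers of `ν`s agree, the word with fewer letters `μ` is larger; if these agree as well, words
are compared lexicographically with `ν > μ`. -/
def wordKey (w : List Bool) : ℕ ×ₗ ℕᵒᵈ ×ₗ List Bool :=
  toLex (w.count true, toLex (OrderDual.toDual (w.count false), w))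

/-- Tree monomials with the same labels are compared by the degree (fewer vertices is larger),
then by the sequence of the path words of the leaves, taken in the order of their labels
(lexicographically), then by the planar sequence of labels (reverse lexicographically). -/
def treeKey (t : Tree) : ℕᵒᵈ ×ₗ List (ℕ ×ₗ ℕᵒᵈ ×ₗ List Bool) ×ₗ (List ℕ)ᵒᵈ :=
  toLex (OrderDual.toDual t.degree,
    toLex ((t.labels.sort (· ≤ ·)).map fun i => wordKey (t.path i), OrderDual.toDual t.leaves))

/-- The degree-path-lexicographic order with `ν > μ`. -/
def degPathLex (s t : Tree) : Prop := treeKey s < treeKey t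

/-- Monomial orders of the free shuffle operad: strict total orders on the shuffle tree monomials
with a given label set that are compatible with all shuffle compositions. Grafting `u` at the leaf
`i` of `s` is a shuffle composition if the smallest label of `u` takes the place of `i` in the
order of the labels of `s`. -/
structure IsMonomialOrder (lt : Tree → Tree → Prop) : Prop where
  irrefl : ∀ S, ∀ s ∈ shuffleMonomials S, ¬ lt s s
  trans : ∀ S, ∀ s ∈ shuffleMonomials S, ∀ t ∈ shuffleMonomials S, ∀ u ∈ shuffleMonomials S,
    lt s t → lt t u → lt s u
  total : ∀ S, ∀ s ∈ shuffleMonomials S, ∀ t ∈ shuffleMonomials S, s ≠ t → lt s t ∨ lt t s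
  comp_left : ∀ (S U : Finset ℕ) (i : ℕ), i ∈ S → Disjoint (S.erase i) U →
    ∀ s ∈ shuffleMonomials S, ∀ s' ∈ shuffleMonomials S, ∀ u ∈ shuffleMonomials U,
    (∀ j ∈ S.erase i, j < i ↔ j < u.minLeaf) → lt s s' → lt (s.graft i u) (s'.graft i u)
  comp_right : ∀ (S U : Finset ℕ) (i : ℕ), i ∈ S → Disjoint (S.erase i) U →
    ∀ s ∈ shuffleMonomials S, ∀ u ∈ shuffleMonomials U, ∀ u' ∈ shuffleMonomials U,
    (∀ j ∈ S.erase i, j < i ↔ j < u.minLeaf) → lt u u' → lt (s.graft i u) (s.graft i u')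

/-! ### Operads given by generators `ν`, `μ` and relations -/

section Presentation

variable (K : Type*) [Field K]

/-- The component with label set `S` of the free operad on a binary and a ternary operation
without symmetries. The symmetries of the generators are imposed below as relations. -/
def multilin (S : Finset ℕ) : Submodule K (Tree →₀ K) := Finsupp.supported K K (treeMonomials S)

/-- The span of the shuffle tree monomials with label set `S`. These form a basis of the component
of the free operad on a skew-symmetric `ν` and a symmetric `μ`, so this space is that
component as well as the component of the free shuffle operad on `ν`, `μ`. -/
def shuffleSpan (S : Finset ℕ) : Submodule K (Tree →₀ K) :=
  Finsupp.supported K K (shuffleMonomials S)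

variable {K}

/-- Relabelling, extended linearly. -/
def relabel (σ : Equiv.Perm ℕ) (p : Tree →₀ K) : Tree →₀ K := p.mapDomain (Tree.relabel σ)

/-- Partial composition, extended bilinearly. -/
def comp (i : ℕ) (p q : Tree →₀ K) : Tree →₀ K :=
  p.sum fun s a => q.sum fun u b => Finsupp.single (s.graft i u) (a * b)

variable (K)

/-- Operadic ideals. -/
structure IsOperadIdeal (I : Finset ℕ → Submodule K (Tree →₀ K)) : Prop where
  le : ∀ S, I S ≤ multilin K S
  relabel_mem : ∀ (σ : Equiv.Perm ℕ) (S : Finset ℕ), ∀ p ∈ I S, relabel σ p ∈ I (S.image σ)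
  comp_mem_left : ∀ (S U : Finset ℕ) (i : ℕ), i ∈ S → Disjoint (S.erase i) U →
    ∀ p ∈ I S, ∀ q ∈ multilin K U, comp i p q ∈ I (S.erase i ∪ U)
  comp_mem_right : ∀ (S U : Finset ℕ) (i : ℕ), i ∈ S → Disjoint (S.erase i) U →
    ∀ p ∈ multilin K S, ∀ q ∈ I U, comp i p q ∈ I (S.erase i ∪ U)

/-- The operadic ideal generated by the sets `R n` of elements of arity `n`. -/
def operadIdeal (R : ℕ → Set (Tree →₀ K)) (S : Finset ℕ) : Submodule K (Tree →₀ K) :=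
  sInf {N | ∃ I : Finset ℕ → Submodule K (Tree →₀ K),
    IsOperadIdeal K I ∧ (∀ n, ∀ r ∈ R n, r ∈ I (std n)) ∧ N = I S}

variable {K}

/-- A tree as an element of the free operad. -/
def mon (t : Tree) : Tree →₀ K := Finsupp.single t 1

open FlipOperad.Tree

variable (K)

/-- `ν` is skew-symmetric and `μ` is symmetric. -/
def symmetryRelations : ℕ → Set (Tree →₀ K)
  | 2 => {mon (nu (leaf 1) (leaf 2)) + mon (nu (leaf 2) (leaf 1))}
  | 3 => {mon (mu (leaf 1) (leaf 2) (leaf 3)) - mon (mu (leaf 2) (leaf 1) (leaf 3)),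
          mon (mu (leaf 1) (leaf 2) (leaf 3)) - mon (mu (leaf 1) (leaf 3) (leaf 2))}
  | _ => ∅

/-- The Jacobi identity. -/
def jacobi : Tree →₀ K :=
  mon (nu (nu (leaf 1) (leaf 2)) (leaf 3)) + mon (nu (nu (leaf 2) (leaf 3)) (leaf 1))
    + mon (nu (nu (leaf 3) (leaf 1)) (leaf 2))

/-- The Leibniz rule. -/
def leibniz : Tree →₀ K :=
  mon (nu (mu (leaf 1) (leaf 2) (leaf 3)) (leaf 4))
    - (mon (mu (leaf 1) (leaf 2) (nu (leaf 3) (leaf 4)))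
      + mon (mu (leaf 1) (nu (leaf 2) (leaf 4)) (leaf 3))
      + mon (mu (nu (leaf 1) (leaf 4)) (leaf 2) (leaf 3)))

variable {K}

/-- A multilinear operation that becomes
`3 μ(ν(a,b),ν(a,b),a) + 6 μ(ν(a,ν(a,b)),a,b) + 6/5 ν(b,ν(a,ν(a,ν(a,b)))) + 18/5 ν(a,ν(b,ν(a,ν(b,a))))`
for `a₁ = a₂ = a₃ = a` and `b₁ = b₂ = b`. -/
def preB (a₁ a₂ a₃ b₁ b₂ : Tree) : Tree →₀ K :=
  (3 : K) • mon (mu (nu a₁ b₁) (nu a₂ b₂) a₃)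
    + (6 : K) • mon (mu (nu a₁ (nu a₂ b₁)) a₃ b₂)
    + (6 / 5 : K) • mon (nu b₁ (nu a₁ (nu a₂ (nu a₃ b₂))))
    + (18 / 5 : K) • mon (nu a₁ (nu b₁ (nu a₂ (nu b₂ a₃))))

/-- The polarization of the operation above: the multilinear operation with the same values for
`a₁ = a₂ = a₃`, `b₁ = b₂` that is symmetric in `a₁, a₂, a₃` and in `b₁, b₂`. -/
def polB (a₁ a₂ a₃ b₁ b₂ : Tree) : Tree →₀ K :=
  (1 / 12 : K) • ∑ σ : Equiv.Perm (Fin 3), ∑ π : Equiv.Perm (Fin 2),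
    preB (![a₁, a₂, a₃] (σ 0)) (![a₁, a₂, a₃] (σ 1)) (![a₁, a₂, a₃] (σ 2))
      (![b₁, b₂] (π 0)) (![b₁, b₂] (π 1))

variable (K)

/-- The deformed generalized associativity relation. -/
def deformedAssoc : Tree →₀ K :=
  (mon (mu (mu (leaf 1) (leaf 2) (leaf 4)) (leaf 3) (leaf 5))
      - mon (mu (mu (leaf 1) (leaf 2) (leaf 3)) (leaf 4) (leaf 5)))
    - (polB (leaf 1) (leaf 2) (leaf 4) (leaf 3) (leaf 5)
      - polB (leaf 1) (leaf 2) (leaf 3) (leaf 4) (leaf 5))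

/-- The defining relations. -/
def relations : ℕ → Set (Tree →₀ K)
  | 3 => {jacobi K}
  | 4 => {leibniz K}
  | 5 => {deformedAssoc K}
  | _ => ∅

/-- The ideal generated by the symmetry relations; modulo it one has the free operad on a
skew-symmetric binary `ν` and a symmetric ternary `μ`. -/
def symmetryIdeal (S : Finset ℕ) : Submodule K (Tree →₀ K) := operadIdeal K (symmetryRelations K) S

/-- The ideal generated by the symmetry relations and the defining relations. -/
def presIdeal (S : Finset ℕ) : Submodule K (Tree →₀ K) :=
  operadIdeal K (fun n => symmetryRelations K n ∪ relations K n) S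

/-- The value of a tree monomial in the associative operad. -/
def evalTree : Tree → FreeAlgebra K ℕ
  | leaf i => X K i
  | nu a b => comm2 (evalTree a) (evalTree b)
  | mu a b c => sym3 (evalTree a) (evalTree b) (evalTree c)

/-- The morphism from the free operad to the associative operad with `ν ↦ ν₂`, `μ ↦ μ₃`. -/
def evalAs : (Tree →₀ K) →ₗ[K] FreeAlgebra K ℕ := Finsupp.linearCombination K (evalTree K)

/-! ### Gröbner bases -/

/-- The defining relations and everything obtained from them by permutations of the inputs, as
elements of the free shuffle operad: an element of the span of the shuffle monomials represents
`r` if it equals `r` modulo the symmetries of `ν` and `μ`. -/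
def shuffleRelations (n : ℕ) : Set (Tree →₀ K) :=
  {g | g ∈ shuffleSpan K (std n) ∧ ∃ r ∈ relations K n, ∃ σ : Equiv.Perm ℕ,
    (std n).image σ = std n ∧ g - relabel σ r ∈ symmetryIdeal K (std n)}

variable {K}

/-- `t` is the leading monomial of `f`. -/
def IsLeading (lt : Tree → Tree → Prop) (f : Tree →₀ K) (t : Tree) : Prop :=
  t ∈ f.support ∧ ∀ s ∈ f.support, s ≠ t → lt s t

/-- `G` is a Gröbner basis of the ideal `I` of the free (shuffle) operad: it consists of
elements of `I`, and the leading monomial of every nonzero element of `I` is divisible by the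
leading monomial of an element of `G`. -/
def IsGroebnerBasis (lt : Tree → Tree → Prop) (G : ℕ → Set (Tree →₀ K))
    (I : Finset ℕ → Submodule K (Tree →₀ K)) : Prop :=
  (∀ n, ∀ g ∈ G n, g ∈ shuffleSpan K (std n) ∧ g ∈ I (std n)) ∧
  ∀ n, ∀ f ∈ shuffleSpan K (std n), f ∈ I (std n) → f ≠ 0 →
    ∃ t, IsLeading lt f t ∧ ∃ k, ∃ g ∈ G k, ∃ s, IsLeading lt g s ∧ s.Divides t

end Presentation

end FlipOperad

end

noncomputable section

namespace FlipOperad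

open Finset

/-! ### Substitution, path words and minima of trees -/

namespace Tree

/-! The Gröbner property is obtained from a dimension count; no S-polynomial is ever reduced. Three
facts are combined: the relations hold in the associative operad, the values of trees span all
invariants, and there are few normal forms with respect to the known leading monomials.

Image (`flipSum_mem_image`). Take a product of values of trees and add its reversal with the sign
that makes it `τ`-invariant. Modulo values of trees the order of the factors does not matter,
because exchanging two neighbours produces the same kind of expression with the two replaced by
their commutator, hence with one factor less. A product of even length is thus congruent to its own
negative, and six times a product of odd length at least three is congruent to a value of `μ₃` on a
shorter product and two trees. Since `p + τ p = 2 p` for an invariant `p`, every invariant is a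
value of the free operad (`image_eq_asInv`).

Kernel. Jacobi and Leibniz are immediate, and the deformed associativity is a finite computation
with words in five letters (`evalAs_deformedAssoc`). Rewriting by leading monomials shows that the
normal forms span the free operad modulo the ideal (`mem_sup_normalForms`), so their values span the
invariants.

Counting. The leading monomials found explicitly are one for Jacobi, four for Leibniz and nine for
associativity: of the ten ways to compose `μ` with itself, only `μ(μ(1,2,3),4,5)` survives. Hence
normal forms are left-nested towers of `μ` on normal Lie monomials (`isNormal_of_not_divides`).
Writing the Lie monomials as blocks, the last one first, turns such a tower into a permutation whose
left-to-right minima are the first letters of the blocks. The number of blocks is odd, and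
exchanging the first two letters changes the parity of the number of left-to-right minima, so for `n
≥ 2` there are at most `n!/2` normal forms. The invariants contain `n!/2` independent elements, one
for each pair of mutually reversed words. A spanning family no larger than the dimension is
independent (`linearIndepOn_normalForms`).

Independence of the values of the normal forms then says at once that the kernel is the ideal
(`mem_presIdeal_iff`) and that no leading monomial of a nonzero element of the ideal is normal
(`isGroebnerBasis_of_linearIndepOn`). -/

lemma exists_cons_leaves : ∀ t : Tree, ∃ i l, t.leaves = i :: l
  | leaf i => ⟨i, [], rfl⟩
  | nu a b => by
      obtain ⟨i, l, h⟩ := exists_cons_leaves a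
      exact ⟨i, l ++ b.leaves, by simp [leaves, h]⟩
  | mu a b c => by
      obtain ⟨i, l, h⟩ := exists_cons_leaves a
      exact ⟨i, l ++ (b.leaves ++ c.leaves), by simp [leaves, h]⟩

lemma leaves_ne_nil (t : Tree) : t.leaves ≠ [] := by
  obtain ⟨i, l, h⟩ := exists_cons_leaves t
  simp [h]

@[simp] lemma mem_labels {i : ℕ} {t : Tree} : i ∈ t.labels ↔ i ∈ t.leaves := by
  simp [labels]

@[simp] lemma labels_leaf (i : ℕ) : (leaf i).labels = {i} := by simp [labels, leaves]
lemma labels_nu (a b : Tree) : (nu a b).labels = a.labels ∪ b.labels := by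
  simp [labels, leaves]
lemma labels_mu (a b c : Tree) : (mu a b c).labels = a.labels ∪ b.labels ∪ c.labels := by
  simp [labels, leaves]

lemma minLeaf_mem (t : Tree) : t.minLeaf ∈ t.leaves := by
  induction t with
  | leaf i => simp [minLeaf, leaves]
  | nu a b ha hb =>
    simp only [minLeaf, leaves, List.mem_append]
    rcases min_choice a.minLeaf b.minLeaf with h | h <;> rw [h] <;> simp [ha, hb]
  | mu a b c ha hb hc =>
    simp only [minLeaf, leaves, List.mem_append]
    rcases min_choice a.minLeaf (min b.minLeaf c.minLeaf) with h | h <;> rw [h]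
    · simp [ha]
    · rcases min_choice b.minLeaf c.minLeaf with h | h <;> rw [h] <;> simp [hb, hc]

lemma minLeaf_le {t : Tree} {i : ℕ} (h : i ∈ t.leaves) : t.minLeaf ≤ i := by
  induction t with
  | leaf j => simp_all [minLeaf, leaves]
  | nu a b ha hb =>
    simp only [minLeaf, leaves, List.mem_append] at h ⊢
    rcases h with h | h
    · exact (min_le_left _ _).trans (ha h)
    · exact (min_le_right _ _).trans (hb h)
  | mu a b c ha hb hc =>
    simp only [minLeaf, leaves, List.mem_append] at h ⊢
    rcases h with (h | h) | h
    · exact (min_le_left _ _).trans (ha h)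
    · exact ((min_le_right _ _).trans (min_le_left _ _)).trans (hb h)
    · exact ((min_le_right _ _).trans (min_le_right _ _)).trans (hc h)

lemma minLeaf_eq_of_labels_eq {s t : Tree} (h : s.labels = t.labels) : s.minLeaf = t.minLeaf := by
  refine le_antisymm (minLeaf_le ?_) (minLeaf_le ?_)
  · rw [← mem_labels, h, mem_labels]; exact minLeaf_mem t
  · rw [← mem_labels, ← h, mem_labels]; exact minLeaf_mem s

lemma IsShuffle.minLeaf_nu {a b : Tree} (h : (nu a b).IsShuffle) :
    (nu a b).minLeaf = a.minLeaf := min_eq_left h.1.le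

lemma IsShuffle.minLeaf_mu {a b c : Tree} (h : (mu a b c).IsShuffle) :
    (mu a b c).minLeaf = a.minLeaf :=
  min_eq_left (le_min h.1.le (h.1.trans h.2.1).le)

/-- At each vertex of a shuffle tree the smallest label sits in the first input, hence in the first
leaf. This makes the tie-break by leaf sequences compatible with substitution, and later lets blocks
of words be recognized by their first letters. -/
lemma IsShuffle.exists_leaves_eq {t : Tree} (h : t.IsShuffle) :
    ∃ l, t.leaves = t.minLeaf :: l := by
  induction t with
  | leaf i => exact ⟨[], rfl⟩
  | nu a b ha _ =>
    obtain ⟨l, hl⟩ := ha h.2.1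
    exact ⟨l ++ b.leaves, by rw [h.minLeaf_nu, leaves, hl]; simp⟩
  | mu a b c ha _ _ =>
    obtain ⟨l, hl⟩ := ha h.2.2.1
    exact ⟨l ++ (b.leaves ++ c.leaves), by rw [h.minLeaf_mu, leaves, hl]; simp⟩

lemma leaves_bind (f : ℕ → Tree) (t : Tree) :
    (t.bind f).leaves = t.leaves.flatMap fun j => (f j).leaves := by
  induction t with
  | leaf i => simp [bind, leaves]
  | nu a b ha hb => simp [bind, leaves, ha, hb]
  | mu a b c ha hb hc => simp [bind, leaves, ha, hb, hc]

lemma labels_bind (f : ℕ → Tree) (t : Tree) :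
    (t.bind f).labels = t.labels.biUnion fun j => (f j).labels := by
  ext k; simp [leaves_bind]

lemma degree_bind (f : ℕ → Tree) (t : Tree) :
    (t.bind f).degree = t.degree + (t.leaves.map fun j => (f j).degree).sum := by
  induction t with
  | leaf i => simp [bind, leaves, degree]
  | nu a b ha hb => simp [bind, leaves, degree, ha, hb]; ring
  | mu a b c ha hb hc => simp [bind, leaves, degree, ha, hb, hc]; ring

lemma bind_congr {f g : ℕ → Tree} {t : Tree} (h : ∀ i ∈ t.leaves, f i = g i) :
    t.bind f = t.bind g := by
  induction t with
  | leaf i => exact h i (by simp [leaves])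
  | nu a b ha hb =>
    simp only [leaves, List.mem_append] at h
    rw [bind, bind, ha fun i hi => h i (.inl hi), hb fun i hi => h i (.inr hi)]
  | mu a b c ha hb hc =>
    simp only [leaves, List.mem_append] at h
    rw [bind, bind, ha fun i hi => h i (.inl (.inl hi)), hb fun i hi => h i (.inl (.inr hi)),
      hc fun i hi => h i (.inr hi)]

@[simp] lemma bind_leaf (t : Tree) : t.bind leaf = t := by
  induction t with
  | leaf i => rfl
  | nu a b ha hb => rw [bind, ha, hb]
  | mu a b c ha hb hc => rw [bind, ha, hb, hc]

lemma bind_bind (f g : ℕ → Tree) (t : Tree) :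
    (t.bind f).bind g = t.bind fun j => (f j).bind g := by
  induction t with
  | leaf i => rfl
  | nu a b ha hb => simp only [bind, ha, hb]
  | mu a b c ha hb hc => simp only [bind, ha, hb, hc]

/-- As `k` comes from the tree put on `j` and from no other, the path to it has to run through the
former leaf `j`. -/
lemma path_bind {f : ℕ → Tree} {t : Tree} {j k : ℕ} (hj : j ∈ t.leaves) (hk : k ∈ (f j).leaves)
    (h : ∀ i ∈ t.leaves, k ∈ (f i).leaves → i = j) :
    (t.bind f).path k = t.path j ++ (f j).path k := by
  have mem : ∀ a : Tree, (∀ i ∈ a.leaves, i ∈ t.leaves) →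
      (k ∈ (a.bind f).leaves ↔ j ∈ a.leaves) := by
    intro a ha
    simp only [leaves_bind, List.mem_flatMap]
    refine ⟨fun ⟨i, hi, hki⟩ => h i (ha i hi) hki ▸ hi, fun hja => ⟨j, hja, hk⟩⟩
  induction t with
  | leaf i =>
    obtain rfl : j = i := by simpa [leaves] using hj
    simp [bind, path]
  | nu a b ha hb =>
    simp only [leaves, List.mem_append] at h hj mem
    simp only [bind, path, mem a fun i hi => .inl hi]
    split_ifs with h1
    · rw [ha h1 (fun i hi => h i (.inl hi)) fun c hc => mem c fun i hi => .inl (hc i hi)]; simp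
    · rw [hb (hj.resolve_left h1) (fun i hi => h i (.inr hi))
        fun c hc => mem c fun i hi => .inr (hc i hi)]; simp
  | mu a b c ha hb hc =>
    simp only [leaves, List.mem_append] at h hj mem
    simp only [bind, path, mem a fun i hi => .inl (.inl hi), mem b fun i hi => .inl (.inr hi)]
    split_ifs with h1 h2
    · rw [ha h1 (fun i hi => h i (.inl (.inl hi)))
        fun c hc => mem c fun i hi => .inl (.inl (hc i hi))]; simp
    · rw [hb h2 (fun i hi => h i (.inl (.inr hi)))
        fun c hc => mem c fun i hi => .inl (.inr (hc i hi))]; simp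
    · rw [hc (hj.resolve_left (by tauto)) (fun i hi => h i (.inr hi))
        fun c hc => mem c fun i hi => .inr (hc i hi)]; simp

lemma minLeaf_bind {f : ℕ → Tree} {t : Tree}
    (h : ∀ i ∈ t.leaves, ∀ j ∈ t.leaves, i < j → (f i).minLeaf < (f j).minLeaf) :
    (t.bind f).minLeaf = (f t.minLeaf).minLeaf := by
  apply le_antisymm
  · apply minLeaf_le
    rw [leaves_bind, List.mem_flatMap]
    exact ⟨_, minLeaf_mem t, minLeaf_mem _⟩
  · have := minLeaf_mem (t.bind f)
    rw [leaves_bind, List.mem_flatMap] at this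
    obtain ⟨j, hj, hk⟩ := this
    refine le_trans ?_ (minLeaf_le hk)
    rcases (minLeaf_le hj).eq_or_lt with e | e
    · rw [e]
    · exact (h _ (minLeaf_mem t) _ hj e).le

lemma IsShuffle.bind {f : ℕ → Tree} {t : Tree} (ht : t.IsShuffle)
    (hf : ∀ i ∈ t.leaves, (f i).IsShuffle)
    (h : ∀ i ∈ t.leaves, ∀ j ∈ t.leaves, i < j → (f i).minLeaf < (f j).minLeaf) :
    (t.bind f).IsShuffle := by
  induction t with
  | leaf i => exact hf i (by simp [leaves])
  | nu a b ha hb =>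
    simp only [leaves, List.mem_append] at h hf
    refine ⟨?_, ha ht.2.1 (fun i hi => hf i (.inl hi)) fun i hi j hj => h i (.inl hi) j (.inl hj),
      hb ht.2.2 (fun i hi => hf i (.inr hi)) fun i hi j hj => h i (.inr hi) j (.inr hj)⟩
    rw [minLeaf_bind fun i hi j hj => h i (.inl hi) j (.inl hj),
      minLeaf_bind fun i hi j hj => h i (.inr hi) j (.inr hj)]
    exact h _ (.inl (minLeaf_mem a)) _ (.inr (minLeaf_mem b)) ht.1
  | mu a b c ha hb hc =>
    simp only [leaves, List.mem_append] at h hf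
    have A : ∀ i ∈ a.leaves, (i ∈ a.leaves ∨ i ∈ b.leaves) ∨ i ∈ c.leaves :=
      fun i hi => .inl (.inl hi)
    have B : ∀ i ∈ b.leaves, (i ∈ a.leaves ∨ i ∈ b.leaves) ∨ i ∈ c.leaves :=
      fun i hi => .inl (.inr hi)
    have C : ∀ i ∈ c.leaves, (i ∈ a.leaves ∨ i ∈ b.leaves) ∨ i ∈ c.leaves :=
      fun i hi => .inr hi
    refine ⟨?_, ?_, ha ht.2.2.1 (fun i hi => hf i (A i hi))
        fun i hi j hj => h i (A i hi) j (A j hj),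
      hb ht.2.2.2.1 (fun i hi => hf i (B i hi)) fun i hi j hj => h i (B i hi) j (B j hj),
      hc ht.2.2.2.2 (fun i hi => hf i (C i hi)) fun i hi j hj => h i (C i hi) j (C j hj)⟩
    · rw [minLeaf_bind fun i hi j hj => h i (A i hi) j (A j hj),
        minLeaf_bind fun i hi j hj => h i (B i hi) j (B j hj)]
      exact h _ (A _ (minLeaf_mem a)) _ (B _ (minLeaf_mem b)) ht.1
    · rw [minLeaf_bind fun i hi j hj => h i (B i hi) j (B j hj),
        minLeaf_bind fun i hi j hj => h i (C i hi) j (C j hj)]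
      exact h _ (B _ (minLeaf_mem b)) _ (C _ (minLeaf_mem c)) ht.2.1

end Tree

open FlipOperad.Tree

/-! ### Label sets of substituted and grafted trees -/

lemma bind_mem_treeMonomials {S : Finset ℕ} {U : ℕ → Finset ℕ} {f : ℕ → Tree} {t : Tree}
    (ht : t ∈ treeMonomials S) (hf : ∀ i ∈ S, f i ∈ treeMonomials (U i))
    (hU : ∀ i ∈ S, ∀ j ∈ S, i ≠ j → Disjoint (U i) (U j)) :
    t.bind f ∈ treeMonomials (S.biUnion U) := by
  have hm : ∀ i, i ∈ t.leaves ↔ i ∈ S := fun i => by rw [← ht.2, mem_labels]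
  refine ⟨?_, ?_⟩
  · rw [leaves_bind, List.nodup_flatMap]
    refine ⟨fun i hi => (hf i ((hm i).1 hi)).1, ?_⟩
    refine ht.1.imp_of_mem fun {i j} hi hj hij => ?_
    rw [hm] at hi hj
    have := hU i hi j hj hij
    rw [← (hf i hi).2, ← (hf j hj).2, Finset.disjoint_left] at this
    intro k hk hk'
    exact this (mem_labels.2 hk) (mem_labels.2 hk')
  · rw [labels_bind, ht.2]
    exact Finset.biUnion_congr rfl fun i hi => (hf i hi).2

lemma bind_mem_shuffleMonomials {S : Finset ℕ} {U : ℕ → Finset ℕ} {f : ℕ → Tree} {t : Tree}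
    (ht : t ∈ shuffleMonomials S) (hf : ∀ i ∈ S, f i ∈ shuffleMonomials (U i))
    (hU : ∀ i ∈ S, ∀ j ∈ S, i ≠ j → Disjoint (U i) (U j))
    (h : ∀ i ∈ S, ∀ j ∈ S, i < j → (f i).minLeaf < (f j).minLeaf) :
    t.bind f ∈ shuffleMonomials (S.biUnion U) := by
  have hm : ∀ i, i ∈ t.leaves ↔ i ∈ S := fun i => by rw [← ht.1.2, mem_labels]
  refine ⟨bind_mem_treeMonomials ht.1 (fun i hi => (hf i hi).1) hU, ht.2.bind ?_ ?_⟩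
  · exact fun i hi => (hf i ((hm i).1 hi)).2
  · exact fun i hi j hj => h i ((hm i).1 hi) j ((hm j).1 hj)

/-- The label sets of the trees that `graft i` puts on the leaves. -/
def graftLabels (i : ℕ) (U : Finset ℕ) (j : ℕ) : Finset ℕ := if j = i then U else {j}

lemma biUnion_graftLabels {S U : Finset ℕ} {i : ℕ} (hi : i ∈ S) :
    S.biUnion (graftLabels i U) = S.erase i ∪ U := by
  ext k
  simp only [graftLabels, mem_biUnion, mem_union, mem_erase]
  constructor
  · rintro ⟨j, hj, hk⟩
    split_ifs at hk with h
    · exact .inr hk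
    · rw [mem_singleton] at hk; subst hk; exact .inl ⟨h, hj⟩
  · rintro (⟨h, hk⟩ | hk)
    · exact ⟨k, hk, by simp [h]⟩
    · exact ⟨i, hi, by simpa using hk⟩

lemma disjoint_graftLabels {S U : Finset ℕ} {i : ℕ} (h : Disjoint (S.erase i) U) :
    ∀ j ∈ S, ∀ k ∈ S, j ≠ k → Disjoint (graftLabels i U j) (graftLabels i U k) := by
  intro j hj k hk hjk
  rw [Finset.disjoint_left] at h
  unfold graftLabels
  split_ifs with h1 h2 h2
  · exact absurd (h1.trans h2.symm) hjk
  · exact Finset.disjoint_singleton_right.2 (h (mem_erase.2 ⟨h2, hk⟩))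
  · exact Finset.disjoint_singleton_left.2 (h (mem_erase.2 ⟨h1, hj⟩))
  · simpa using hjk

lemma leaf_mem_shuffleMonomials (j : ℕ) : leaf j ∈ shuffleMonomials {j} := by
  refine ⟨⟨by simp [leaves], by simp⟩, trivial⟩

lemma graft_mem_treeMonomials {S U : Finset ℕ} {i : ℕ} (hi : i ∈ S) (h : Disjoint (S.erase i) U)
    {s u : Tree} (hs : s ∈ treeMonomials S) (hu : u ∈ treeMonomials U) :
    s.graft i u ∈ treeMonomials (S.erase i ∪ U) := by
  rw [← biUnion_graftLabels hi]
  refine bind_mem_treeMonomials hs (fun j _ => ?_) (disjoint_graftLabels h)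
  unfold graftLabels
  split_ifs
  · exact hu
  · exact (leaf_mem_shuffleMonomials j).1

/-- The position of the smallest label of `u` is that of the label `i`. -/
lemma minLeaf_graft_lt {S : Finset ℕ} {i : ℕ} {u : Tree} (hi : i ∈ S)
    (hp : ∀ j ∈ S.erase i, j < i ↔ j < u.minLeaf) (hu : u.minLeaf ∉ S.erase i) :
    ∀ j ∈ S, ∀ k ∈ S, j < k →
      (if j = i then u else leaf j).minLeaf < (if k = i then u else leaf k).minLeaf := by
  intro j hj k hk hjk
  split_ifs with h1 h2 h2
  · omega
  · subst h1
    have := hp k (mem_erase.2 ⟨h2, hk⟩)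
    have h3 : u.minLeaf ≠ k := fun e => hu (e ▸ mem_erase.2 ⟨h2, hk⟩)
    simp only [minLeaf]; omega
  · subst h2
    exact (hp j (mem_erase.2 ⟨h1, hj⟩)).1 hjk
  · exact hjk

lemma minLeaf_mem_of_mem {U : Finset ℕ} {u : Tree} (hu : u ∈ treeMonomials U) : u.minLeaf ∈ U := by
  rw [← hu.2, mem_labels]; exact minLeaf_mem u

lemma graft_mem_shuffleMonomials {S U : Finset ℕ} {i : ℕ} (hi : i ∈ S)
    (h : Disjoint (S.erase i) U) {s u : Tree} (hs : s ∈ shuffleMonomials S)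
    (hu : u ∈ shuffleMonomials U) (hp : ∀ j ∈ S.erase i, j < i ↔ j < u.minLeaf) :
    s.graft i u ∈ shuffleMonomials (S.erase i ∪ U) := by
  rw [← biUnion_graftLabels hi]
  refine bind_mem_shuffleMonomials hs (fun j _ => ?_) (disjoint_graftLabels h)
    (minLeaf_graft_lt hi hp ?_)
  · unfold graftLabels
    split_ifs
    · exact hu
    · exact leaf_mem_shuffleMonomials j
  · exact Finset.disjoint_right.1 h (minLeaf_mem_of_mem hu.1)

/-! ### The order -/

/-- In an increasing list of labels, "earlier in the list" means "smaller label", so the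
lexicographic comparison is decided at the smallest label where `f` and `g` differ. -/
lemma list_map_lt_map_iff {α : Type*} [LinearOrder α] (f g : ℕ → α) {l : List ℕ}
    (hl : l.Pairwise (· < ·)) :
    l.map f < l.map g ↔ ∃ j ∈ l, f j < g j ∧ ∀ k ∈ l, k < j → f k = g k := by
  induction l with
  | nil => simp
  | cons a l ih =>
    rw [List.pairwise_cons] at hl
    rw [List.map_cons, List.map_cons, List.cons_lt_cons_iff, ih hl.2]
    constructor
    · rintro (h | ⟨h, j, hj, hlt, hk⟩)
      · refine ⟨a, by simp, h, fun k hk hka => ?_⟩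
        rcases List.mem_cons.1 hk with rfl | hk
        · exact absurd hka (lt_irrefl _)
        · exact absurd (hl.1 k hk) hka.not_gt
      · refine ⟨j, by simp [hj], hlt, fun k hk' hkj => ?_⟩
        rcases List.mem_cons.1 hk' with rfl | hk'
        · exact h
        · exact hk k hk' hkj
    · rintro ⟨j, hj, hlt, hk⟩
      rcases List.mem_cons.1 hj with rfl | hj
      · exact .inl hlt
      · exact .inr ⟨hk a (by simp) (hl.1 j hj), j, hj, hlt, fun k hk' => hk k (by simp [hk'])⟩

lemma sort_map_lt_iff {α : Type*} [LinearOrder α] (S : Finset ℕ) (f g : ℕ → α) :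
    (S.sort (· ≤ ·)).map f < (S.sort (· ≤ ·)).map g ↔
      ∃ j ∈ S, f j < g j ∧ ∀ k ∈ S, k < j → f k = g k := by
  rw [list_map_lt_map_iff f g (Finset.sortedLT_sort S).pairwise]
  simp

lemma sort_map_eq_iff {α : Type*} (S : Finset ℕ) (f g : ℕ → α) :
    (S.sort (· ≤ ·)).map f = (S.sort (· ≤ ·)).map g ↔ ∀ j ∈ S, f j = g j := by
  rw [List.map_inj_left]; simp

lemma degPathLex_iff {S : Finset ℕ} {s t : Tree} (hs : s.labels = S) (ht : t.labels = S) :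
    degPathLex s t ↔ t.degree < s.degree ∨ (s.degree = t.degree ∧
      ((∃ j ∈ S, wordKey (s.path j) < wordKey (t.path j) ∧
          ∀ k ∈ S, k < j → wordKey (s.path k) = wordKey (t.path k)) ∨
        ((∀ j ∈ S, wordKey (s.path j) = wordKey (t.path j)) ∧ t.leaves < s.leaves))) := by
  unfold degPathLex treeKey
  rw [hs, ht, Prod.Lex.toLex_lt_toLex, Prod.Lex.toLex_lt_toLex, OrderDual.toDual_lt_toDual,
    OrderDual.toDual_lt_toDual, sort_map_lt_iff, sort_map_eq_iff]
  simp only [OrderDual.toDual_inj]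

lemma wordKey_injective : Function.Injective wordKey := by
  intro w v h
  have := congrArg (fun x => (ofLex (ofLex x).2).2) h
  exact this

lemma wordKey_lt_iff {w v : List Bool} : wordKey w < wordKey v ↔
    w.count true < v.count true ∨ (w.count true = v.count true ∧
      (v.count false < w.count false ∨ (w.count false = v.count false ∧ w < v))) := by
  unfold wordKey
  rw [Prod.Lex.toLex_lt_toLex, Prod.Lex.toLex_lt_toLex, OrderDual.toDual_lt_toDual]
  simp only [OrderDual.toDual_inj]

lemma append_lt_append_of_length_eq {α : Type*} [LinearOrder α] {l l' : List α}
    (h : l < l') (hl : l.length = l'.length) (x y : List α) : l ++ x < l' ++ y := by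
  induction l generalizing l' with
  | nil => cases l' with
    | nil => exact absurd h (lt_irrefl _)
    | cons => simp at hl
  | cons a l ih => cases l' with
    | nil => simp at hl
    | cons b l' =>
      rw [List.cons_lt_cons_iff] at h
      rw [List.cons_append, List.cons_append, List.cons_lt_cons_iff]
      rcases h with h | ⟨h, h'⟩
      · exact .inl h
      · exact .inr ⟨h, ih h' (by simpa using hl)⟩

lemma append_left_lt {α : Type*} [LinearOrder α] {l l' : List α} (h : l < l') (x : List α) :
    x ++ l < x ++ l' := by
  induction x with
  | nil => exact h
  | cons a x ih =>
    rw [List.cons_append, List.cons_append, List.cons_lt_cons_iff]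
    exact .inr ⟨rfl, ih⟩

lemma length_eq_count (w : List Bool) : w.length = w.count true + w.count false := by
  induction w with
  | nil => rfl
  | cons a w ih => cases a <;> simp only [List.length_cons, ih, List.count_cons] <;> simp <;> omega

/-- When both letter counts agree the two words have the same length, so the lexicographic
comparison is decided before the appended suffix begins. For the bare lexicographic order of words
this would fail when one word is a prefix of the other. -/
lemma wordKey_append_lt {w w' : List Bool} (h : wordKey w < wordKey w') (v : List Bool) :
    wordKey (w ++ v) < wordKey (w' ++ v) := by
  rw [wordKey_lt_iff] at h ⊢
  simp only [List.count_append]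
  rcases h with h | ⟨h1, h | ⟨h2, h⟩⟩
  · left; omega
  · right; refine ⟨by omega, .inl (by omega)⟩
  · refine .inr ⟨by omega, .inr ⟨by omega, append_lt_append_of_length_eq h ?_ v v⟩⟩
    rw [length_eq_count, length_eq_count, h1, h2]

lemma wordKey_append_left_lt {w w' : List Bool} (h : wordKey w < wordKey w') (v : List Bool) :
    wordKey (v ++ w) < wordKey (v ++ w') := by
  rw [wordKey_lt_iff] at h ⊢
  simp only [List.count_append]
  rcases h with h | ⟨h1, h | ⟨h2, h⟩⟩
  · left; omega
  · right; refine ⟨by omega, .inl (by omega)⟩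
  · exact .inr ⟨by omega, .inr ⟨by omega, append_left_lt h v⟩⟩

/-- Each letter `i` is replaced by a block beginning with `m i`; equal letters give equal blocks,
and at the first difference the first letters of the blocks already decide. -/
lemma flatMap_lt_flatMap {g : ℕ → List ℕ} {m : ℕ → ℕ} {l l' : List ℕ}
    (hg : ∀ i, (i ∈ l ∨ i ∈ l') → ∃ r, g i = m i :: r)
    (hm : ∀ i ∈ l, ∀ j ∈ l', i < j → m i < m j) (h : l < l') :
    l.flatMap g < l'.flatMap g := by
  induction l generalizing l' with
  | nil => cases l' with
    | nil => exact absurd h (lt_irrefl _)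
    | cons b l' =>
      obtain ⟨r, hr⟩ := hg b (by simp)
      simp [hr]
  | cons a l ih => cases l' with
    | nil => simp at h
    | cons b l' =>
      rw [List.cons_lt_cons_iff] at h
      rw [List.flatMap_cons, List.flatMap_cons]
      rcases h with h | ⟨rfl, h⟩
      · obtain ⟨r, hr⟩ := hg a (by simp)
        obtain ⟨r', hr'⟩ := hg b (by simp)
        rw [hr, hr', List.cons_append, List.cons_append, List.cons_lt_cons_iff]
        exact .inl (hm a (by simp) b (by simp) h)
      · refine append_left_lt (ih (fun i hi => hg i ?_) (fun i hi j hj => hm i ?_ j ?_) h) _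
        · rcases hi with h | h <;> simp [h]
        · simp [hi]
        · simp [hj]

lemma leaves_perm {S : Finset ℕ} {s t : Tree} (hs : s ∈ treeMonomials S)
    (ht : t ∈ treeMonomials S) : s.leaves.Perm t.leaves :=
  List.perm_of_nodup_nodup_toFinset_eq hs.1 ht.1 (hs.2.trans ht.2.symm)

/-- Substitution of shuffle trees for the leaves is monotone. -/
lemma degPathLex_bind {S : Finset ℕ} {U : ℕ → Finset ℕ} {f : ℕ → Tree} {s t : Tree}
    (hs : s ∈ shuffleMonomials S) (ht : t ∈ shuffleMonomials S)
    (hf : ∀ i ∈ S, f i ∈ shuffleMonomials (U i))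
    (hU : ∀ i ∈ S, ∀ j ∈ S, i ≠ j → Disjoint (U i) (U j))
    (h : ∀ i ∈ S, ∀ j ∈ S, i < j → (f i).minLeaf < (f j).minLeaf)
    (hst : degPathLex s t) : degPathLex (s.bind f) (t.bind f) := by
  have hms : ∀ i, i ∈ s.leaves ↔ i ∈ S := fun i => by rw [← hs.1.2, mem_labels]
  have hmt : ∀ i, i ∈ t.leaves ↔ i ∈ S := fun i => by rw [← ht.1.2, mem_labels]
  have hmf : ∀ i ∈ S, ∀ k, k ∈ (f i).leaves ↔ k ∈ U i := fun i hi k => by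
    rw [← (hf i hi).1.2, mem_labels]
  have uniq : ∀ i ∈ S, ∀ j ∈ S, ∀ k, k ∈ (f i).leaves → k ∈ (f j).leaves → i = j := by
    intro i hi j hj k hk hk'
    by_contra hij
    exact Finset.disjoint_left.1 (hU i hi j hj hij) ((hmf i hi k).1 hk) ((hmf j hj k).1 hk')
  have ps : ∀ j ∈ S, ∀ k ∈ (f j).leaves, (s.bind f).path k = s.path j ++ (f j).path k :=
    fun j hj k hk => path_bind ((hms j).2 hj) hk
      fun i hi hki => uniq i ((hms i).1 hi) j hj k hki hk
  have pt : ∀ j ∈ S, ∀ k ∈ (f j).leaves, (t.bind f).path k = t.path j ++ (f j).path k :=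
    fun j hj k hk => path_bind ((hmt j).2 hj) hk
      fun i hi hki => uniq i ((hmt i).1 hi) j hj k hki hk
  rw [degPathLex_iff (bind_mem_treeMonomials hs.1 (fun i hi => (hf i hi).1) hU).2
    (bind_mem_treeMonomials ht.1 (fun i hi => (hf i hi).1) hU).2]
  rw [degPathLex_iff hs.1.2 ht.1.2] at hst
  have hd : (s.leaves.map fun j => (f j).degree).sum = (t.leaves.map fun j => (f j).degree).sum :=
    ((leaves_perm hs.1 ht.1).map _).sum_eq
  rw [degree_bind, degree_bind, hd]
  have split : ∀ k ∈ S.biUnion U, ∃ j ∈ S, k ∈ (f j).leaves := by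
    intro k hk
    obtain ⟨j, hj, hk⟩ := mem_biUnion.1 hk
    exact ⟨j, hj, (hmf j hj k).2 hk⟩
  rcases hst with hst | ⟨hdeg, ⟨j, hj, hlt, hk⟩ | ⟨heq, hlt⟩⟩
  · left; omega
  -- A difference at the leaf `j` first becomes visible at the smallest label of `f j`: all smaller
  -- labels lie over leaves `i < j`, whose paths agree.
  · refine .inr ⟨by omega, .inl ⟨(f j).minLeaf, ?_, ?_, ?_⟩⟩
    · exact mem_biUnion.2 ⟨j, hj, (hmf j hj _).1 (minLeaf_mem _)⟩
    · rw [ps j hj _ (minLeaf_mem _), pt j hj _ (minLeaf_mem _)]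
      exact wordKey_append_lt hlt _
    · intro k hkS hkj
      obtain ⟨i, hi, hki⟩ := split k hkS
      have hij : i < j := by
        by_contra hij
        rcases (not_lt.1 hij).eq_or_lt with rfl | e
        · exact absurd (minLeaf_le hki) (not_le.2 hkj)
        · exact absurd ((h j hj i hi e).trans_le (minLeaf_le hki)) hkj.not_gt
      rw [ps i hi k hki, pt i hi k hki, wordKey_injective (hk i hi hij)]
  · refine .inr ⟨by omega, .inr ⟨?_, ?_⟩⟩
    · intro k hkS
      obtain ⟨i, hi, hki⟩ := split k hkS
      rw [ps i hi k hki, pt i hi k hki, wordKey_injective (heq i hi)]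
    · rw [leaves_bind, leaves_bind]
      refine flatMap_lt_flatMap (m := fun i => (f i).minLeaf) ?_ ?_ hlt
      · intro i hi
        rw [hms, hmt, or_self] at hi
        exact (hf i hi).2.exists_leaves_eq
      · intro i hi j hj
        exact h i ((hmt i).1 hi) j ((hms j).1 hj)

/-- Only the paths to labels in `U` change, and they all receive the same prefix `s.path i`; the
leaf sequences differ in a single block of fixed length. No shuffle condition enters, in contrast to
`degPathLex_bind`. -/
lemma degPathLex_graft_right {S U : Finset ℕ} {i : ℕ} (hi : i ∈ S)
    (hd : Disjoint (S.erase i) U) {s u v : Tree} (hs : s ∈ treeMonomials S)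
    (hu : u ∈ treeMonomials U) (hv : v ∈ treeMonomials U) (huv : degPathLex u v) :
    degPathLex (s.graft i u) (s.graft i v) := by
  have hms : ∀ j, j ∈ s.leaves ↔ j ∈ S := fun i => by rw [← hs.2, mem_labels]
  have hmu : ∀ j, j ∈ u.leaves ↔ j ∈ U := fun i => by rw [← hu.2, mem_labels]
  have hmv : ∀ j, j ∈ v.leaves ↔ j ∈ U := fun i => by rw [← hv.2, mem_labels]
  obtain ⟨l₁, l₂, hl⟩ := List.append_of_mem ((hms i).2 hi)
  have hnd := hs.1
  rw [hl, List.nodup_middle, List.nodup_cons, List.mem_append, not_or] at hnd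
  have hdeg : ∀ w : Tree, (s.graft i w).degree = s.degree + w.degree := by
    intro w
    rw [graft, degree_bind, hl]
    have : ∀ l : List ℕ, i ∉ l →
        (l.map fun j => (if j = i then w else leaf j).degree).sum = 0 := by
      intro l hl
      apply List.sum_eq_zero
      intro x hx
      obtain ⟨j, hj, rfl⟩ := List.mem_map.1 hx
      rw [if_neg (fun e => hl (by rwa [← e]))]; rfl
    simp [this _ hnd.1.1, this _ hnd.1.2]
  have hlv : ∀ w : Tree, (s.graft i w).leaves = l₁ ++ (w.leaves ++ l₂) := by
    intro w
    rw [graft, leaves_bind, hl]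
    have : ∀ l : List ℕ, i ∉ l →
        (l.flatMap fun j => (if j = i then w else leaf j).leaves) = l := by
      intro l hl
      induction l with
      | nil => rfl
      | cons a l ih =>
        rw [List.mem_cons, not_or] at hl
        rw [List.flatMap_cons, ih hl.2, if_neg (Ne.symm hl.1)]; rfl
    simp [this _ hnd.1.1, this _ hnd.1.2]
  have pin : ∀ w ∈ treeMonomials U, ∀ k ∈ U, (s.graft i w).path k = s.path i ++ w.path k := by
    intro w hw k hk
    have hkw : k ∈ w.leaves := by rw [← mem_labels, hw.2]; exact hk
    have := path_bind (f := fun j => if j = i then w else leaf j) (t := s) (j := i) (k := k)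
      ((hms i).2 hi) (by simpa using hkw) ?_
    · simpa [graft] using this
    · intro j hj hkj
      by_contra hji
      rw [if_neg hji] at hkj
      obtain rfl : k = j := by simpa [leaves] using hkj
      exact Finset.disjoint_left.1 hd (mem_erase.2 ⟨hji, (hms _).1 hj⟩) hk
  have pout : ∀ w ∈ treeMonomials U, ∀ k ∈ S.erase i, (s.graft i w).path k = s.path k := by
    intro w hw k hk
    have hki := (mem_erase.1 hk).1
    have := path_bind (f := fun j => if j = i then w else leaf j) (t := s) (j := k) (k := k)
      ((hms k).2 (mem_erase.1 hk).2) (by simp [hki, leaves]) ?_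
    · simpa [hki, path, graft] using this
    · intro j hj hkj
      split_ifs at hkj with hji
      · rw [← mem_labels, hw.2] at hkj
        exact absurd hkj (Finset.disjoint_left.1 hd hk)
      · simpa [leaves, eq_comm] using hkj
  rw [degPathLex_iff (graft_mem_treeMonomials hi hd hs hu).2
    (graft_mem_treeMonomials hi hd hs hv).2, hdeg, hdeg, hlv, hlv]
  rw [degPathLex_iff hu.2 hv.2] at huv
  have same : ∀ k ∈ S.erase i,
      wordKey ((s.graft i u).path k) = wordKey ((s.graft i v).path k) := fun k hk => by
    rw [pout u hu k hk, pout v hv k hk]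
  rcases huv with h | ⟨h, ⟨j, hj, hlt, hk⟩ | ⟨heq, hlt⟩⟩
  · left; omega
  · refine .inr ⟨by omega, .inl ⟨j, mem_union_right _ hj, ?_, fun k hk' hkj => ?_⟩⟩
    · rw [pin u hu j hj, pin v hv j hj]
      exact wordKey_append_left_lt hlt _
    · rcases mem_union.1 hk' with hk' | hk'
      · exact same k hk'
      · rw [pin u hu k hk', pin v hv k hk', wordKey_injective (hk k hk' hkj)]
  · refine .inr ⟨by omega, .inr ⟨fun k hk' => ?_, ?_⟩⟩
    · rcases mem_union.1 hk' with hk' | hk'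
      · exact same k hk'
      · rw [pin u hu k hk', pin v hv k hk', wordKey_injective (heq k hk')]
    · exact append_left_lt (append_lt_append_of_length_eq hlt (leaves_perm hv hu).length_eq _ _) _

/-- The path words of the leaves in planar order. -/
def pathWords : Tree → List (List Bool)
  | leaf _ => [[]]
  | nu a b => (pathWords a ++ pathWords b).map (true :: ·)
  | mu a b c => (pathWords a ++ pathWords b ++ pathWords c).map (false :: ·)

lemma pathWords_eq_map {t : Tree} (h : t.leaves.Nodup) :
    pathWords t = t.leaves.map fun i => t.path i := by
  induction t with
  | leaf i => rfl
  | nu a b ha hb =>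
    rw [leaves, List.nodup_append'] at h
    rw [pathWords, ha h.1, hb h.2.1, leaves, List.map_append, List.map_append, List.map_map,
      List.map_map]
    congr 1
    · exact List.map_congr_left fun i hi => by simp [path, hi]
    · exact List.map_congr_left fun i hi => by simp [path, show i ∉ a.leaves from fun hi' => h.2.2 hi' hi]
  | mu a b c ha hb hc =>
    rw [leaves, List.nodup_append', List.nodup_append'] at h
    rw [pathWords, ha h.1.1, hb h.1.2.1, hc h.2.1, leaves]
    simp only [List.map_append, List.map_map]
    congr 1
    · congr 1
      · exact List.map_congr_left fun i hi => by simp [path, hi]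
      · exact List.map_congr_left fun i hi => by simp [path, hi, show i ∉ a.leaves from fun hi' => h.1.2.2 hi' hi]
    · refine List.map_congr_left fun i hi => ?_
      have h1 : i ∉ a.leaves ∧ i ∉ b.leaves := by
        have := h.2.2.symm hi
        simpa using this
      simp [path, h1]

lemma length_leaves_eq_length_pathWords (t : Tree) : t.leaves.length = (pathWords t).length := by
  induction t with
  | leaf i => rfl
  | nu a b ha hb => simp [leaves, pathWords, ha, hb]
  | mu a b c ha hb hc => simp [leaves, pathWords, ha, hb, hc]

/-- The leaves with their path words, prefixed by `w`, determine the tree. -/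
lemma eq_of_pathWords (t t' : Tree) : ∀ (w : List Bool) (l l' : List (ℕ × List Bool)),
    (t.leaves.zip ((pathWords t).map (w ++ ·))) ++ l
      = (t'.leaves.zip ((pathWords t').map (w ++ ·))) ++ l' → t = t' ∧ l = l' := by
  have hd : ∀ (x : Bool) (s : Tree) (w : List Bool), ((pathWords s).map (x :: ·)).map (w ++ ·)
      = (pathWords s).map ((w ++ [x]) ++ ·) := by intros; simp
  have head : ∀ (s : Tree) (w : List Bool), ∃ i v r,
      s.leaves.zip ((pathWords s).map (w ++ ·)) = (i, w ++ v) :: r := by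
    intro s w
    obtain ⟨i, l, hl⟩ := exists_cons_leaves s
    have := length_leaves_eq_length_pathWords s
    rw [hl] at this
    obtain ⟨v, r, hv⟩ := List.exists_cons_of_length_pos (l := pathWords s) (by rw [← this]; simp)
    exact ⟨i, v, _, by rw [hl, hv]; rfl⟩
  have znu : ∀ (a b : Tree) (w : List Bool),
      (nu a b).leaves.zip ((pathWords (nu a b)).map (w ++ ·))
        = a.leaves.zip ((pathWords a).map ((w ++ [true]) ++ ·)) ++
          b.leaves.zip ((pathWords b).map ((w ++ [true]) ++ ·)) := by
    intro a b w
    rw [leaves, pathWords, List.map_append, List.map_append, hd, hd,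
      List.zip_append (by simp [length_leaves_eq_length_pathWords])]
  have zmu : ∀ (a b c : Tree) (w : List Bool),
      (mu a b c).leaves.zip ((pathWords (mu a b c)).map (w ++ ·))
        = a.leaves.zip ((pathWords a).map ((w ++ [false]) ++ ·)) ++
          (b.leaves.zip ((pathWords b).map ((w ++ [false]) ++ ·)) ++
          c.leaves.zip ((pathWords c).map ((w ++ [false]) ++ ·))) := by
    intro a b c w
    rw [leaves, pathWords, List.map_append, List.map_append, List.map_append, List.map_append,
      hd, hd, hd, List.append_assoc, List.append_assoc, List.zip_append (by simp [length_leaves_eq_length_pathWords]),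
      List.zip_append (by simp [length_leaves_eq_length_pathWords])]
  have zleaf : ∀ (i : ℕ) (w : List Bool),
      (leaf i).leaves.zip ((pathWords (leaf i)).map (w ++ ·)) = [(i, w)] := by
    intro i w; simp [leaves, pathWords]
  induction t generalizing t' with
  | leaf i =>
    intro w l l' h
    cases t' with
    | leaf j => rw [zleaf, zleaf] at h; simp at h; simp [h]
    | nu a b =>
      obtain ⟨j, v, r, hr⟩ := head a (w ++ [true])
      rw [zleaf, znu, hr] at h; simp at h
    | mu a b c =>
      obtain ⟨j, v, r, hr⟩ := head a (w ++ [false])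
      rw [zleaf, zmu, hr] at h; simp at h
  | nu a b ha hb =>
    intro w l l' h
    obtain ⟨i, u, q, hq⟩ := head a (w ++ [true])
    cases t' with
    | leaf j => rw [zleaf, znu, hq] at h; simp at h
    | nu a' b' =>
      rw [znu, znu, List.append_assoc, List.append_assoc] at h
      obtain ⟨rfl, h1⟩ := ha _ _ _ _ h
      obtain ⟨rfl, h2⟩ := hb _ _ _ _ h1
      exact ⟨rfl, h2⟩
    | mu a' b' c' =>
      obtain ⟨j, v, r, hr⟩ := head a' (w ++ [false])
      rw [znu, zmu, hr, hq] at h; simp at h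
  | mu a b c ha hb hc =>
    intro w l l' h
    obtain ⟨i, u, q, hq⟩ := head a (w ++ [false])
    cases t' with
    | leaf j => rw [zleaf, zmu, hq] at h; simp at h
    | nu a' b' =>
      obtain ⟨j, v, r, hr⟩ := head a' (w ++ [true])
      rw [znu, zmu, hr, hq] at h; simp at h
    | mu a' b' c' =>
      rw [zmu, zmu, List.append_assoc, List.append_assoc, List.append_assoc,
        List.append_assoc] at h
      obtain ⟨rfl, h1⟩ := ha _ _ _ _ h
      obtain ⟨rfl, h2⟩ := hb _ _ _ _ h1
      obtain ⟨rfl, h3⟩ := hc _ _ _ _ h2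
      exact ⟨rfl, h3⟩

/-- This is what makes the order total: the leaf sequence together with the path words in planar
order determines the tree, as `eq_of_pathWords` shows by parsing. -/
lemma treeKey_injOn {S : Finset ℕ} {s t : Tree} (hs : s ∈ treeMonomials S)
    (ht : t ∈ treeMonomials S) (h : treeKey s = treeKey t) : s = t := by
  have h2 := congrArg (fun x => (ofLex x).2) h
  have hl : s.leaves = t.leaves := congrArg (fun x => OrderDual.ofDual (ofLex x).2) h2
  have hp := congrArg (fun x => (ofLex x).1) h2
  simp only [treeKey, ofLex_toLex, hs.2, ht.2, sort_map_eq_iff] at hp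
  have hw : pathWords s = pathWords t := by
    rw [pathWords_eq_map hs.1, pathWords_eq_map ht.1, hl]
    refine List.map_congr_left fun i hi => wordKey_injective (hp i ?_)
    rwa [← ht.2, mem_labels]
  exact (eq_of_pathWords s t [] [] [] (by rw [hl, hw])).1

theorem isMonomialOrder_degPathLex : IsMonomialOrder degPathLex where
  irrefl _ _ _ := lt_irrefl _
  trans _ _ _ _ _ _ _ := lt_trans
  total S s hs t ht hst := lt_or_gt_of_ne fun h => hst (treeKey_injOn hs.1 ht.1 h)
  comp_left S U i hi hd s hs s' hs' u hu hp h := by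
    refine degPathLex_bind (U := graftLabels i U) hs hs' (fun j _ => ?_) (disjoint_graftLabels hd)
      (minLeaf_graft_lt hi hp (Finset.disjoint_right.1 hd (minLeaf_mem_of_mem hu.1))) h
    unfold graftLabels
    split_ifs
    · exact hu
    · exact leaf_mem_shuffleMonomials j
  comp_right S U i hi hd s hs u hu u' hu' _ h :=
    degPathLex_graft_right hi hd hs.1 hu.1 hu'.1 h

/-! ### Operadic ideals -/

section Ideals

variable {K : Type*} [Field K]

lemma comp_mon_left (i : ℕ) (s : Tree) (q : Tree →₀ K) :
    comp i (mon s) q = q.mapDomain (s.graft i) := by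
  rw [comp, mon, Finsupp.sum_single_index (by simp)]
  simp only [one_mul, Finsupp.mapDomain]

lemma comp_mon_right (i : ℕ) (p : Tree →₀ K) (u : Tree) :
    comp i p (mon u) = p.mapDomain fun s => s.graft i u := by
  rw [comp, Finsupp.mapDomain]
  refine Finsupp.sum_congr fun s _ => ?_
  rw [mon, Finsupp.sum_single_index (by simp), mul_one]

lemma mapDomain_mon (g : Tree → Tree) (t : Tree) : (mon t : Tree →₀ K).mapDomain g = mon (g t) :=
  Finsupp.mapDomain_single

lemma mon_mem_multilin {S : Finset ℕ} {t : Tree} (h : t ∈ treeMonomials S) :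
    (mon t : Tree →₀ K) ∈ multilin K S := Finsupp.single_mem_supported K 1 h

lemma mem_treeMonomials_of_mem_support {S : Finset ℕ} {p : Tree →₀ K} (hp : p ∈ multilin K S)
    {t : Tree} (ht : t ∈ p.support) : t ∈ treeMonomials S :=
  (Finsupp.mem_supported K p).1 hp ht

lemma multilin_eq_span (S : Finset ℕ) :
    multilin K S = Submodule.span K ((fun t => (mon t : Tree →₀ K)) '' treeMonomials S) :=
  Finsupp.supported_eq_span_single K _

lemma mapDomain_mem_multilin {S T : Finset ℕ} {g : Tree → Tree}
    (hg : ∀ t ∈ treeMonomials S, g t ∈ treeMonomials T) {p : Tree →₀ K}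
    (hp : p ∈ multilin K S) : p.mapDomain g ∈ multilin K T := by
  rw [Finsupp.mapDomain]
  exact Submodule.sum_mem _ fun t ht => Finsupp.single_mem_supported K _
    (hg t (mem_treeMonomials_of_mem_support hp ht))

lemma relabel_mem_treeMonomials (σ : Equiv.Perm ℕ) {S : Finset ℕ} {t : Tree}
    (ht : t ∈ treeMonomials S) : t.relabel σ ∈ treeMonomials (S.image σ) := by
  have := bind_mem_treeMonomials (U := fun j => {σ j}) (f := fun j => leaf (σ j)) ht
    (fun i _ => (leaf_mem_shuffleMonomials (σ i)).1) (by intro i _ j _ hij; simpa using hij)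
  rwa [Finset.biUnion_singleton] at this

lemma isOperadIdeal_multilin : IsOperadIdeal K (multilin K) := by
  have hc : ∀ (S U : Finset ℕ) (i : ℕ), i ∈ S → Disjoint (S.erase i) U →
      ∀ p ∈ multilin K S, ∀ q ∈ multilin K U, comp i p q ∈ multilin K (S.erase i ∪ U) :=
    fun S U i hi hd p hp q hq => Submodule.sum_mem _ fun s hs => Submodule.sum_mem _ fun u hu =>
      Finsupp.single_mem_supported K _ (graft_mem_treeMonomials hi hd
        (mem_treeMonomials_of_mem_support hp hs) (mem_treeMonomials_of_mem_support hq hu))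
  exact ⟨fun _ => le_rfl, fun σ S p hp =>
    mapDomain_mem_multilin (fun t ht => relabel_mem_treeMonomials σ ht) hp, hc, hc⟩

lemma mem_operadIdeal {R : ℕ → Set (Tree →₀ K)} {S : Finset ℕ} {p : Tree →₀ K} :
    p ∈ operadIdeal K R S ↔ ∀ I, IsOperadIdeal K I → (∀ n, ∀ r ∈ R n, r ∈ I (std n)) → p ∈ I S := by
  unfold operadIdeal
  rw [Submodule.mem_sInf]
  exact ⟨fun h I hI hR => h _ ⟨I, hI, hR, rfl⟩, by rintro h _ ⟨I, hI, hR, rfl⟩; exact h I hI hR⟩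

lemma isOperadIdeal_operadIdeal {R : ℕ → Set (Tree →₀ K)}
    (hR : ∀ n, ∀ r ∈ R n, r ∈ multilin K (std n)) : IsOperadIdeal K (operadIdeal K R) where
  le _ _ hp := mem_operadIdeal.1 hp _ isOperadIdeal_multilin hR
  relabel_mem σ S p hp := mem_operadIdeal.2 fun I hI h =>
    hI.relabel_mem σ S p (mem_operadIdeal.1 hp I hI h)
  comp_mem_left S U i hi hd p hp q hq := mem_operadIdeal.2 fun I hI h =>
    hI.comp_mem_left S U i hi hd p (mem_operadIdeal.1 hp I hI h) q hq
  comp_mem_right S U i hi hd p hp q hq := mem_operadIdeal.2 fun I hI h =>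
    hI.comp_mem_right S U i hi hd p hp q (mem_operadIdeal.1 hq I hI h)

lemma subset_operadIdeal {R : ℕ → Set (Tree →₀ K)} {n : ℕ} {r : Tree →₀ K} (hr : r ∈ R n) :
    r ∈ operadIdeal K R (std n) := mem_operadIdeal.2 fun _ _ h => h n r hr

lemma IsOperadIdeal.graft_mem {I : Finset ℕ → Submodule K (Tree →₀ K)} (hI : IsOperadIdeal K I)
    {S U : Finset ℕ} {i : ℕ} (hi : i ∈ S) (hd : Disjoint (S.erase i) U) {s : Tree}
    (hs : s ∈ treeMonomials S) {p : Tree →₀ K} (hp : p ∈ I U) :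
    p.mapDomain (s.graft i) ∈ I (S.erase i ∪ U) := by
  rw [← comp_mon_left]
  exact hI.comp_mem_right S U i hi hd _ (mon_mem_multilin hs) p hp

lemma graft_of_notMem {i : ℕ} {t : Tree} (h : i ∉ t.leaves) (u : Tree) : t.graft i u = t := by
  conv_rhs => rw [← bind_leaf t]
  exact bind_congr fun j hj => if_neg fun e => h (by rwa [← e])

/-- Since the new labels avoid `S`, the trees can be grafted one leaf at a time: no clash of labels
occurs at an intermediate stage, and no earlier graft contains a leaf still to be replaced. -/
lemma IsOperadIdeal.bind_mem_of_disjoint {I : Finset ℕ → Submodule K (Tree →₀ K)}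
    (hI : IsOperadIdeal K I) {S : Finset ℕ} {p : Tree →₀ K} (hp : p ∈ I S) {f : ℕ → Tree}
    {U : ℕ → Finset ℕ} {T : Finset ℕ} (hT : T ⊆ S) (hf : ∀ j ∈ T, f j ∈ treeMonomials (U j))
    (hU : ∀ j ∈ T, ∀ k ∈ T, j ≠ k → Disjoint (U j) (U k)) (hSU : ∀ j ∈ T, Disjoint S (U j)) :
    p.mapDomain (Tree.bind fun j => if j ∈ T then f j else leaf j) ∈ I (S \ T ∪ T.biUnion U) := by
  induction T using Finset.induction_on with
  | empty =>
    have : (Tree.bind fun j => if j ∈ (∅ : Finset ℕ) then f j else leaf j) = id := by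
      funext t; simp
    rw [this, Finsupp.mapDomain_id]
    simpa using hp
  | insert a T haT ih =>
    have haS : a ∈ S := hT (mem_insert_self _ _)
    have hTi : ∀ {j}, j ∈ T → j ∈ insert a T := mem_insert_of_mem
    specialize ih (fun j hj => hT (hTi hj)) (fun j hj => hf j (hTi hj))
      (fun j hj k hk => hU j (hTi hj) k (hTi hk)) (fun j hj => hSU j (hTi hj))
    have haU : ∀ j ∈ T, a ∉ U j := fun j hj => Finset.disjoint_left.1 (hSU j (hTi hj)) haS
    have ha : a ∈ S \ T ∪ T.biUnion U := mem_union_left _ (mem_sdiff.2 ⟨haS, haT⟩)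
    have hsa := hSU a (mem_insert_self _ _)
    have hd : Disjoint ((S \ T ∪ T.biUnion U).erase a) (U a) := by
      refine Disjoint.mono_left (Finset.erase_subset _ _) ?_
      rw [Finset.disjoint_union_left, Finset.disjoint_biUnion_left]
      refine ⟨hsa.mono_left Finset.sdiff_subset, fun j hj => ?_⟩
      exact hU j (hTi hj) a (mem_insert_self _ _) fun e => haT (e ▸ hj)
    have := hI.comp_mem_left _ _ a ha hd _ ih (mon (f a))
      (mon_mem_multilin (hf a (mem_insert_self _ _)))
    rw [comp_mon_right, ← Finsupp.mapDomain_comp] at this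
    have e1 : ((fun s => s.graft a (f a)) ∘ Tree.bind fun j => if j ∈ T then f j else leaf j)
        = Tree.bind fun j => if j ∈ insert a T then f j else leaf j := by
      funext t
      simp only [Function.comp, graft, bind_bind]
      congr 1
      funext j
      by_cases hj : j ∈ T
      · rw [if_pos hj, if_pos (hTi hj)]
        refine graft_of_notMem (fun h => haU j hj ?_) _
        rwa [← (hf j (hTi hj)).2, mem_labels]
      · by_cases hja : j = a <;> simp [hj, hja, Tree.bind, haT]
    have e2 : (S \ T ∪ T.biUnion U).erase a ∪ U a = S \ insert a T ∪ (insert a T).biUnion U := by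
      ext k
      simp only [mem_union, mem_erase, mem_sdiff, mem_biUnion, mem_insert]
      constructor
      · rintro (⟨h1, ⟨h2, h3⟩ | ⟨j, hj, hk⟩⟩ | h)
        · exact .inl ⟨h2, by tauto⟩
        · exact .inr ⟨j, .inr hj, hk⟩
        · exact .inr ⟨a, .inl rfl, h⟩
      · rintro (⟨h1, h2⟩ | ⟨j, rfl | hj, hk⟩)
        · exact .inl ⟨by tauto, .inl ⟨h1, by tauto⟩⟩
        · exact .inr hk
        · exact .inl ⟨fun e => haU j hj (e ▸ hk), .inr ⟨j, hj, hk⟩⟩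
    rwa [e1, e2] at this

/-- The permutation that swaps `j` and `j + N` for `j < N`. -/
def shiftPerm (N : ℕ) : Equiv.Perm ℕ :=
  Function.Involutive.toPerm (fun j => if j < N then j + N else if j < 2 * N then j - N else j)
    (by intro j; dsimp only; split_ifs <;> omega)

lemma shiftPerm_of_lt {N j : ℕ} (h : j < N) : shiftPerm N j = j + N := by
  change (if j < N then j + N else if j < 2 * N then j - N else j) = _
  rw [if_pos h]

lemma shiftPerm_shiftPerm (N j : ℕ) : shiftPerm N (shiftPerm N j) = j :=
  Function.Involutive.toPerm_involutive _ j

/-- Operadic ideals are closed under simultaneous substitution of tree monomials. -/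
lemma IsOperadIdeal.bind_mem {I : Finset ℕ → Submodule K (Tree →₀ K)}
    (hI : IsOperadIdeal K I) {S : Finset ℕ} {p : Tree →₀ K} (hp : p ∈ I S) {f : ℕ → Tree}
    {U : ℕ → Finset ℕ} (hf : ∀ j ∈ S, f j ∈ treeMonomials (U j))
    (hU : ∀ j ∈ S, ∀ k ∈ S, j ≠ k → Disjoint (U j) (U k)) :
    p.mapDomain (Tree.bind f) ∈ I (S.biUnion U) := by
  set V := S ∪ S.biUnion U with hV
  -- The labels of the substituted trees may meet `S`. Shifting the inputs by `N`, beyond all labels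
  -- in play, reduces to the disjoint case; the shift is undone by composing the substitution with
  -- the same involution.
  set N := V.sup id + 1 with hN
  have hVN : ∀ j ∈ V, j < N := fun j hj => Nat.lt_succ_of_le (Finset.le_sup (f := id) hj)
  set σ := shiftPerm N
  have hσ : ∀ j ∈ S.image σ, σ j ∈ S ∧ N ≤ j := by
    intro j hj
    obtain ⟨i, hi, rfl⟩ := mem_image.1 hj
    rw [shiftPerm_shiftPerm]
    refine ⟨hi, ?_⟩
    rw [shiftPerm_of_lt (hVN i (mem_union_left _ hi))]
    exact Nat.le_add_left _ _
  have := hI.bind_mem_of_disjoint (hI.relabel_mem σ S p hp) (f := fun j => f (σ j))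
    (U := fun j => U (σ j)) (T := S.image σ) subset_rfl (fun j hj => hf _ (hσ j hj).1)
    (fun j hj k hk hjk => hU _ (hσ j hj).1 _ (hσ k hk).1 fun e => hjk (σ.injective e)) ?_
  · have e : (S.image σ).biUnion (fun j => U (σ j)) = S.biUnion U := by
      rw [Finset.image_biUnion]
      exact Finset.biUnion_congr rfl fun j _ => by simp only [σ, shiftPerm_shiftPerm]
    rw [relabel, ← Finsupp.mapDomain_comp, sdiff_self, Finset.bot_eq_empty, Finset.empty_union,
      e] at this
    convert this using 1
    refine Finsupp.mapDomain_congr fun t ht => ?_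
    simp only [Function.comp, Tree.relabel, bind_bind]
    refine bind_congr fun j hj => ?_
    have hjS : j ∈ S := by
      rw [← (mem_treeMonomials_of_mem_support (hI.le S hp) ht).2, mem_labels]; exact hj
    rw [Tree.bind, if_pos (mem_image_of_mem _ hjS), shiftPerm_shiftPerm]
  · intro j hj
    rw [Finset.disjoint_left]
    intro k hk hk'
    have h1 := hVN k (mem_union_right _ (mem_biUnion.2 ⟨σ j, (hσ j hj).1, hk'⟩))
    have h2 := (hσ k hk).2
    omega

end Ideals

/-! ### Evaluation in the associative operad -/

section Evaluation

variable (K : Type*) [Field K]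

lemma sum_perm_three {M : Type*} [AddCommMonoid M] (f : Equiv.Perm (Fin 3) → M) :
    ∑ σ, f σ = f 1 + f (Equiv.swap 0 1) + f (Equiv.swap 0 2) + f (Equiv.swap 1 2)
      + f (Equiv.swap 0 1 * Equiv.swap 1 2) + f (Equiv.swap 1 2 * Equiv.swap 0 1) := by
  have : (Finset.univ : Finset (Equiv.Perm (Fin 3))) = {1, Equiv.swap 0 1, Equiv.swap 0 2,
    Equiv.swap 1 2, Equiv.swap 0 1 * Equiv.swap 1 2, Equiv.swap 1 2 * Equiv.swap 0 1} := by decide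
  rw [this]
  repeat rw [Finset.sum_insert (by decide)]
  rw [Finset.sum_singleton]
  simp only [add_assoc]

variable {K}

lemma sym3_eq (a b c : FreeAlgebra K ℕ) : sym3 a b c =
    a * b * c + b * a * c + c * b * a + a * c * b + b * c * a + c * a * b := by
  have h1 : (Equiv.swap (0 : Fin 3) 2) 1 = 1 := by decide
  have h2 : (Equiv.swap (1 : Fin 3) 2) 0 = 0 := by decide
  have h3 : (Equiv.swap (0 : Fin 3) 1) 2 = 2 := by decide
  simp [sym3, sum_perm_three, Equiv.Perm.mul_apply, h1, h2, h3]

lemma sym3_swap_left (a b c : FreeAlgebra K ℕ) : sym3 a b c = sym3 b a c := by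
  simp only [sym3_eq]; abel

lemma sym3_swap_right (a b c : FreeAlgebra K ℕ) : sym3 a b c = sym3 a c b := by
  simp only [sym3_eq]; abel

lemma map_comm2 (φ : FreeAlgebra K ℕ →ₐ[K] FreeAlgebra K ℕ) (a b : FreeAlgebra K ℕ) :
    φ (comm2 a b) = comm2 (φ a) (φ b) := by simp [comm2]

lemma map_sym3 (φ : FreeAlgebra K ℕ →ₐ[K] FreeAlgebra K ℕ) (a b c : FreeAlgebra K ℕ) :
    φ (sym3 a b c) = sym3 (φ a) (φ b) (φ c) := by simp [sym3_eq]

lemma evalTree_bind (f : ℕ → Tree) (t : Tree) :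
    evalTree K (t.bind f) = FreeAlgebra.lift K (fun j => evalTree K (f j)) (evalTree K t) := by
  induction t with
  | leaf i => simp [evalTree, Tree.bind, X]
  | nu a b ha hb => simp only [evalTree, Tree.bind, ha, hb, map_comm2]
  | mu a b c ha hb hc => simp only [evalTree, Tree.bind, ha, hb, hc, map_sym3]

lemma evalTree_relabel (σ : Equiv.Perm ℕ) (t : Tree) :
    evalTree K (t.relabel σ) = asRelabel K σ (evalTree K t) := evalTree_bind _ t

lemma evalTree_graft (i : ℕ) (t u : Tree) :
    evalTree K (t.graft i u) = asComp K i (evalTree K t) (evalTree K u) := by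
  rw [graft, evalTree_bind, asComp]
  congr 2
  funext j
  split_ifs <;> rfl

lemma evalAs_mon (t : Tree) : evalAs K (mon t) = evalTree K t := by simp [evalAs, mon]

lemma evalAs_mapDomain (g : Tree → Tree) (L : FreeAlgebra K ℕ →ₗ[K] FreeAlgebra K ℕ)
    {p : Tree →₀ K} (h : ∀ t ∈ p.support, evalTree K (g t) = L (evalTree K t)) :
    evalAs K (p.mapDomain g) = L (evalAs K p) := by
  rw [evalAs, Finsupp.linearCombination_mapDomain, Finsupp.linearCombination_apply,
    Finsupp.linearCombination_apply, Finsupp.sum, Finsupp.sum, map_sum]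
  exact Finset.sum_congr rfl fun t ht => by simp [h t ht]

lemma evalAs_relabel (σ : Equiv.Perm ℕ) (p : Tree →₀ K) :
    evalAs K (relabel σ p) = asRelabel K σ (evalAs K p) :=
  evalAs_mapDomain _ (FreeAlgebra.lift K (fun j => X K (σ j))).toLinearMap
    fun t _ => evalTree_relabel σ t

/-- The commutator with `b` on the right. -/
def comm2L (b : FreeAlgebra K ℕ) : FreeAlgebra K ℕ →ₗ[K] FreeAlgebra K ℕ :=
  LinearMap.mulRight K b - LinearMap.mulLeft K b

/-- The symmetrized product as a function of its first argument. -/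
def sym3L (b c : FreeAlgebra K ℕ) : FreeAlgebra K ℕ →ₗ[K] FreeAlgebra K ℕ :=
  LinearMap.mulRight K (b * c + c * b) + LinearMap.mulLeft K (b * c + c * b)
    + LinearMap.mulLeft K b ∘ₗ LinearMap.mulRight K c
    + LinearMap.mulLeft K c ∘ₗ LinearMap.mulRight K b

lemma comm2L_apply (a b : FreeAlgebra K ℕ) : comm2L b a = comm2 a b := by simp [comm2L, comm2]

lemma sym3L_apply (a b c : FreeAlgebra K ℕ) : sym3L b c a = sym3 a b c := by
  simp [sym3L, sym3_eq, mul_add, add_mul, mul_assoc]; abel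

lemma asComp_evalTree_of_notMem {i : ℕ} {t : Tree} (h : i ∉ t.leaves) (q : FreeAlgebra K ℕ) :
    asComp K i (evalTree K t) q = evalTree K t := by
  induction t with
  | leaf j =>
    have : j ≠ i := by simpa [leaves, eq_comm] using h
    simp [asComp, evalTree, X, this]
  | nu a b ha hb =>
    simp only [leaves, List.mem_append, not_or] at h
    have ha := ha h.1
    have hb := hb h.2
    unfold asComp at *
    rw [evalTree, map_comm2, ha, hb]
  | mu a b c ha hb hc =>
    simp only [leaves, List.mem_append, not_or] at h
    have ha := ha h.1.1
    have hb := hb h.1.2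
    have hc := hc h.2
    unfold asComp at *
    rw [evalTree, map_sym3, ha, hb, hc]

/-- Substitution into a noncommutative polynomial is not linear in general. It is linear here
because `i` labels exactly one leaf, so `q` enters every operation above the root path linearly in a
single argument. -/
lemma exists_linear_asComp {i : ℕ} {t : Tree} (hn : t.leaves.Nodup) (hi : i ∈ t.leaves) :
    ∃ L : FreeAlgebra K ℕ →ₗ[K] FreeAlgebra K ℕ, ∀ q, asComp K i (evalTree K t) q = L q := by
  have hc2 : ∀ a b : Tree, ∀ q, asComp K i (evalTree K (nu a b)) q
      = comm2 (asComp K i (evalTree K a) q) (asComp K i (evalTree K b) q) :=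
    fun a b q => map_comm2 _ _ _
  have hc3 : ∀ a b c : Tree, ∀ q, asComp K i (evalTree K (mu a b c)) q
      = sym3 (asComp K i (evalTree K a) q) (asComp K i (evalTree K b) q)
        (asComp K i (evalTree K c) q) := fun a b c q => map_sym3 _ _ _ _
  induction t with
  | leaf j =>
    obtain rfl : i = j := by simpa [leaves] using hi
    exact ⟨LinearMap.id, fun q => by simp [asComp, evalTree, X]⟩
  | nu a b ha hb =>
    rw [leaves, List.nodup_append'] at hn
    rcases List.mem_append.1 hi with hi | hi
    · obtain ⟨L, hL⟩ := ha hn.1 hi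
      refine ⟨comm2L (evalTree K b) ∘ₗ L, fun q => ?_⟩
      rw [hc2, hL, asComp_evalTree_of_notMem (hn.2.2 hi), LinearMap.comp_apply, comm2L_apply]
    · obtain ⟨L, hL⟩ := hb hn.2.1 hi
      refine ⟨-(comm2L (evalTree K a) ∘ₗ L), fun q => ?_⟩
      rw [hc2, hL, asComp_evalTree_of_notMem (hn.2.2.symm hi), LinearMap.neg_apply,
        LinearMap.comp_apply, comm2L_apply]
      simp [comm2]
  | mu a b c ha hb hc =>
    rw [leaves, List.nodup_append', List.nodup_append'] at hn
    rcases List.mem_append.1 hi with hi | hi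
    · have h3 : i ∉ c.leaves := hn.2.2 hi
      rcases List.mem_append.1 hi with hi | hi
      · obtain ⟨L, hL⟩ := ha hn.1.1 hi
        refine ⟨sym3L (evalTree K b) (evalTree K c) ∘ₗ L, fun q => ?_⟩
        rw [hc3, hL, asComp_evalTree_of_notMem (hn.1.2.2 hi), asComp_evalTree_of_notMem h3,
          LinearMap.comp_apply, sym3L_apply]
      · obtain ⟨L, hL⟩ := hb hn.1.2.1 hi
        refine ⟨sym3L (evalTree K a) (evalTree K c) ∘ₗ L, fun q => ?_⟩
        rw [hc3, hL, asComp_evalTree_of_notMem (hn.1.2.2.symm hi), asComp_evalTree_of_notMem h3,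
          LinearMap.comp_apply, sym3L_apply, sym3_swap_left]
    · obtain ⟨L, hL⟩ := hc hn.2.1 hi
      have h3 : i ∉ a.leaves ++ b.leaves := hn.2.2.symm hi
      rw [List.mem_append, not_or] at h3
      refine ⟨sym3L (evalTree K a) (evalTree K b) ∘ₗ L, fun q => ?_⟩
      rw [hc3, hL, asComp_evalTree_of_notMem h3.1, asComp_evalTree_of_notMem h3.2,
        LinearMap.comp_apply, sym3L_apply, sym3_swap_right, sym3_swap_left]

lemma comp_eq_sum (i : ℕ) (p q : Tree →₀ K) :
    comp i p q = p.sum fun s a => a • q.mapDomain (s.graft i) := by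
  simp [comp, Finsupp.mapDomain, Finsupp.smul_sum]

lemma asComp_evalAs (i : ℕ) (p : Tree →₀ K) (x : FreeAlgebra K ℕ) :
    asComp K i (evalAs K p) x = p.sum fun s a => a • asComp K i (evalTree K s) x := by
  rw [evalAs, Finsupp.linearCombination_apply, asComp, map_finsuppSum]
  exact Finsupp.sum_congr fun s _ => by rw [map_smul, asComp]

lemma evalAs_comp {S : Finset ℕ} {i : ℕ} (hi : i ∈ S) {p : Tree →₀ K} (hp : p ∈ multilin K S)
    (q : Tree →₀ K) : evalAs K (comp i p q) = asComp K i (evalAs K p) (evalAs K q) := by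
  rw [comp_eq_sum, asComp_evalAs, map_finsuppSum]
  refine Finsupp.sum_congr fun s hs => ?_
  have hs := mem_treeMonomials_of_mem_support hp hs
  obtain ⟨L, hL⟩ := exists_linear_asComp (K := K) hs.1 (i := i) (by rwa [← mem_labels, hs.2])
  rw [map_smul, evalAs_mapDomain (s.graft i) L fun u _ => by rw [evalTree_graft, hL], hL]

lemma asComp_evalAs_zero {S : Finset ℕ} {i : ℕ} (hi : i ∈ S) {p : Tree →₀ K}
    (hp : p ∈ multilin K S) : asComp K i (evalAs K p) 0 = 0 := by
  rw [asComp_evalAs]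
  refine Finset.sum_eq_zero fun s hs => ?_
  have hs := mem_treeMonomials_of_mem_support hp hs
  obtain ⟨L, hL⟩ := exists_linear_asComp (K := K) hs.1 (i := i) (by rwa [← mem_labels, hs.2])
  simp only [hL, map_zero, smul_zero]

lemma asRelabel_zero (σ : Equiv.Perm ℕ) : asRelabel K σ 0 = 0 := map_zero _

/-- Evaluation respects relabelling and composition. Composing an element of the kernel into a
multilinear one gives zero because the latter is linear in the input replaced. -/
lemma isOperadIdeal_ker :
    IsOperadIdeal K fun S => multilin K S ⊓ LinearMap.ker (evalAs K) where
  le _ := inf_le_left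
  relabel_mem σ S p hp := ⟨isOperadIdeal_multilin.relabel_mem σ S p hp.1, by
    rw [SetLike.mem_coe, LinearMap.mem_ker, evalAs_relabel, LinearMap.mem_ker.1 hp.2, asRelabel_zero]⟩
  comp_mem_left S U i hi hd p hp q hq :=
    ⟨isOperadIdeal_multilin.comp_mem_left S U i hi hd p hp.1 q hq, by
      rw [SetLike.mem_coe, LinearMap.mem_ker, evalAs_comp hi hp.1, LinearMap.mem_ker.1 hp.2, asComp, map_zero]⟩
  comp_mem_right S U i hi hd p hp q hq :=
    ⟨isOperadIdeal_multilin.comp_mem_left S U i hi hd p hp q hq.1, by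
      rw [SetLike.mem_coe, LinearMap.mem_ker, evalAs_comp hi hp, LinearMap.mem_ker.1 hq.2, asComp_evalAs_zero hi hp]⟩

end Evaluation

/-! ### The relations hold in the associative operad -/

section WordPolynomials

/-- Product of noncommutative polynomials, given as lists of terms. -/
def wpMul (p q : List (ℤ × List ℕ)) : List (ℤ × List ℕ) :=
  p.flatMap fun m => q.map fun n => (m.1 * n.1, m.2 ++ n.2)

/-- Multiplication by an integer. -/
def wpSmul (z : ℤ) (p : List (ℤ × List ℕ)) : List (ℤ × List ℕ) := p.map fun m => (z * m.1, m.2)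

/-- The value of a tree monomial as a list of terms. -/
def wpTree : Tree → List (ℤ × List ℕ)
  | leaf i => [(1, [i])]
  | nu a b => wpMul (wpTree a) (wpTree b) ++ wpSmul (-1) (wpMul (wpTree b) (wpTree a))
  | mu a b c => wpMul (wpMul (wpTree a) (wpTree b)) (wpTree c)
      ++ (wpMul (wpMul (wpTree b) (wpTree a)) (wpTree c)
      ++ (wpMul (wpMul (wpTree c) (wpTree b)) (wpTree a)
      ++ (wpMul (wpMul (wpTree a) (wpTree c)) (wpTree b)
      ++ (wpMul (wpMul (wpTree b) (wpTree c)) (wpTree a)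
      ++ wpMul (wpMul (wpTree c) (wpTree a)) (wpTree b)))))

/-- Adding a term, collecting equal words. -/
def wpInsert (m : ℤ × List ℕ) : List (ℤ × List ℕ) → List (ℤ × List ℕ)
  | [] => [m]
  | n :: p => if m.2 = n.2 then (m.1 + n.1, n.2) :: p else n :: wpInsert m p

/-- Collecting equal words. -/
def wpCollect (p : List (ℤ × List ℕ)) : List (ℤ × List ℕ) := p.foldr wpInsert []

/-- Five times the value of `preB`. -/
def wpPreB (a₁ a₂ a₃ b₁ b₂ : Tree) : List (ℤ × List ℕ) :=
  wpSmul 15 (wpTree (mu (nu a₁ b₁) (nu a₂ b₂) a₃))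
    ++ (wpSmul 30 (wpTree (mu (nu a₁ (nu a₂ b₁)) a₃ b₂))
    ++ (wpSmul 6 (wpTree (nu b₁ (nu a₁ (nu a₂ (nu a₃ b₂)))))
    ++ wpSmul 18 (wpTree (nu a₁ (nu b₁ (nu a₂ (nu b₂ a₃)))))))

/-- Sixty times the value of `polB`. -/
def wpPolB (a b c d e : Tree) : List (ℤ × List ℕ) :=
  [(a, b, c), (b, a, c), (c, b, a), (a, c, b), (b, c, a), (c, a, b)].flatMap fun x =>
    wpPreB x.1 x.2.1 x.2.2 d e ++ wpPreB x.1 x.2.1 x.2.2 e d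

variable {K : Type*} [Field K]

/-- The element of the free algebra given by a list of terms. -/
def wpVal (K : Type*) [Field K] (p : List (ℤ × List ℕ)) : FreeAlgebra K ℕ :=
  (p.map fun m => m.1 • (m.2.map (X K)).prod).sum

lemma wpVal_append (p q : List (ℤ × List ℕ)) : wpVal K (p ++ q) = wpVal K p + wpVal K q := by
  simp [wpVal]

lemma wpVal_cons (m : ℤ × List ℕ) (p : List (ℤ × List ℕ)) :
    wpVal K (m :: p) = m.1 • (m.2.map (X K)).prod + wpVal K p := by
  simp [wpVal]

lemma wpVal_nil : wpVal K [] = 0 := rfl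

lemma wpVal_smul (z : ℤ) (p : List (ℤ × List ℕ)) : wpVal K (wpSmul z p) = z • wpVal K p := by
  induction p with
  | nil => simp [wpSmul, wpVal_nil]
  | cons m p ih =>
    rw [wpSmul, List.map_cons, wpVal_cons, wpVal_cons, smul_add, ← ih, mul_smul]; rfl

lemma wpVal_mul (p q : List (ℤ × List ℕ)) : wpVal K (wpMul p q) = wpVal K p * wpVal K q := by
  induction p with
  | nil => simp [wpMul, wpVal_nil]
  | cons m p ih =>
    rw [wpMul, List.flatMap_cons, wpVal_append, wpVal_cons, add_mul, ← ih, wpMul]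
    congr 1
    clear ih
    induction q with
    | nil => simp [wpVal_nil]
    | cons n q ihq =>
      rw [List.map_cons, wpVal_cons, ihq, wpVal_cons, mul_add, List.map_append, List.prod_append,
        smul_mul_smul_comm]

lemma wpVal_tree (t : Tree) : wpVal K (wpTree t) = evalTree K t := by
  induction t with
  | leaf i => simp [wpTree, wpVal, evalTree]
  | nu a b ha hb =>
    rw [wpTree, wpVal_append, wpVal_smul, wpVal_mul, wpVal_mul, ha, hb, evalTree, comm2]
    simp [sub_eq_add_neg]
  | mu a b c ha hb hc =>
    simp only [wpTree, wpVal_append, wpVal_mul, ha, hb, hc, evalTree, sym3_eq, add_assoc]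

lemma wpVal_insert (m : ℤ × List ℕ) (p : List (ℤ × List ℕ)) :
    wpVal K (wpInsert m p) = wpVal K (m :: p) := by
  induction p with
  | nil => rfl
  | cons n p ih =>
    rw [wpInsert]
    split_ifs with h
    · rw [wpVal_cons, wpVal_cons, wpVal_cons, h, add_smul, add_assoc]
    · rw [wpVal_cons, ih, wpVal_cons, wpVal_cons, wpVal_cons, add_left_comm]

lemma wpVal_collect (p : List (ℤ × List ℕ)) : wpVal K (wpCollect p) = wpVal K p := by
  induction p with
  | nil => rfl
  | cons n p ih => rw [wpCollect, List.foldr_cons, wpVal_insert, wpVal_cons, wpVal_cons, ← ih,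
      wpCollect]

/-- Turns an identity in the free algebra into a decidable statement about integer coefficients. -/
lemma wpVal_eq_zero {p : List (ℤ × List ℕ)} (h : ∀ m ∈ wpCollect p, m.1 = 0) :
    wpVal K p = 0 := by
  rw [← wpVal_collect]
  refine List.sum_eq_zero fun x hx => ?_
  obtain ⟨m, hm, rfl⟩ := List.mem_map.1 hx
  rw [h m hm, zero_smul]

variable [CharZero K]

lemma evalAs_preB (a₁ a₂ a₃ b₁ b₂ : Tree) :
    evalAs K (preB a₁ a₂ a₃ b₁ b₂) = (1 / 5 : K) • wpVal K (wpPreB a₁ a₂ a₃ b₁ b₂) := by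
  simp only [preB, wpPreB, map_add, map_smul, evalAs_mon, wpVal_append, wpVal_smul, wpVal_tree,
    ← Int.cast_smul_eq_zsmul K]
  module

/-- The factor `60 = 5 · 12` clears the fifths in the coefficients of `preB` and the averaging over
`S₃ × S₂`, which makes all coefficients integers. -/
lemma evalAs_polB (a b c d e : Tree) :
    evalAs K (polB a b c d e) = (1 / 60 : K) • wpVal K (wpPolB a b c d e) := by
  have h1 : (Equiv.swap (0 : Fin 3) 2) 1 = 1 := by decide
  have h2 : (Equiv.swap (1 : Fin 3) 2) 0 = 0 := by decide
  have h3 : (Equiv.swap (0 : Fin 3) 1) 2 = 2 := by decide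
  have h4 : ∀ f : Equiv.Perm (Fin 2) → (Tree →₀ K), ∑ π, f π = f 1 + f (Equiv.swap 0 1) := by
    intro f
    have : (Finset.univ : Finset (Equiv.Perm (Fin 2))) = {1, Equiv.swap 0 1} := by decide
    rw [this, Finset.sum_pair (by decide)]
  simp only [polB, sum_perm_three, h4, Equiv.Perm.mul_apply, h1, h2, h3, Equiv.swap_apply_left,
    Equiv.swap_apply_right, Equiv.Perm.one_apply, map_smul, map_add, evalAs_preB,
    Matrix.cons_val, wpPolB, List.flatMap_cons, List.flatMap_nil, wpVal_append, wpVal_nil]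
  module

lemma evalAs_deformedAssoc : evalAs K (deformedAssoc K) = 0 := by
  have : evalAs K (deformedAssoc K) = (1 / 60 : K) • wpVal K
      (wpSmul 60 (wpTree (mu (mu (leaf 1) (leaf 2) (leaf 4)) (leaf 3) (leaf 5)))
        ++ (wpSmul (-60) (wpTree (mu (mu (leaf 1) (leaf 2) (leaf 3)) (leaf 4) (leaf 5)))
        ++ (wpSmul (-1) (wpPolB (leaf 1) (leaf 2) (leaf 4) (leaf 3) (leaf 5))
        ++ wpPolB (leaf 1) (leaf 2) (leaf 3) (leaf 4) (leaf 5)))) := by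
    simp only [deformedAssoc, map_sub, evalAs_mon, evalAs_polB, wpVal_append, wpVal_smul,
      wpVal_tree, ← Int.cast_smul_eq_zsmul K]
    module
  rw [this, wpVal_eq_zero, smul_zero]
  -- After expansion and collection, this checks that the coefficients of all words in five distinct
  -- letters vanish.
  decide +kernel

end WordPolynomials

/-! ### The ideal of relations lies in the kernel -/

section Kernel

variable {K : Type*} [Field K]

lemma evalAs_jacobi : evalAs K (jacobi K) = 0 := by
  simp only [jacobi, map_add, evalAs_mon, evalTree, comm2]
  noncomm_ring

lemma evalAs_leibniz : evalAs K (leibniz K) = 0 := by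
  simp only [leibniz, map_add, map_sub, evalAs_mon, evalTree, comm2, sym3_eq]
  noncomm_ring

lemma symmetryRelations_mem_multilin (n : ℕ) (r : Tree →₀ K) (hr : r ∈ symmetryRelations K n) :
    r ∈ multilin K (std n) := by
  unfold symmetryRelations at hr
  split at hr
  · obtain rfl := hr
    refine Submodule.add_mem _ ?_ ?_ <;> exact mon_mem_multilin ⟨by decide, by decide⟩
  · rcases hr with rfl | rfl <;> refine Submodule.sub_mem _ ?_ ?_ <;>
      exact mon_mem_multilin ⟨by decide, by decide⟩
  · exact hr.elim

lemma symmetryRelations_mem_ker (n : ℕ) (r : Tree →₀ K) (hr : r ∈ symmetryRelations K n) :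
    evalAs K r = 0 := by
  unfold symmetryRelations at hr
  split at hr
  · obtain rfl := hr
    simp [evalAs_mon, evalTree, comm2]
  · rcases hr with rfl | rfl
    · rw [map_sub, evalAs_mon, evalAs_mon, sub_eq_zero]; exact sym3_swap_left _ _ _
    · rw [map_sub, evalAs_mon, evalAs_mon, sub_eq_zero]; exact sym3_swap_right _ _ _
  · exact hr.elim

/-- The tree monomials with at least three vertices. -/
def highMonomials (S : Finset ℕ) : Set Tree := {t | t ∈ treeMonomials S ∧ 3 ≤ t.degree}

/-- The correction terms have three or four vertices, while the associativity terms have two. As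
fewer vertices means larger, the corrections never affect the leading monomial. -/
lemma preB_mem_highMonomials {S : Finset ℕ} {i₁ i₂ i₃ j₁ j₂ : ℕ}
    (hn : [i₁, i₂, i₃, j₁, j₂].Nodup) (hS : [i₁, i₂, i₃, j₁, j₂].toFinset = S) :
    (preB (leaf i₁) (leaf i₂) (leaf i₃) (leaf j₁) (leaf j₂) : Tree →₀ K)
      ∈ Finsupp.supported K K (highMonomials S) := by
  have key : ∀ t : Tree, t.leaves.Perm [i₁, i₂, i₃, j₁, j₂] → 3 ≤ t.degree →
      (mon t : Tree →₀ K) ∈ Finsupp.supported K K (highMonomials S) := fun t ht hd =>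
    Finsupp.single_mem_supported K 1
      ⟨⟨ht.nodup_iff.2 hn, by rw [labels, List.toFinset_eq_of_perm _ _ ht, hS]⟩, hd⟩
  refine Submodule.add_mem _ (Submodule.add_mem _ (Submodule.add_mem _ ?_ ?_) ?_) ?_ <;>
    refine Submodule.smul_mem _ _ (key _ ?_ (by simp [degree])) <;> simp only [leaves,
      List.cons_append, List.nil_append] <;> rw [← Multiset.coe_eq_coe] <;>
    simp only [← Multiset.cons_coe, Multiset.cons_swap]

lemma polB_mem_highMonomials {S : Finset ℕ} {i₁ i₂ i₃ j₁ j₂ : ℕ}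
    (hn : ∀ (σ : Equiv.Perm (Fin 3)) (π : Equiv.Perm (Fin 2)), [![i₁, i₂, i₃] (σ 0),
      ![i₁, i₂, i₃] (σ 1), ![i₁, i₂, i₃] (σ 2), ![j₁, j₂] (π 0), ![j₁, j₂] (π 1)].Nodup)
    (hS : ∀ (σ : Equiv.Perm (Fin 3)) (π : Equiv.Perm (Fin 2)), [![i₁, i₂, i₃] (σ 0),
      ![i₁, i₂, i₃] (σ 1), ![i₁, i₂, i₃] (σ 2), ![j₁, j₂] (π 0), ![j₁, j₂] (π 1)].toFinset = S) :
    (polB (leaf i₁) (leaf i₂) (leaf i₃) (leaf j₁) (leaf j₂) : Tree →₀ K)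
      ∈ Finsupp.supported K K (highMonomials S) := by
  have h3 : ∀ k, ![leaf i₁, leaf i₂, leaf i₃] k = leaf (![i₁, i₂, i₃] k) := by
    intro k; fin_cases k <;> rfl
  have h2 : ∀ k, ![leaf j₁, leaf j₂] k = leaf (![j₁, j₂] k) := by
    intro k; fin_cases k <;> rfl
  refine Submodule.smul_mem _ _ (Submodule.sum_mem _ fun σ _ => Submodule.sum_mem _ fun π _ => ?_)
  simp only [h2, h3]
  exact preB_mem_highMonomials (hn σ π) (hS σ π)

variable (K) in
/-- The terms of the deformed associativity relation with more than two vertices. -/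
def assocTail : Tree →₀ K := polB (leaf 1) (leaf 2) (leaf 4) (leaf 3) (leaf 5)
  - polB (leaf 1) (leaf 2) (leaf 3) (leaf 4) (leaf 5)

lemma assocTail_mem : assocTail K ∈ Finsupp.supported K K (highMonomials (std 5)) :=
  Submodule.sub_mem _ (polB_mem_highMonomials (by decide) (by decide))
    (polB_mem_highMonomials (by decide) (by decide))

lemma highMonomials_le (S : Finset ℕ) : Finsupp.supported K K (highMonomials S) ≤ multilin K S :=
  Finsupp.supported_mono fun _ h => h.1

lemma relations_mem_multilin (n : ℕ) (r : Tree →₀ K) (hr : r ∈ relations K n) :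
    r ∈ multilin K (std n) := by
  have key : ∀ {m : ℕ} (t : Tree), t.leaves.Nodup → t.labels = std m →
    (mon t : Tree →₀ K) ∈ multilin K (std m) := fun t h1 h2 => mon_mem_multilin ⟨h1, h2⟩
  unfold relations at hr
  split at hr
  · obtain rfl := hr
    exact Submodule.add_mem _ (Submodule.add_mem _ (key _ (by decide) (by decide))
      (key _ (by decide) (by decide))) (key _ (by decide) (by decide))
  · obtain rfl := hr
    exact Submodule.sub_mem _ (key _ (by decide) (by decide)) (Submodule.add_mem _
      (Submodule.add_mem _ (key _ (by decide) (by decide)) (key _ (by decide) (by decide)))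
      (key _ (by decide) (by decide)))
  · obtain rfl := hr
    exact Submodule.sub_mem _ (Submodule.sub_mem _ (key _ (by decide) (by decide))
      (key _ (by decide) (by decide))) (highMonomials_le _ assocTail_mem)
  · exact hr.elim

lemma relations_mem_ker [CharZero K] (n : ℕ) (r : Tree →₀ K) (hr : r ∈ relations K n) :
    evalAs K r = 0 := by
  unfold relations at hr
  split at hr
  · obtain rfl := hr
    exact evalAs_jacobi
  · obtain rfl := hr
    exact evalAs_leibniz
  · obtain rfl := hr
    exact evalAs_deformedAssoc
  · exact hr.elim

lemma isOperadIdeal_symmetryIdeal : IsOperadIdeal K (symmetryIdeal K) :=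
  isOperadIdeal_operadIdeal symmetryRelations_mem_multilin

lemma isOperadIdeal_presIdeal : IsOperadIdeal K (presIdeal K) :=
  isOperadIdeal_operadIdeal fun n r hr =>
    hr.elim (symmetryRelations_mem_multilin n r) (relations_mem_multilin n r)

lemma symmetryIdeal_le_presIdeal (S : Finset ℕ) : symmetryIdeal K S ≤ presIdeal K S :=
  fun _ hp => mem_operadIdeal.1 hp _ isOperadIdeal_presIdeal
    fun _ _ hr => subset_operadIdeal (.inl hr)

lemma evalAs_eq_zero_of_mem_presIdeal [CharZero K] {S : Finset ℕ} {p : Tree →₀ K}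
    (hp : p ∈ presIdeal K S) : evalAs K p = 0 :=
  (mem_operadIdeal.1 hp _ isOperadIdeal_ker fun n r hr => hr.elim
    (fun h => ⟨symmetryRelations_mem_multilin n r h, symmetryRelations_mem_ker n r h⟩)
    fun h => ⟨relations_mem_multilin n r h, relations_mem_ker n r h⟩).2

end Kernel

/-! ### The image of the evaluation -/

section Image

variable {K : Type*} [Field K]

lemma mul_mem_As {S U : Finset ℕ} (h : Disjoint S U) {p q : FreeAlgebra K ℕ} (hp : p ∈ As K S)
    (hq : q ∈ As K U) : p * q ∈ As K (S ∪ U) := by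
  have := Submodule.mul_mem_mul hp hq
  rw [As, As, Submodule.span_mul_span] at this
  refine Submodule.span_mono ?_ this
  rintro _ ⟨_, ⟨l, h1, h2, rfl, rfl⟩, _, ⟨l', h1', h2', rfl, rfl⟩, rfl⟩
  refine ⟨l ++ l', by simp [h1], ?_, by simp, by simp⟩
  rw [List.nodup_append']
  refine ⟨h2, h2', fun i hi hi' => Finset.disjoint_left.1 h (List.mem_toFinset.2 hi)
    (List.mem_toFinset.2 hi')⟩

lemma disjoint_labels {a b : Tree} (h : a.leaves.Disjoint b.leaves) :
    Disjoint a.labels b.labels :=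
  Finset.disjoint_left.2 fun _ hi hi' => h (mem_labels.1 hi) (mem_labels.1 hi')

lemma evalTree_mem_As {t : Tree} (h : t.leaves.Nodup) : evalTree K t ∈ As K t.labels := by
  induction t with
  | leaf i => exact Submodule.subset_span ⟨[i], by simp, by simp, by simp, by simp [evalTree]⟩
  | nu a b ha hb =>
    rw [leaves, List.nodup_append'] at h
    have hd := disjoint_labels h.2.2
    rw [labels_nu, evalTree, comm2]
    refine Submodule.sub_mem _ (mul_mem_As hd (ha h.1) (hb h.2.1)) ?_
    rw [Finset.union_comm]
    exact mul_mem_As hd.symm (hb h.2.1) (ha h.1)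
  | mu a b c ha hb hc =>
    rw [leaves, List.nodup_append', List.nodup_append'] at h
    have hab := disjoint_labels h.1.2.2
    have hac : Disjoint a.labels c.labels := disjoint_labels fun i hi =>
      h.2.2 (List.mem_append_left _ hi)
    have hbc : Disjoint b.labels c.labels := disjoint_labels fun i hi =>
      h.2.2 (List.mem_append_right _ hi)
    have key : ∀ {S U V : Finset ℕ} {x y z : FreeAlgebra K ℕ}, Disjoint S U → Disjoint S V →
        Disjoint U V → x ∈ As K S → y ∈ As K U → z ∈ As K V → S ∪ U ∪ V = (mu a b c).labels →
        x * y * z ∈ As K (mu a b c).labels := by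
      intro S U V x y z h1 h2 h3 hx hy hz e
      rw [← e]
      exact mul_mem_As (Finset.disjoint_union_left.2 ⟨h2, h3⟩) (mul_mem_As h1 hx hy) hz
    have ha := ha h.1.1
    have hb := hb h.1.2.1
    have hc := hc h.2.1
    rw [evalTree, sym3_eq]
    refine Submodule.add_mem _ (Submodule.add_mem _ (Submodule.add_mem _ (Submodule.add_mem _
      (Submodule.add_mem _ ?_ ?_) ?_) ?_) ?_) ?_
    · exact key hab hac hbc ha hb hc (by rw [labels_mu])
    · exact key hab.symm hbc hac hb ha hc (by rw [labels_mu]; ac_rfl)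
    · exact key hbc.symm hac.symm hab.symm hc hb ha (by rw [labels_mu]; ac_rfl)
    · exact key hac hab hbc.symm ha hc hb (by rw [labels_mu]; ac_rfl)
    · exact key hbc hab.symm hac.symm hb hc ha (by rw [labels_mu]; ac_rfl)
    · exact key hac.symm hbc.symm hab hc ha hb (by rw [labels_mu]; ac_rfl)

lemma flip_X (i : ℕ) : flip K (X K i) = X K i := by
  simp [flip, X, FreeAlgebra.starHom]

lemma flip_mul (a b : FreeAlgebra K ℕ) : flip K (a * b) = flip K b * flip K a := by
  simp [flip]

lemma flip_one : flip K 1 = 1 := by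
  simp [flip]

lemma flip_prod (l : List ℕ) : flip K (l.map (X K)).prod = (l.reverse.map (X K)).prod := by
  induction l with
  | nil => simp [flip_one]
  | cons a l ih => simp [flip_mul, ih, flip_X]

lemma flip_comm2 (a b : FreeAlgebra K ℕ) : flip K (comm2 a b) = -comm2 (flip K a) (flip K b) := by
  simp [comm2, flip_mul]

lemma flip_sym3 (a b c : FreeAlgebra K ℕ) :
    flip K (sym3 a b c) = sym3 (flip K a) (flip K b) (flip K c) := by
  simp only [sym3_eq, map_add, flip_mul, ← mul_assoc]
  abel

/-- Reversal is an antiautomorphism: it changes the sign of a commutator and preserves the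
symmetrized product. So the sign is the parity of the number of `ν`, and this has the parity of the
number of leaves minus one, since `μ` adds two inputs. -/
lemma flip_evalTree (t : Tree) :
    flip K (evalTree K t) = (-1 : K) ^ (t.leaves.length + 1) • evalTree K t := by
  have sm : ∀ (z w : K) (a b : FreeAlgebra K ℕ), comm2 (z • a) (w • b) = (z * w) • comm2 a b := by
    intro z w a b
    simp only [comm2, smul_mul_smul_comm, mul_comm w z, smul_sub]
  have sm3 : ∀ (z w u : K) (a b c : FreeAlgebra K ℕ),
      sym3 (z • a) (w • b) (u • c) = (z * w * u) • sym3 a b c := by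
    intro z w u a b c
    simp only [sym3_eq, smul_mul_smul_comm, smul_add]
    congr 1; congr 1; congr 1; congr 1; congr 1
    all_goals congr 1; ring
  induction t with
  | leaf i => simp [evalTree, flip_X, leaves]
  | nu a b ha hb =>
    rw [evalTree, flip_comm2, ha, hb, sm, ← neg_smul, leaves, List.length_append]
    congr 1
    ring
  | mu a b c ha hb hc =>
    rw [evalTree, flip_sym3, ha, hb, hc, sm3, leaves, List.length_append, List.length_append]
    congr 1
    ring

lemma length_leaves {S : Finset ℕ} {t : Tree} (ht : t ∈ treeMonomials S) :
    t.leaves.length = S.card := by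
  rw [← ht.2, labels, List.toFinset_card_of_nodup ht.1]

lemma evalTree_mem_asInv {S : Finset ℕ} {t : Tree} (ht : t ∈ treeMonomials S) :
    evalTree K t ∈ asInv K S := by
  refine ⟨?_, ?_⟩
  · rw [← ht.2]; exact evalTree_mem_As ht.1
  · have hpos : 0 < t.leaves.length := List.length_pos_of_ne_nil (leaves_ne_nil t)
    rw [SetLike.mem_coe, LinearMap.mem_eqLocus, tau, LinearMap.smul_apply, flip_evalTree,
      ← length_leaves ht, smul_smul, ← pow_add, Even.neg_one_pow, one_smul, LinearMap.id_apply]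
    exact ⟨t.leaves.length, by omega⟩

variable (K) in
/-- The values of the elements of the free operad with label set `S`. -/
def image (S : Finset ℕ) : Submodule K (FreeAlgebra K ℕ) := (multilin K S).map (evalAs K)

lemma image_eq_span (S : Finset ℕ) :
    image K S = Submodule.span K (evalTree K '' treeMonomials S) := by
  rw [image, multilin_eq_span, Submodule.map_span, Set.image_image]
  simp only [evalAs_mon]

lemma evalTree_mem_image {S : Finset ℕ} {t : Tree} (ht : t ∈ treeMonomials S) :
    evalTree K t ∈ image K S := by
  rw [image_eq_span]
  exact Submodule.subset_span ⟨t, ht, rfl⟩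

lemma image_le_asInv (S : Finset ℕ) : image K S ≤ asInv K S := by
  rw [image_eq_span, Submodule.span_le]
  rintro _ ⟨t, ht, rfl⟩
  exact evalTree_mem_asInv ht

lemma mu_mem_treeMonomials {S U V : Finset ℕ} (hSU : Disjoint S U) (hSV : Disjoint S V)
    (hUV : Disjoint U V) {a b c : Tree} (ha : a ∈ treeMonomials S) (hb : b ∈ treeMonomials U)
    (hc : c ∈ treeMonomials V) : mu a b c ∈ treeMonomials (S ∪ U ∪ V) := by
  refine ⟨?_, by rw [labels_mu, ha.2, hb.2, hc.2]⟩
  rw [leaves, List.nodup_append', List.nodup_append']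
  rw [← ha.2, ← hb.2, Finset.disjoint_left] at hSU
  rw [← ha.2, ← hc.2, Finset.disjoint_left] at hSV
  rw [← hb.2, ← hc.2, Finset.disjoint_left] at hUV
  simp only [mem_labels] at hSU hSV hUV
  refine ⟨⟨ha.1, hb.1, hSU⟩, hc.1, fun i hi hi' => ?_⟩
  rcases List.mem_append.1 hi with hi | hi
  exacts [hSV hi hi', hUV hi hi']

lemma nu_mem_treeMonomials {S U : Finset ℕ} (hSU : Disjoint S U) {a b : Tree}
    (ha : a ∈ treeMonomials S) (hb : b ∈ treeMonomials U) : nu a b ∈ treeMonomials (S ∪ U) := by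
  refine ⟨?_, by rw [labels_nu, ha.2, hb.2]⟩
  rw [← ha.2, ← hb.2, Finset.disjoint_left] at hSU
  simp only [mem_labels] at hSU
  rw [leaves, List.nodup_append']
  exact ⟨ha.1, hb.1, hSU⟩

/-- Linearity in the first argument allows a sum of values there, such as `flipSum`, and not only
the value of one tree. -/
lemma sym3_mem_image {S U V : Finset ℕ} (hSU : Disjoint S U) (hSV : Disjoint S V)
    (hUV : Disjoint U V) {x : FreeAlgebra K ℕ} (hx : x ∈ image K S) {b c : Tree}
    (hb : b ∈ treeMonomials U) (hc : c ∈ treeMonomials V) :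
    sym3 x (evalTree K b) (evalTree K c) ∈ image K (S ∪ U ∪ V) := by
  rw [← sym3L_apply]
  suffices image K S ≤ (image K (S ∪ U ∪ V)).comap (sym3L (evalTree K b) (evalTree K c)) from
    this hx
  conv_lhs => rw [image_eq_span]
  rw [Submodule.span_le]
  rintro _ ⟨a, ha, rfl⟩
  rw [SetLike.mem_coe, Submodule.mem_comap, sym3L_apply]
  exact evalTree_mem_image (mu_mem_treeMonomials hSU hSV hUV ha hb hc)

variable (K) in
/-- The product of the values of trees. -/
def treeProd (l : List Tree) : FreeAlgebra K ℕ := (l.map (evalTree K)).prod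

variable (K) in
/-- The (anti)symmetrization of a product of trees with respect to reversal. -/
def flipSum (l : List Tree) : FreeAlgebra K ℕ :=
  treeProd K l + (-1 : K) ^ (l.length + 1) • treeProd K l.reverse

lemma treeProd_append (l l' : List Tree) : treeProd K (l ++ l') = treeProd K l * treeProd K l' := by
  simp [treeProd]

lemma treeProd_cons (a : Tree) (l : List Tree) :
    treeProd K (a :: l) = evalTree K a * treeProd K l := by
  simp [treeProd]

/-- In the reversed products the difference is minus a commutator; this sign is absorbed because the
list becomes one shorter and the sign in `flipSum` depends on the length. -/
lemma flipSum_swap (l l' : List Tree) (a b : Tree) :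
    flipSum K (l ++ a :: b :: l') - flipSum K (l ++ b :: a :: l')
      = flipSum K (l ++ nu a b :: l') := by
  simp only [flipSum, treeProd_append, treeProd_cons, List.reverse_append, List.reverse_cons,
    List.length_append, List.length_cons, evalTree, comm2, List.append_assoc, List.cons_append,
    List.nil_append, pow_add, pow_one]
  simp only [mul_neg, mul_one, neg_neg, neg_smul]
  simp only [mul_sub, sub_mul, smul_sub, mul_assoc]
  abel

/-- The labels of a list of trees. -/
def listLeaves (l : List Tree) : List ℕ := l.flatMap leaves

/-- By `flipSum_swap` each adjacent transposition costs a `flipSum` of a list of length `n`, which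
lies in the image by assumption. The prefix `m` is carried along so that transpositions may happen
inside a list. -/
lemma flipSum_perm_sub_mem {n : ℕ} {S : Finset ℕ}
    (ih : ∀ l : List Tree, l.length = n → (listLeaves l).Nodup →
      (listLeaves l).toFinset = S → flipSum K l ∈ image K S)
    {l l' : List Tree} (h : l.Perm l') : ∀ m : List Tree, (m ++ l).length = n + 1 →
      (listLeaves (m ++ l)).Nodup → (listLeaves (m ++ l)).toFinset = S →
      flipSum K (m ++ l) - flipSum K (m ++ l') ∈ image K S := by
  induction h with
  | nil => intro m _ _ _; rw [sub_self]; exact zero_mem _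
  | @cons x l₁ l₂ _ IH =>
    intro m h1 h2 h3
    have e : ∀ l : List Tree, m ++ x :: l = (m ++ [x]) ++ l := by simp
    rw [e l₁] at h1 h2 h3
    rw [e l₁, e l₂]
    exact IH _ h1 h2 h3
  | swap x y l =>
    intro m h1 h2 h3
    rw [flipSum_swap]
    refine ih _ (by simp at h1 ⊢; omega) ?_ ?_
    · simpa [listLeaves, leaves] using h2
    · simpa [listLeaves, leaves] using h3
  | @trans l₁ l₂ l₃ p q IH IH' =>
    intro m h1 h2 h3
    have hp : (listLeaves (m ++ l₁)).Perm (listLeaves (m ++ l₂)) :=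
      (p.append_left m).flatMap_right _
    rw [← sub_add_sub_cancel]
    refine Submodule.add_mem _ (IH m h1 h2 h3) (IH' m ?_ (hp.nodup_iff.1 h2) ?_)
    · rw [← h1, List.length_append, List.length_append, p.length_eq]
    · rw [← h3, List.toFinset_eq_of_perm _ _ hp]

/-- The induction is on the number of factors, with arbitrary trees as factors, because reordering
merges two factors into a commutator. The order of factors being irrelevant modulo the image,
reversal settles even length and symmetrization settles odd length. -/
lemma flipSum_mem_image [CharZero K] (n : ℕ) : ∀ (S : Finset ℕ) (l : List Tree), l.length = n + 1 →
    (listLeaves l).Nodup → (listLeaves l).toFinset = S → flipSum K l ∈ image K S := by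
  induction n using Nat.strong_induction_on with
  | _ n ih =>
  intro S l hl hnd hS
  have halve : ∀ (z : K) {x : FreeAlgebra K ℕ}, z ≠ 0 → z • x ∈ image K S → x ∈ image K S :=
    fun z x hz hx => (Submodule.smul_mem_iff _ hz).1 hx
  obtain _ | n := n
  · obtain ⟨a, rfl⟩ := List.length_eq_one_iff.1 hl
    have : flipSum K [a] = (2 : K) • evalTree K a := by
      simp [flipSum, treeProd, two_smul]
    rw [this]
    refine Submodule.smul_mem _ _ (evalTree_mem_image ⟨?_, ?_⟩)
    · simpa [listLeaves] using hnd
    · simpa [listLeaves, labels] using hS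
  have perm : ∀ l' : List Tree, l.Perm l' → flipSum K l - flipSum K l' ∈ image K S :=
    fun l' h => flipSum_perm_sub_mem (n := n + 1) (ih n (by omega) S) h [] hl hnd hS
  -- The length is now `n + 2`. If it is even, reversing the list changes the sign of `flipSum`, so
  -- twice the element is a difference of two reorderings.
  rcases Nat.even_or_odd n with hn | hn
  · have h1 : flipSum K l.reverse = -flipSum K l := by
      rw [flipSum, flipSum, List.length_reverse, List.reverse_reverse, hl]
      have : (-1 : K) ^ (n + 1 + 1 + 1) = -1 := Odd.neg_one_pow (by
        obtain ⟨k, rfl⟩ := hn; exact ⟨k + 1, by omega⟩)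
      rw [this]
      simp
    have := perm l.reverse l.reverse_perm.symm
    rw [h1, sub_neg_eq_add, ← two_smul K] at this
    exact halve 2 two_ne_zero this
  · obtain ⟨k, hk⟩ := hn
    match l, hl with
    | a :: b :: m, hl =>
      have hm : m.length = n := by simpa using hl
      have hnd' := hnd
      simp only [listLeaves, List.flatMap_cons, List.nodup_append', List.disjoint_append_right]
        at hnd'
      obtain ⟨ha, ⟨hb, hlm, hbm⟩, hab, ham⟩ := hnd'
      -- In the odd case the remaining list `m` has odd length `n`, hence `flipSum` of it is a plain
      -- sum with its reversal, and `sym3` with the trees `a`, `b` produces six `flipSum`s of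
      -- reorderings of the whole list.
      have hq := ih (n - 1) (by omega) (listLeaves m).toFinset m (by omega) hlm rfl
      have key := sym3_mem_image (U := a.labels) (V := b.labels) ?_ ?_ (disjoint_labels hab) hq
        ⟨ha, rfl⟩ ⟨hb, rfl⟩
      · have hS' : (listLeaves m).toFinset ∪ a.labels ∪ b.labels = S := by
          rw [← hS]
          simp only [listLeaves, List.flatMap_cons, List.toFinset_append, labels]
          ac_rfl
        rw [hS'] at key
        have hsum : sym3 (flipSum K m) (evalTree K a) (evalTree K b)
            = flipSum K (m ++ [a, b]) + flipSum K (m ++ [b, a]) + flipSum K (a :: m ++ [b])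
              + flipSum K (b :: m ++ [a]) + flipSum K (a :: b :: m) + flipSum K (b :: a :: m) := by
          have s1 : (-1 : K) ^ (n + 1) = 1 := Even.neg_one_pow ⟨k + 1, by omega⟩
          have s3 : (-1 : K) ^ (n + 1 + 1 + 1) = 1 := Even.neg_one_pow ⟨k + 2, by omega⟩
          simp only [flipSum, sym3_eq, List.length_append, List.length_cons, List.length_nil, hm,
            List.reverse_append, List.reverse_cons, List.reverse_nil, treeProd_append,
            treeProd_cons, List.nil_append, List.cons_append, zero_add, Nat.reduceAdd,
            ← add_assoc, s1, s3, one_smul]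
          simp only [show treeProd K [] = 1 from rfl, mul_one, add_mul, mul_add, ← mul_assoc]
          abel
        have hp := fun l' (h : (a :: b :: m).Perm l') => perm l' h
        have p1 := hp (m ++ [a, b]) (List.perm_append_comm (l₁ := [a, b]))
        have p2 := hp (m ++ [b, a]) ((List.Perm.swap b a m).trans
          (List.perm_append_comm (l₁ := [b, a])))
        have p3 := hp (a :: m ++ [b]) ((List.perm_append_comm (l₁ := [b])).cons a)
        have p4 := hp (b :: m ++ [a]) ((List.Perm.swap b a m).trans
          ((List.perm_append_comm (l₁ := [a])).cons b))
        have p6 := hp (b :: a :: m) (List.Perm.swap b a m)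
        rw [hsum] at key
        have tot := Submodule.add_mem _ (Submodule.add_mem _ (Submodule.add_mem _
          (Submodule.add_mem _ (Submodule.add_mem _ key p1) p2) p3) p4) p6
        refine halve 6 (by norm_num) ?_
        convert tot using 1
        module
      · exact Finset.disjoint_left.2 fun i hi hi' =>
          ham (mem_labels.1 hi') (List.mem_toFinset.1 hi)
      · exact Finset.disjoint_left.2 fun i hi hi' =>
          hbm (mem_labels.1 hi') (List.mem_toFinset.1 hi)

lemma treeProd_map_leaf (l : List ℕ) : treeProd K (l.map leaf) = (l.map (X K)).prod := by
  rw [treeProd, List.map_map]; rfl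

theorem image_eq_asInv [CharZero K] (S : Finset ℕ) : image K S = asInv K S := by
  refine le_antisymm (image_le_asInv S) fun p hp => ?_
  -- For a word `w` the element `w + τ w` is the `flipSum` of its letters. On an invariant the map
  -- `id + τ` is multiplication by two, which is invertible.
  have h : As K S ≤ (image K S).comap (LinearMap.id + tau K S) := by
    rw [As, Submodule.span_le]
    rintro _ ⟨l, hl, hnd, hS, rfl⟩
    have hlen : l.length = l.length - 1 + 1 := by
      have := List.length_pos_of_ne_nil hl; omega
    have e : listLeaves (l.map leaf) = l := by
      rw [listLeaves, List.flatMap_map]; exact List.flatMap_singleton' l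
    have := flipSum_mem_image (K := K) (l.length - 1) S (l.map leaf)
      (by rw [List.length_map]; exact hlen) (by rwa [e]) (by rwa [e])
    rw [SetLike.mem_coe, Submodule.mem_comap, LinearMap.add_apply, LinearMap.id_apply, tau,
      LinearMap.smul_apply, flip_prod]
    rw [flipSum, treeProd_map_leaf, ← List.map_reverse, treeProd_map_leaf, List.length_map] at this
    convert this using 3
    rw [← hS, List.toFinset_card_of_nodup hnd, hlen, Nat.add_sub_cancel, pow_add, pow_add]
    simp
  have h2 := h hp.1
  rw [Submodule.mem_comap, LinearMap.add_apply, LinearMap.mem_eqLocus.1 hp.2,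
    LinearMap.id_apply, ← two_smul K] at h2
  exact (Submodule.smul_mem_iff _ two_ne_zero).1 h2

/-! ### The generated suboperad -/

/-- Closure under relabelling and composition is inherited from the free operad through
`image_eq_asInv`, with no computation of how `τ` interacts with composition. -/
lemma isSuboperad_asInv [CharZero K] : IsSuboperad K (asInv K) where
  le _ := inf_le_left
  unit_mem i := evalTree_mem_asInv (leaf_mem_shuffleMonomials i).1
  relabel_mem σ S p hp := by
    rw [← image_eq_asInv] at hp ⊢
    obtain ⟨q, hq, rfl⟩ := hp
    exact ⟨relabel σ q, isOperadIdeal_multilin.relabel_mem σ S q hq, evalAs_relabel σ q⟩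
  comp_mem S U i hi hd p hp q hq := by
    rw [← image_eq_asInv] at hp hq ⊢
    obtain ⟨p, hp, rfl⟩ := hp
    obtain ⟨q, hq, rfl⟩ := hq
    exact ⟨comp i p q, isOperadIdeal_multilin.comp_mem_left S U i hi hd p hp q hq,
      evalAs_comp hi hp q⟩

lemma std_two : std 2 = {1, 2} := by decide
lemma std_three : std 3 = {1, 2, 3} := by decide

lemma generators_mem_asInv (n : ℕ) (g : FreeAlgebra K ℕ) (hg : g ∈ generators K n) :
    g ∈ asInv K (std n) := by
  unfold generators at hg
  split at hg
  · obtain rfl := hg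
    exact evalTree_mem_asInv (t := nu (leaf 1) (leaf 2)) ⟨by decide, by decide⟩
  · obtain rfl := hg
    exact evalTree_mem_asInv (t := mu (leaf 1) (leaf 2) (leaf 3)) ⟨by decide, by decide⟩
  · exact hg.elim

lemma IsSuboperad.graft_mem {P : Finset ℕ → Submodule K (FreeAlgebra K ℕ)}
    (hP : IsSuboperad K P) {S U : Finset ℕ} {i : ℕ} (hi : i ∈ S) (hd : Disjoint (S.erase i) U)
    {s u : Tree} (hs : evalTree K s ∈ P S) (hu : evalTree K u ∈ P U) :
    evalTree K (s.graft i u) ∈ P (S.erase i ∪ U) := by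
  rw [evalTree_graft]
  exact hP.comp_mem S U i hi hd _ hs _ hu

/-- A tree is built from its root: the generator is relabelled by inputs larger than every label of
the tree, and the subtrees are grafted there one after another without clashes. -/
lemma IsSuboperad.evalTree_mem {P : Finset ℕ → Submodule K (FreeAlgebra K ℕ)}
    (hP : IsSuboperad K P) (hG : ∀ n, ∀ g ∈ generators K n, g ∈ P (std n)) {t : Tree}
    (ht : t.leaves.Nodup) : evalTree K t ∈ P t.labels := by
  -- The bound `3 < N` guarantees that `shiftPerm N` really moves the labels `1, 2, 3` of the
  -- generators beyond `N`.
  have fresh : ∀ S : Finset ℕ, ∃ N, 3 < N ∧ ∀ j ∈ S, j < N := fun S =>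
    ⟨S.sup id + 4, by omega, fun j hj => by have := Finset.le_sup (f := id) hj; simp at this; omega⟩
  induction t with
  | leaf i => rw [labels_leaf]; exact hP.unit_mem i
  | nu a b ha hb =>
    rw [leaves, List.nodup_append'] at ht
    obtain ⟨N, hN3, hN⟩ := fresh (nu a b).labels
    have hNa : ∀ j ∈ a.labels, j < N := fun j hj => hN j (by rw [labels_nu]; simp_all)
    have hNb : ∀ j ∈ b.labels, j < N := fun j hj => hN j (by rw [labels_nu]; simp_all)
    have h0 := hP.relabel_mem (shiftPerm N) (std 2) _ (hG 2 (comm2 (X K 1) (X K 2)) rfl)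
    have e0 : asRelabel K (shiftPerm N) (comm2 (X K 1) (X K 2))
        = evalTree K (nu (leaf (1 + N)) (leaf (2 + N))) := by
      rw [← shiftPerm_of_lt (show 1 < N by omega), ← shiftPerm_of_lt (show 2 < N by omega)]
      exact (evalTree_relabel (shiftPerm N) (nu (leaf 1) (leaf 2))).symm
    have e1 : (std 2).image (shiftPerm N) = {1 + N, 2 + N} := by
      rw [std_two, Finset.image_insert, Finset.image_singleton, shiftPerm_of_lt (by omega),
        shiftPerm_of_lt (by omega)]
    rw [e0, e1] at h0
    have h1 := hP.graft_mem (i := 1 + N) (by simp) (U := a.labels) ?_ h0 (ha ht.1)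
    · have h2 := hP.graft_mem (i := 2 + N) (by simp) (U := b.labels) ?_ h1 (hb ht.2.1)
      · have ea : a.graft (2 + N) b = a := graft_of_notMem (fun h => by
          have := hNa _ (mem_labels.2 h); omega) b
        convert h2 using 1
        · congr 1
          ext j
          have := hNa j
          have := hNb j
          simp only [labels_nu, mem_union, mem_erase, mem_insert, mem_singleton]
          constructor
          · rintro (h | h)
            · have := hNa j h; exact .inl ⟨by omega, .inr h⟩
            · exact .inr h
          · rintro (⟨h, ⟨h', h'' | h''⟩ | h'⟩ | h')
            · omega
            · omega
            · exact .inl h'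
            · exact .inr h'
        · unfold graft at ea ⊢
          simp [Tree.bind, ea]
      · rw [Finset.disjoint_left]
        intro j hj hj'
        have := hNb j hj'
        simp only [mem_union, mem_erase, mem_insert, mem_singleton] at hj
        rcases hj with ⟨h, ⟨h', h'' | h''⟩ | h'⟩
        · omega
        · omega
        · exact ht.2.2 (mem_labels.1 h') (mem_labels.1 hj')
    · rw [Finset.disjoint_left]
      intro j hj hj'
      have := hNa j hj'
      simp only [mem_erase, mem_insert, mem_singleton] at hj
      omega
  | mu a b c ha hb hc =>
    rw [leaves, List.nodup_append', List.nodup_append'] at ht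
    have hab := ht.1.2.2
    have hc' : ∀ j, j ∈ c.leaves → j ∉ a.leaves ∧ j ∉ b.leaves := fun j hj => by
      have : j ∉ a.leaves ++ b.leaves := fun h => ht.2.2 h hj
      simpa using this
    obtain ⟨N, hN3, hN⟩ := fresh (mu a b c).labels
    have hNa : ∀ j ∈ a.leaves, j < N := fun j hj => hN j (by rw [labels_mu]; simp_all)
    have hNb : ∀ j ∈ b.leaves, j < N := fun j hj => hN j (by rw [labels_mu]; simp_all)
    have hNc : ∀ j ∈ c.leaves, j < N := fun j hj => hN j (by rw [labels_mu]; simp_all)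
    have h0 := hP.relabel_mem (shiftPerm N) (std 3) _ (hG 3 (sym3 (X K 1) (X K 2) (X K 3)) rfl)
    have e0 : asRelabel K (shiftPerm N) (sym3 (X K 1) (X K 2) (X K 3))
        = evalTree K (mu (leaf (1 + N)) (leaf (2 + N)) (leaf (3 + N))) := by
      rw [← shiftPerm_of_lt (show 1 < N by omega), ← shiftPerm_of_lt (show 2 < N by omega),
        ← shiftPerm_of_lt (show 3 < N by omega)]
      exact (evalTree_relabel (shiftPerm N) (mu (leaf 1) (leaf 2) (leaf 3))).symm
    have e1 : (std 3).image (shiftPerm N) = {1 + N, 2 + N, 3 + N} := by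
      rw [std_three, Finset.image_insert, Finset.image_insert, Finset.image_singleton,
        shiftPerm_of_lt (by omega), shiftPerm_of_lt (by omega), shiftPerm_of_lt (by omega)]
    rw [e0, e1] at h0
    have h1 := hP.graft_mem (i := 1 + N) (by simp) (U := a.labels) ?_ h0 (ha ht.1.1)
    · have h2 := hP.graft_mem (i := 2 + N) (by simp) (U := b.labels) ?_ h1 (hb ht.1.2.1)
      · have h3 := hP.graft_mem (i := 3 + N) (by simp) (U := c.labels) ?_ h2 (hc ht.2.1)
        · have ea : a.graft (2 + N) b = a := graft_of_notMem (fun h => by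
            have := hNa _ h; omega) b
          have ea' : a.graft (3 + N) c = a := graft_of_notMem (fun h => by
            have := hNa _ h; omega) c
          have eb : b.graft (3 + N) c = b := graft_of_notMem (fun h => by
            have := hNb _ h; omega) c
          convert h3 using 1
          · congr 1
            ext j
            simp only [labels_mu, mem_union, mem_erase, mem_insert, mem_singleton, mem_labels]
            constructor
            · rintro ((h | h) | h)
              · have := hNa j h; exact .inl ⟨by omega, .inl ⟨by omega, .inr h⟩⟩
              · have := hNb j h; exact .inl ⟨by omega, .inr h⟩
              · exact .inr h
            · rintro (⟨h, ⟨h', ⟨h'', h3⟩ | h''⟩ | h'⟩ | h')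
              · omega
              · exact .inl (.inl h'')
              · exact .inl (.inr h')
              · exact .inr h'
          · unfold graft at ea ea' eb ⊢
            simp [Tree.bind, ea, ea', eb]
        · rw [Finset.disjoint_left]
          intro j hj hj'
          rw [mem_labels] at hj'
          have := hNc j hj'
          have := hc' j hj'
          simp only [mem_union, mem_erase, mem_insert, mem_singleton, mem_labels] at hj
          rcases hj with ⟨h, ⟨h', ⟨h'', h3⟩ | h''⟩ | h'⟩
          · omega
          · exact this.1 h''
          · exact this.2 h'
      · rw [Finset.disjoint_left]
        intro j hj hj'
        rw [mem_labels] at hj'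
        have := hNb j hj'
        simp only [mem_union, mem_erase, mem_insert, mem_singleton, mem_labels] at hj
        rcases hj with ⟨h, ⟨h', h''⟩ | h'⟩
        · omega
        · exact hab h' hj'
    · rw [Finset.disjoint_left]
      intro j hj hj'
      have := hNa j (mem_labels.1 hj')
      simp only [mem_erase, mem_insert, mem_singleton] at hj
      omega

theorem suboperadGen_eq_asInv [CharZero K] (S : Finset ℕ) :
    suboperadGen K (generators K) S = asInv K S := by
  refine le_antisymm (sInf_le ⟨asInv K, isSuboperad_asInv, generators_mem_asInv, rfl⟩) ?_
  refine le_sInf ?_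
  rintro _ ⟨P, hP, hG, rfl⟩
  rw [← image_eq_asInv, image_eq_span, Submodule.span_le]
  rintro _ ⟨t, ht, rfl⟩
  rw [← ht.2]
  exact hP.evalTree_mem hG ht.1

end Image

/-! ### Shuffle representatives -/

namespace Tree

/-- The shuffle tree obtained by sorting the inputs of every vertex. -/
def sortTree : Tree → Tree
  | leaf i => leaf i
  | nu a b => if a.minLeaf < b.minLeaf then nu a.sortTree b.sortTree else nu b.sortTree a.sortTree
  | mu a b c =>
    if a.minLeaf < b.minLeaf then
      if b.minLeaf < c.minLeaf then mu a.sortTree b.sortTree c.sortTree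
      else if a.minLeaf < c.minLeaf then mu a.sortTree c.sortTree b.sortTree
      else mu c.sortTree a.sortTree b.sortTree
    else
      if a.minLeaf < c.minLeaf then mu b.sortTree a.sortTree c.sortTree
      else if b.minLeaf < c.minLeaf then mu b.sortTree c.sortTree a.sortTree
      else mu c.sortTree b.sortTree a.sortTree

/-- The sign of sorting the inputs of every vertex. -/
def sortSign (K : Type*) [Field K] : Tree → K
  | leaf _ => 1
  | nu a b => a.sortSign K * b.sortSign K * if a.minLeaf < b.minLeaf then 1 else -1
  | mu a b c => a.sortSign K * b.sortSign K * c.sortSign K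

lemma sortSign_ne_zero (K : Type*) [Field K] (t : Tree) : t.sortSign K ≠ 0 := by
  induction t with
  | leaf i => exact one_ne_zero
  | nu a b ha hb => rw [sortSign]; split_ifs <;> simp [ha, hb]
  | mu a b c ha hb hc => simp [sortSign, ha, hb, hc]

lemma labels_sortTree (t : Tree) : t.sortTree.labels = t.labels := by
  induction t with
  | leaf i => rfl
  | nu a b ha hb =>
    rw [sortTree]
    split_ifs <;> simp only [labels_nu, ha, hb]
    rw [Finset.union_comm]
  | mu a b c ha hb hc =>
    rw [sortTree]
    split_ifs <;> simp only [labels_mu, ha, hb, hc] <;> ac_rfl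

lemma minLeaf_sortTree (t : Tree) : t.sortTree.minLeaf = t.minLeaf :=
  minLeaf_eq_of_labels_eq (labels_sortTree t)

lemma degree_sortTree (t : Tree) : t.sortTree.degree = t.degree := by
  induction t with
  | leaf i => rfl
  | nu a b ha hb =>
    rw [sortTree]
    split_ifs <;> simp only [degree, ha, hb]
    omega
  | mu a b c ha hb hc =>
    rw [sortTree]
    split_ifs <;> simp only [degree, ha, hb, hc] <;> omega

lemma minLeaf_ne_of_disjoint {a b : Tree} (h : a.leaves.Disjoint b.leaves) :
    a.minLeaf ≠ b.minLeaf := fun e => h (minLeaf_mem a) (e ▸ minLeaf_mem b)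

lemma nodup_nu {a b : Tree} : (nu a b).leaves.Nodup ↔
    a.leaves.Nodup ∧ b.leaves.Nodup ∧ a.leaves.Disjoint b.leaves := by
  rw [leaves, List.nodup_append']

lemma nodup_mu {a b c : Tree} : (mu a b c).leaves.Nodup ↔
    (a.leaves.Nodup ∧ b.leaves.Nodup ∧ c.leaves.Nodup) ∧ a.leaves.Disjoint b.leaves ∧
      a.leaves.Disjoint c.leaves ∧ b.leaves.Disjoint c.leaves := by
  rw [leaves, List.nodup_append', List.nodup_append', List.disjoint_append_left]
  tauto

lemma perm_leaves_sortTree (t : Tree) : t.sortTree.leaves.Perm t.leaves := by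
  induction t with
  | leaf i => rfl
  | nu a b ha hb =>
    rw [← Multiset.coe_eq_coe] at *
    rw [sortTree]
    split_ifs <;> simp only [leaves, ← Multiset.coe_add, ha, hb]
    rw [add_comm]
  | mu a b c ha hb hc =>
    rw [← Multiset.coe_eq_coe] at *
    rw [sortTree]
    split_ifs <;> simp only [leaves, ← Multiset.coe_add, ha, hb, hc] <;> ac_rfl

lemma isShuffle_sortTree {t : Tree} (h : t.leaves.Nodup) : t.sortTree.IsShuffle := by
  induction t with
  | leaf i => trivial
  | nu a b ha hb =>
    rw [nodup_nu] at h
    have := minLeaf_ne_of_disjoint h.2.2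
    rw [sortTree]
    split_ifs <;> simp only [IsShuffle, ha h.1, hb h.2.1, minLeaf_sortTree, and_true] <;> omega
  | mu a b c ha hb hc =>
    rw [nodup_mu] at h
    have h1 := minLeaf_ne_of_disjoint h.2.1
    have h2 := minLeaf_ne_of_disjoint h.2.2.1
    have h3 := minLeaf_ne_of_disjoint h.2.2.2
    rw [sortTree]
    split_ifs <;> simp only [IsShuffle, ha h.1.1, hb h.1.2.1, hc h.1.2.2, minLeaf_sortTree,
      and_true] <;> omega

end Tree

lemma sortTree_mem_shuffleMonomials {S : Finset ℕ} {t : Tree} (ht : t ∈ treeMonomials S) :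
    t.sortTree ∈ shuffleMonomials S :=
  ⟨⟨(perm_leaves_sortTree t).nodup_iff.2 ht.1, by rw [labels_sortTree, ht.2]⟩,
    isShuffle_sortTree ht.1⟩

section Representatives

variable {K : Type*} [Field K]

/-- Substitution into a one-vertex context. -/
lemma IsOperadIdeal.context {I : Finset ℕ → Submodule K (Tree →₀ K)} (hI : IsOperadIdeal K I)
    {S V W : Finset ℕ} {g : Tree → Tree} (hSV : Disjoint V S) (hW : V ∪ S = W)
    (hg : ∀ i ∉ V, g (leaf i) ∈ treeMonomials (insert i V) ∧
      ∀ u, (g (leaf i)).graft i u = g u) {a a' : Tree} {c : K}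
    (h : mon a - c • mon a' ∈ I S) : mon (g a) - c • mon (g a') ∈ I W := by
  obtain ⟨i, hi⟩ := Infinite.exists_notMem_finset V
  have e : (insert i V).erase i = V := Finset.erase_insert hi
  have := hI.graft_mem (U := S) (mem_insert_self i V) (by rwa [e]) (hg i hi).1 h
  rw [e, hW] at this
  convert this using 1
  rw [sub_eq_add_neg, sub_eq_add_neg, Finsupp.mapDomain_add, ← neg_smul, ← neg_smul,
    Finsupp.mapDomain_smul, mapDomain_mon, mapDomain_mon, (hg i hi).2, (hg i hi).2]

lemma leaf_mem (i : ℕ) : leaf i ∈ treeMonomials {i} := (leaf_mem_shuffleMonomials i).1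

lemma notMem_leaves {V : Finset ℕ} {b : Tree} (hb : b ∈ treeMonomials V) {i : ℕ} (hi : i ∉ V) :
    i ∉ b.leaves := by rwa [← mem_labels, hb.2]

/-- The two subtrees are replaced one at a time and the differences telescope, the second with the
coefficient left by the first. -/
lemma IsOperadIdeal.context_nu {I : Finset ℕ → Submodule K (Tree →₀ K)} (hI : IsOperadIdeal K I)
    {S V : Finset ℕ} (hd : Disjoint S V) {a a' b b' : Tree} {c d : K}
    (ha' : a' ∈ treeMonomials S) (hb : b ∈ treeMonomials V)
    (h : mon a - c • mon a' ∈ I S) (h' : mon b - d • mon b' ∈ I V) :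
    mon (nu a b) - (c * d) • mon (nu a' b') ∈ I (S ∪ V) := by
  have h1 := hI.context (W := S ∪ V) (g := fun u => nu u b) hd.symm (Finset.union_comm _ _)
    (fun i hi => ⟨nu_mem_treeMonomials (by simpa using hi) (leaf_mem i) hb, fun u => by
      have := graft_of_notMem (notMem_leaves hb hi) u
      unfold graft at this ⊢; simp [Tree.bind, this]⟩) h
  have h2 := hI.context (W := S ∪ V) (g := fun u => nu a' u) hd rfl
    (fun i hi => ⟨by
        have := nu_mem_treeMonomials (by simpa using hi) ha' (leaf_mem i)
        rwa [Finset.union_comm] at this, fun u => by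
      have := graft_of_notMem (notMem_leaves ha' hi) u
      unfold graft at this ⊢; simp [Tree.bind, this]⟩) h'
  convert Submodule.add_mem _ h1 (Submodule.smul_mem _ c h2) using 1
  module

lemma IsOperadIdeal.context_mu {I : Finset ℕ → Submodule K (Tree →₀ K)} (hI : IsOperadIdeal K I)
    {S U V : Finset ℕ} (hSU : Disjoint S U) (hSV : Disjoint S V) (hUV : Disjoint U V)
    {a a' b b' x x' : Tree} {c d e : K} (ha' : a' ∈ treeMonomials S) (hb : b ∈ treeMonomials U)
    (hb' : b' ∈ treeMonomials U) (hx : x ∈ treeMonomials V)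
    (h : mon a - c • mon a' ∈ I S) (h' : mon b - d • mon b' ∈ I U)
    (h'' : mon x - e • mon x' ∈ I V) :
    mon (mu a b x) - (c * d * e) • mon (mu a' b' x') ∈ I (S ∪ U ∪ V) := by
  have h1 := hI.context (V := U ∪ V) (W := S ∪ U ∪ V) (g := fun u => mu u b x)
    (Finset.disjoint_union_left.2 ⟨hSU.symm, hSV.symm⟩) (by ac_rfl)
    (fun i hi => by
      rw [mem_union, not_or] at hi
      refine ⟨?_, fun u => ?_⟩
      · convert mu_mem_treeMonomials (by simpa using hi.1) (by simpa using hi.2) hUV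
          (leaf_mem i) hb hx using 1
        rw [Finset.insert_eq]; ac_rfl
      · have h1 := graft_of_notMem (notMem_leaves hb hi.1) u
        have h2 := graft_of_notMem (notMem_leaves hx hi.2) u
        unfold graft at h1 h2 ⊢; simp [Tree.bind, h1, h2]) h
  have h2 := hI.context (V := S ∪ V) (W := S ∪ U ∪ V) (g := fun u => mu a' u x)
    (Finset.disjoint_union_left.2 ⟨hSU, hUV.symm⟩) (by ac_rfl)
    (fun i hi => by
      rw [mem_union, not_or] at hi
      refine ⟨?_, fun u => ?_⟩
      · convert mu_mem_treeMonomials (by simpa using hi.1) hSV (by simpa using hi.2)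
          ha' (leaf_mem i) hx using 1
        rw [Finset.insert_eq]; ac_rfl
      · have h1 := graft_of_notMem (notMem_leaves ha' hi.1) u
        have h2 := graft_of_notMem (notMem_leaves hx hi.2) u
        unfold graft at h1 h2 ⊢; simp [Tree.bind, h1, h2]) h'
  have h3 := hI.context (V := S ∪ U) (W := S ∪ U ∪ V) (g := fun u => mu a' b' u)
    (Finset.disjoint_union_left.2 ⟨hSV, hUV⟩) (by ac_rfl)
    (fun i hi => by
      rw [mem_union, not_or] at hi
      refine ⟨?_, fun u => ?_⟩
      · convert mu_mem_treeMonomials hSU (by simpa using hi.1) (by simpa using hi.2)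
          ha' hb' (leaf_mem i) using 1
        rw [Finset.insert_eq]; ac_rfl
      · have h1 := graft_of_notMem (notMem_leaves ha' hi.1) u
        have h2 := graft_of_notMem (notMem_leaves hb' hi.2) u
        unfold graft at h1 h2 ⊢; simp [Tree.bind, h1, h2]) h''
  convert Submodule.add_mem _ (Submodule.add_mem _ h1 (Submodule.smul_mem _ c h2))
    (Submodule.smul_mem _ (c * d) h3) using 1
  module

lemma nu_swap_mem {S U : Finset ℕ} (hd : Disjoint S U) {a b : Tree} (ha : a ∈ treeMonomials S)
    (hb : b ∈ treeMonomials U) :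
    (mon (nu a b) - (-1 : K) • mon (nu b a)) ∈ symmetryIdeal K (S ∪ U) := by
  have h0 : mon (nu (leaf 1) (leaf 2)) + mon (nu (leaf 2) (leaf 1)) ∈ symmetryIdeal K (std 2) :=
    subset_operadIdeal rfl
  have := isOperadIdeal_symmetryIdeal.bind_mem h0 (f := fun j => if j = 1 then a else b)
    (U := fun j => if j = 1 then S else U) (by simp [std_two, ha, hb])
    (by simp [std_two, hd, hd.symm])
  simpa [std_two, Finset.biUnion_insert, Finsupp.mapDomain_add, mapDomain_mon, Tree.bind] using this

lemma mu_swap_left_mem {S U V : Finset ℕ} (hSU : Disjoint S U) (hSV : Disjoint S V)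
    (hUV : Disjoint U V) {a b c : Tree} (ha : a ∈ treeMonomials S) (hb : b ∈ treeMonomials U)
    (hc : c ∈ treeMonomials V) :
    (mon (mu a b c) - mon (mu b a c) : Tree →₀ K) ∈ symmetryIdeal K (S ∪ U ∪ V) := by
  have h0 : mon (mu (leaf 1) (leaf 2) (leaf 3)) - mon (mu (leaf 2) (leaf 1) (leaf 3))
      ∈ symmetryIdeal K (std 3) := subset_operadIdeal (.inl rfl)
  have := isOperadIdeal_symmetryIdeal.bind_mem h0
    (f := fun j => if j = 1 then a else if j = 2 then b else c)
    (U := fun j => if j = 1 then S else if j = 2 then U else V) (by simp [std_three, ha, hb, hc])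
    (by simp [std_three, hSU, hSU.symm, hSV, hSV.symm, hUV, hUV.symm])
  have e : (std 3).biUnion (fun j => if j = 1 then S else if j = 2 then U else V) = S ∪ U ∪ V := by
    simp [std_three, Finset.biUnion_insert, Finset.union_assoc]
  rw [e, sub_eq_add_neg, Finsupp.mapDomain_add, ← neg_one_smul K, Finsupp.mapDomain_smul,
    mapDomain_mon, mapDomain_mon, neg_one_smul, ← sub_eq_add_neg] at this
  simpa [Tree.bind] using this

lemma mu_swap_right_mem {S U V : Finset ℕ} (hSU : Disjoint S U) (hSV : Disjoint S V)
    (hUV : Disjoint U V) {a b c : Tree} (ha : a ∈ treeMonomials S) (hb : b ∈ treeMonomials U)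
    (hc : c ∈ treeMonomials V) :
    (mon (mu a b c) - mon (mu a c b) : Tree →₀ K) ∈ symmetryIdeal K (S ∪ U ∪ V) := by
  have h0 : mon (mu (leaf 1) (leaf 2) (leaf 3)) - mon (mu (leaf 1) (leaf 3) (leaf 2))
      ∈ symmetryIdeal K (std 3) := subset_operadIdeal (.inr rfl)
  have := isOperadIdeal_symmetryIdeal.bind_mem h0
    (f := fun j => if j = 1 then a else if j = 2 then b else c)
    (U := fun j => if j = 1 then S else if j = 2 then U else V) (by simp [std_three, ha, hb, hc])
    (by simp [std_three, hSU, hSU.symm, hSV, hSV.symm, hUV, hUV.symm])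
  have e : (std 3).biUnion (fun j => if j = 1 then S else if j = 2 then U else V) = S ∪ U ∪ V := by
    simp [std_three, Finset.biUnion_insert, Finset.union_assoc]
  rw [e, sub_eq_add_neg, Finsupp.mapDomain_add, ← neg_one_smul K, Finsupp.mapDomain_smul,
    mapDomain_mon, mapDomain_mon, neg_one_smul, ← sub_eq_add_neg] at this
  simpa [Tree.bind] using this

/-- First the subtrees are sorted, then the inputs of the root by at most three adjacent exchanges,
each a symmetry relation. Only exchanges at `ν` contribute a sign. -/
lemma sub_sortTree_mem {t : Tree} (h : t.leaves.Nodup) :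
    mon t - t.sortSign K • mon t.sortTree ∈ symmetryIdeal K t.labels := by
  have hI := isOperadIdeal_symmetryIdeal (K := K)
  have sm : ∀ {a : Tree}, a.leaves.Nodup → a.sortTree ∈ treeMonomials a.labels :=
    fun ha => (sortTree_mem_shuffleMonomials ⟨ha, rfl⟩).1
  induction t with
  | leaf i => simp [sortTree, sortSign]
  | nu a b ha hb =>
    rw [nodup_nu] at h
    have hd := disjoint_labels h.2.2
    have key := hI.context_nu hd (sm h.1) ⟨h.2.1, rfl⟩ (ha h.1) (hb h.2.1)
    rw [labels_nu, sortTree, sortSign]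
    split_ifs
    · rwa [mul_one]
    · have := nu_swap_mem (K := K) hd (sm h.1) (sm h.2.1)
      convert Submodule.add_mem _ key
        (Submodule.smul_mem _ (a.sortSign K * b.sortSign K) this) using 1
      module
  | mu a b c ha hb hc =>
    rw [nodup_mu] at h
    obtain ⟨⟨na, nb, nc⟩, h⟩ := h
    have hab := disjoint_labels h.1
    have hac := disjoint_labels h.2.1
    have hbc := disjoint_labels h.2.2
    have key := hI.context_mu hab hac hbc (sm na) ⟨nb, rfl⟩ (sm nb) ⟨nc, rfl⟩ (ha na) (hb nb)
      (hc nc)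
    have a1 := mu_swap_left_mem (K := K) hab hac hbc (sm na) (sm nb) (sm nc)
    have a2 := mu_swap_right_mem (K := K) hab hac hbc (sm na) (sm nb) (sm nc)
    have a3 := mu_swap_right_mem (K := K) hab.symm hbc hac (sm nb) (sm na) (sm nc)
    have a4 := mu_swap_left_mem (K := K) hac hab hbc.symm (sm na) (sm nc) (sm nb)
    have a5 := mu_swap_left_mem (K := K) hbc hab.symm hac.symm (sm nb) (sm nc) (sm na)
    have e3 : b.labels ∪ a.labels ∪ c.labels = a.labels ∪ b.labels ∪ c.labels := by ac_rfl
    have e4 : a.labels ∪ c.labels ∪ b.labels = a.labels ∪ b.labels ∪ c.labels := by ac_rfl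
    have e5 : b.labels ∪ c.labels ∪ a.labels = a.labels ∪ b.labels ∪ c.labels := by ac_rfl
    rw [e3] at a3
    rw [e4] at a4
    rw [e5] at a5
    rw [labels_mu, sortTree, sortSign]
    set z := a.sortSign K * b.sortSign K * c.sortSign K
    split_ifs
    · exact key
    · convert Submodule.add_mem _ key (Submodule.smul_mem _ z a2) using 1; module
    · convert Submodule.add_mem _ key
        (Submodule.smul_mem _ z (Submodule.add_mem _ a2 a4)) using 1; module
    · convert Submodule.add_mem _ key (Submodule.smul_mem _ z a1) using 1; module
    · convert Submodule.add_mem _ key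
        (Submodule.smul_mem _ z (Submodule.add_mem _ a1 a3)) using 1; module
    · convert Submodule.add_mem _ key (Submodule.smul_mem _ z
        (Submodule.add_mem _ (Submodule.add_mem _ a1 a3) a5)) using 1; module

variable (K) in
/-- The shuffle representative of an element of the free operad. -/
def sortLin : (Tree →₀ K) →ₗ[K] (Tree →₀ K) :=
  Finsupp.linearCombination K fun t => t.sortSign K • mon t.sortTree

lemma sortLin_mon (t : Tree) : sortLin K (mon t) = t.sortSign K • mon t.sortTree := by
  simp [sortLin, mon]

/-- So every multilinear element has a representative in the shuffle span; this supplies the shuffle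
forms of all permuted relations. -/
lemma sub_sortLin_mem {S : Finset ℕ} {p : Tree →₀ K} (hp : p ∈ multilin K S) :
    p - sortLin K p ∈ symmetryIdeal K S := by
  suffices multilin K S ≤ (symmetryIdeal K S).comap (LinearMap.id - sortLin K) from this hp
  rw [multilin_eq_span, Submodule.span_le]
  rintro _ ⟨t, ht, rfl⟩
  rw [SetLike.mem_coe, Submodule.mem_comap, LinearMap.sub_apply, LinearMap.id_apply, sortLin_mon,
    ← ht.2]
  exact sub_sortTree_mem ht.1

lemma sortLin_mem_supported {A B : Set Tree} (h : ∀ t ∈ A, t.sortTree ∈ B) {p : Tree →₀ K}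
    (hp : p ∈ Finsupp.supported K K A) : sortLin K p ∈ Finsupp.supported K K B := by
  rw [sortLin, Finsupp.linearCombination_apply]
  exact Submodule.sum_mem _ fun t ht => Submodule.smul_mem _ _ (Submodule.smul_mem _ _
    (Finsupp.single_mem_supported K 1 (h t ((Finsupp.mem_supported K p).1 hp ht))))

/-! ### Leading monomials of the relations -/

lemma isLeading_of_add {lt : Tree → Tree → Prop} {s : Tree} (hs : ¬ lt s s) {c : K} (hc : c ≠ 0)
    {h : Tree →₀ K} (hh : h ∈ Finsupp.supported K K {t | lt t s}) :
    IsLeading lt (c • mon s + h) s := by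
  have h0 : h s = 0 := by
    by_contra hne
    exact hs ((Finsupp.mem_supported K h).1 hh (Finsupp.mem_support_iff.2 hne))
  refine ⟨by simp [mon, h0, hc], fun t ht hts => ?_⟩
  refine (Finsupp.mem_supported K h).1 hh (Finsupp.mem_support_iff.2 fun e => ?_)
  rw [Finsupp.mem_support_iff] at ht
  exact ht (by simp [mon, e, Ne.symm hts])

/-- `s` is the leading monomial of one of the relations. -/
def IsLeadingRelation (K : Type*) [Field K] (s : Tree) : Prop :=
  ∃ n, ∃ g ∈ shuffleRelations K n, IsLeading degPathLex g s

/-- The sorted form of `σ r` is a shuffle relation. It suffices that every other term sorts to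
something below `s`: such terms may coincide or cancel among themselves, but cannot touch the
coefficient of `s`, which is `c` up to sign. -/
lemma isLeadingRelation_of {n : ℕ} {r : Tree →₀ K} (hr : r ∈ relations K n) {σ : Equiv.Perm ℕ}
    (hσ : (std n).image σ = std n) {t s : Tree} {c : K} (hc : c ≠ 0) {h : Tree →₀ K}
    (hrt : r = c • mon t + h) (hs : (t.relabel σ).sortTree = s)
    (hh : h ∈ Finsupp.supported K K {u | degPathLex (u.relabel σ).sortTree s}) :
    IsLeadingRelation K s := by
  have hm := isOperadIdeal_multilin.relabel_mem σ _ r (relations_mem_multilin n r hr)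
  rw [hσ] at hm
  refine ⟨n, sortLin K (relabel σ r), ⟨sortLin_mem_supported
    (fun _ => sortTree_mem_shuffleMonomials) hm, r, hr, σ, hσ, ?_⟩, ?_⟩
  · rw [← neg_mem_iff, neg_sub]
    exact sub_sortLin_mem hm
  · have e : sortLin K (relabel σ r)
        = (c * (t.relabel σ).sortSign K) • mon s + sortLin K (relabel σ h) := by
      rw [hrt, relabel, Finsupp.mapDomain_add, Finsupp.mapDomain_smul, mapDomain_mon, map_add,
        map_smul, sortLin_mon, hs, mul_smul]; rfl
    rw [e]
    refine isLeading_of_add (lt_irrefl (treeKey s)) (mul_ne_zero hc (sortSign_ne_zero K _)) ?_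
    refine sortLin_mem_supported (A := (Tree.relabel σ) '' {u | degPathLex (u.relabel σ).sortTree s})
      ?_ ?_
    · rintro _ ⟨u, hu, rfl⟩; exact hu
    · rw [relabel, Finsupp.mapDomain]
      exact Submodule.sum_mem _ fun u hu => Finsupp.single_mem_supported K _
        ⟨u, (Finsupp.mem_supported K h).1 hh hu, rfl⟩

lemma degPathLex_of_path {S : Finset ℕ} {s t : Tree} (hs : s.labels = S) (ht : t.labels = S)
    (hd : s.degree = t.degree) {j : ℕ} (hj : j ∈ S)
    (hp : (s.path j).count true < (t.path j).count true ∨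
      ((s.path j).count true = (t.path j).count true ∧
        ((t.path j).count false < (s.path j).count false ∨
          ((s.path j).count false = (t.path j).count false ∧ s.path j < t.path j))))
    (hk : ∀ k ∈ S, k < j → s.path k = t.path k) : degPathLex s t :=
  (degPathLex_iff hs ht).2 (.inr ⟨hd, .inl ⟨j, hj, wordKey_lt_iff.2 hp,
    fun k hkS hkj => by rw [hk k hkS hkj]⟩⟩)

/-- Of the three shuffle forms of a double bracket, this one has the longest paths to the leaves `1`
and `2`. -/
lemma isLeadingRelation_nu_nu :
    IsLeadingRelation K (nu (nu (leaf 1) (leaf 2)) (leaf 3)) := by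
  refine isLeadingRelation_of (n := 3) (r := jacobi K) rfl (σ := 1) (by simp)
    (t := nu (nu (leaf 1) (leaf 2)) (leaf 3)) one_ne_zero
    (h := mon (nu (nu (leaf 2) (leaf 3)) (leaf 1)) + mon (nu (nu (leaf 3) (leaf 1)) (leaf 2)))
    (by rw [jacobi, one_smul, add_assoc]) rfl ?_
  refine Submodule.add_mem _ ?_ ?_ <;> refine Finsupp.single_mem_supported K 1 ?_
  · exact degPathLex_of_path (S := std 3) (j := 1) (by decide) (by decide) rfl (by decide)
      (by decide) (by decide)
  · exact degPathLex_of_path (S := std 3) (j := 2) (by decide) (by decide) rfl (by decide)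
      (by decide) (by decide)

/-- In the applications the leaf `1` always decides. If it lies under `μ`, its word `νμ` beats `μ`
and `μν`; if it is the other argument of `ν`, its word `ν` beats `μν` because fewer letters `μ` is
larger. -/
lemma isLeadingRelation_leibniz {σ : Equiv.Perm ℕ} (hσ : (std 4).image σ = std 4) {s s₁ s₂ s₃ : Tree}
    (h : ((nu (mu (leaf 1) (leaf 2) (leaf 3)) (leaf 4)).relabel σ).sortTree = s)
    (h₁ : ((mu (leaf 1) (leaf 2) (nu (leaf 3) (leaf 4))).relabel σ).sortTree = s₁)
    (h₂ : ((mu (leaf 1) (nu (leaf 2) (leaf 4)) (leaf 3)).relabel σ).sortTree = s₂)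
    (h₃ : ((mu (nu (leaf 1) (leaf 4)) (leaf 2) (leaf 3)).relabel σ).sortTree = s₃)
    (l₁ : degPathLex s₁ s) (l₂ : degPathLex s₂ s) (l₃ : degPathLex s₃ s) :
    IsLeadingRelation K s := by
  refine isLeadingRelation_of (n := 4) (r := leibniz K) rfl hσ one_ne_zero
    (by rw [leibniz, one_smul, sub_eq_add_neg]) h ?_
  refine Submodule.neg_mem _ (Submodule.add_mem _ (Submodule.add_mem _ ?_ ?_) ?_) <;>
    refine Finsupp.single_mem_supported K 1 ?_
  · rwa [Set.mem_ofPred_eq, h₁]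
  · rwa [Set.mem_ofPred_eq, h₂]
  · rwa [Set.mem_ofPred_eq, h₃]

/-- The two leading terms differ by exchanging the leaves `σ 3` and `σ 4` between the inner and the
outer vertex. In the applications `σ 3 < σ 4`, so the comparison is decided at `σ 3`, where the word
`μ` beats `μμ`. -/
lemma isLeadingRelation_assoc {σ : Equiv.Perm ℕ} (hσ : (std 5).image σ = std 5) {s s' : Tree}
    (h : ((mu (mu (leaf 1) (leaf 2) (leaf 4)) (leaf 3) (leaf 5)).relabel σ).sortTree = s)
    (h' : ((mu (mu (leaf 1) (leaf 2) (leaf 3)) (leaf 4) (leaf 5)).relabel σ).sortTree = s')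
    (l : degPathLex s' s) : IsLeadingRelation K s := by
  have hm : ∀ t : Tree, t ∈ treeMonomials (std 5) →
      (t.relabel σ).sortTree ∈ treeMonomials (std 5) := fun t ht => by
    have := (sortTree_mem_shuffleMonomials (relabel_mem_treeMonomials σ ht)).1
    rwa [hσ] at this
  have deg : ∀ t : Tree, (t.relabel σ).sortTree.degree = t.degree := fun t => by
    rw [degree_sortTree, Tree.relabel, degree_bind]; simp [degree]
  refine isLeadingRelation_of (n := 5) (r := deformedAssoc K) rfl hσ one_ne_zero
    (t := mu (mu (leaf 1) (leaf 2) (leaf 4)) (leaf 3) (leaf 5))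
    (h := -mon (mu (mu (leaf 1) (leaf 2) (leaf 3)) (leaf 4) (leaf 5)) - assocTail K)
    (by rw [deformedAssoc, assocTail, one_smul]; abel) h ?_
  refine Submodule.sub_mem _ (Submodule.neg_mem _ (Finsupp.single_mem_supported K 1 ?_))
    (Finsupp.supported_mono ?_ assocTail_mem)
  · rwa [Set.mem_ofPred_eq, h']
  -- Relabelling and sorting keep the number of vertices, so the tail still has at least three of
  -- them and is smaller by degree alone.
  · rintro t ⟨ht, hd⟩
    rw [Set.mem_ofPred_eq, degPathLex_iff (hm t ht).2 (S := std 5)]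
    · left
      rw [← h, deg, deg]
      exact lt_of_lt_of_le (by decide) hd
    · rw [← h]; exact (hm _ ⟨by decide, by decide⟩).2

lemma isLeadingRelation_nu_mu_4 :
    IsLeadingRelation K (nu (mu (leaf 1) (leaf 2) (leaf 3)) (leaf 4)) := by
  refine isLeadingRelation_leibniz (σ := 1) (by simp) rfl rfl rfl rfl ?_ ?_ ?_ <;>
    exact degPathLex_of_path (S := std 4) (j := 1) (by decide) (by decide) rfl (by decide)
      (by decide) (by decide)

lemma isLeadingRelation_nu_mu_3 :
    IsLeadingRelation K (nu (mu (leaf 1) (leaf 2) (leaf 4)) (leaf 3)) := by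
  refine isLeadingRelation_leibniz (σ := Equiv.swap 3 4) (by decide) rfl rfl rfl rfl ?_ ?_ ?_ <;>
    exact degPathLex_of_path (S := std 4) (j := 1) (by decide) (by decide) rfl (by decide)
      (by decide) (by decide)

lemma isLeadingRelation_nu_mu_2 :
    IsLeadingRelation K (nu (mu (leaf 1) (leaf 3) (leaf 4)) (leaf 2)) := by
  refine isLeadingRelation_leibniz (σ := Equiv.swap 2 3 * Equiv.swap 3 4) (by decide)
    rfl rfl rfl rfl ?_ ?_ ?_ <;>
    exact degPathLex_of_path (S := std 4) (j := 1) (by decide) (by decide) rfl (by decide)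
      (by decide) (by decide)

lemma isLeadingRelation_nu_mu_1 :
    IsLeadingRelation K (nu (leaf 1) (mu (leaf 2) (leaf 3) (leaf 4))) := by
  refine isLeadingRelation_leibniz (σ := Equiv.swap 1 2 * Equiv.swap 2 3 * Equiv.swap 3 4) (by decide)
    rfl rfl rfl rfl ?_ ?_ ?_ <;>
    exact degPathLex_of_path (S := std 4) (j := 1) (by decide) (by decide) rfl (by decide)
      (by decide) (by decide)

lemma isLeadingRelation_mu_mu_124 :
    IsLeadingRelation K (mu (mu (leaf 1) (leaf 2) (leaf 4)) (leaf 3) (leaf 5)) :=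
  isLeadingRelation_assoc (σ := 1)
    (by decide) rfl rfl (degPathLex_of_path (S := std 5) (j := 3) (by decide) (by decide) rfl
      (by decide) (by decide) (by decide))

lemma isLeadingRelation_mu_mu_125 :
    IsLeadingRelation K (mu (mu (leaf 1) (leaf 2) (leaf 5)) (leaf 3) (leaf 4)) :=
  isLeadingRelation_assoc (σ := Equiv.swap 4 5)
    (by decide) rfl rfl (degPathLex_of_path (S := std 5) (j := 3) (by decide) (by decide) rfl
      (by decide) (by decide) (by decide))

lemma isLeadingRelation_mu_mu_134 :
    IsLeadingRelation K (mu (mu (leaf 1) (leaf 3) (leaf 4)) (leaf 2) (leaf 5)) :=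
  isLeadingRelation_assoc (σ := Equiv.swap 2 3)
    (by decide) rfl rfl (degPathLex_of_path (S := std 5) (j := 2) (by decide) (by decide) rfl
      (by decide) (by decide) (by decide))

lemma isLeadingRelation_mu_mu_135 :
    IsLeadingRelation K (mu (mu (leaf 1) (leaf 3) (leaf 5)) (leaf 2) (leaf 4)) :=
  isLeadingRelation_assoc (σ := Equiv.swap 2 3 * Equiv.swap 4 5)
    (by decide) rfl rfl (degPathLex_of_path (S := std 5) (j := 2) (by decide) (by decide) rfl
      (by decide) (by decide) (by decide))

lemma isLeadingRelation_mu_mu_145 :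
    IsLeadingRelation K (mu (mu (leaf 1) (leaf 4) (leaf 5)) (leaf 2) (leaf 3)) :=
  isLeadingRelation_assoc (σ := Equiv.swap 2 3 * Equiv.swap 2 4 * Equiv.swap 4 5)
    (by decide) rfl rfl (degPathLex_of_path (S := std 5) (j := 2) (by decide) (by decide) rfl
      (by decide) (by decide) (by decide))

lemma isLeadingRelation_mu_mu_234 :
    IsLeadingRelation K (mu (leaf 1) (mu (leaf 2) (leaf 3) (leaf 4)) (leaf 5)) :=
  isLeadingRelation_assoc (σ := Equiv.swap 1 2 * Equiv.swap 2 3)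
    (by decide) rfl rfl (degPathLex_of_path (S := std 5) (j := 1) (by decide) (by decide) rfl
      (by decide) (by decide) (by decide))

lemma isLeadingRelation_mu_mu_235 :
    IsLeadingRelation K (mu (leaf 1) (mu (leaf 2) (leaf 3) (leaf 5)) (leaf 4)) :=
  isLeadingRelation_assoc (σ := Equiv.swap 1 2 * Equiv.swap 2 3 * Equiv.swap 4 5)
    (by decide) rfl rfl (degPathLex_of_path (S := std 5) (j := 1) (by decide) (by decide) rfl
      (by decide) (by decide) (by decide))

lemma isLeadingRelation_mu_mu_245 :
    IsLeadingRelation K (mu (leaf 1) (mu (leaf 2) (leaf 4) (leaf 5)) (leaf 3)) :=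
  isLeadingRelation_assoc (σ := Equiv.swap 1 2 * Equiv.swap 2 3 * Equiv.swap 2 4 * Equiv.swap 4 5)
    (by decide) rfl rfl (degPathLex_of_path (S := std 5) (j := 1) (by decide) (by decide) rfl
      (by decide) (by decide) (by decide))

lemma isLeadingRelation_mu_mu_345 :
    IsLeadingRelation K (mu (leaf 1) (leaf 2) (mu (leaf 3) (leaf 4) (leaf 5))) :=
  isLeadingRelation_assoc (σ := Equiv.swap 1 3 * Equiv.swap 2 4 * Equiv.swap 4 5)
    (by decide) rfl rfl (degPathLex_of_path (S := std 5) (j := 1) (by decide) (by decide) rfl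
      (by decide) (by decide) (by decide))

end Representatives

/-! ### Reduction to normal forms -/

namespace Tree

lemma isSubtree_refl (t : Tree) : IsSubtree t t := by
  cases t <;> simp [IsSubtree]

/-- Collapsing a subtree to a leaf carrying its smallest label changes no minimum, hence preserves
the shuffle condition at the vertices below it. -/
lemma minLeaf_graft_minLeaf (s u : Tree) : (s.graft u.minLeaf u).minLeaf = s.minLeaf := by
  have h : ∀ j, (if j = u.minLeaf then u else leaf j).minLeaf = j := by
    intro j
    split_ifs with e
    · exact e.symm
    · rfl
  rw [graft, minLeaf_bind, h]
  intro i _ j _ hij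
  rwa [h, h]

/-- A subtree of a shuffle tree can be replaced by a leaf with its smallest label. -/
lemma exists_graft_of_isSubtree {u t : Tree} (h : IsSubtree u t) (ht : t.IsShuffle)
    (hn : t.leaves.Nodup) : (u.IsShuffle ∧ u.leaves.Nodup ∧ ∀ j ∈ u.leaves, j ∈ t.leaves) ∧
      ∃ s : Tree, s.IsShuffle ∧ s.leaves.Nodup ∧ u.minLeaf ∈ s.leaves ∧
        (∀ j ∈ s.leaves, j ≠ u.minLeaf → j ∉ u.leaves) ∧ s.graft u.minLeaf u = t ∧
        (∀ j ∈ s.leaves, j ∈ t.leaves) := by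
  have self : ∀ t : Tree, t.IsShuffle → t.leaves.Nodup →
      (t.IsShuffle ∧ t.leaves.Nodup ∧ ∀ j ∈ t.leaves, j ∈ t.leaves) ∧
      ∃ s : Tree, s.IsShuffle ∧ s.leaves.Nodup ∧ t.minLeaf ∈ s.leaves ∧
        (∀ j ∈ s.leaves, j ≠ t.minLeaf → j ∉ t.leaves) ∧ s.graft t.minLeaf t = t ∧
        (∀ j ∈ s.leaves, j ∈ t.leaves) := fun t ht hn =>
    ⟨⟨ht, hn, fun _ h => h⟩, leaf t.minLeaf, trivial, by simp [leaves], by simp [leaves],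
      by simp [leaves], by simp [graft, Tree.bind], by simp [leaves, minLeaf_mem]⟩
  induction t with
  | leaf i => obtain rfl := h; exact self _ ht hn
  | nu a b ha hb =>
    rcases h with rfl | h | h
    · exact self _ ht hn
    · rw [nodup_nu] at hn
      obtain ⟨⟨h1, h2, h3⟩, s, s1, s2, s3, s4, s5, s6⟩ := ha h ht.2.1 hn.1
      have hi := h3 _ (minLeaf_mem u)
      have hm : s.minLeaf = a.minLeaf := by rw [← s5, minLeaf_graft_minLeaf]
      refine ⟨⟨h1, h2, fun j hj => by simp [leaves, h3 j hj]⟩, nu s b,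
        ⟨hm ▸ ht.1, s1, ht.2.2⟩, nodup_nu.2 ⟨s2, hn.2.1, fun j hj => hn.2.2 (s6 j hj)⟩,
        by simp [leaves, s3], ?_, ?_, ?_⟩
      · intro j hj hji hju
        rcases List.mem_append.1 hj with hj | hj
        · exact s4 j hj hji hju
        · exact hn.2.2 (h3 j hju) hj
      · have := graft_of_notMem (hn.2.2 hi) u
        unfold graft at s5 this ⊢
        rw [Tree.bind, s5, this]
      · intro j hj
        rcases List.mem_append.1 hj with hj | hj
        · simp [leaves, s6 j hj]
        · simp [leaves, hj]
    · rw [nodup_nu] at hn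
      obtain ⟨⟨h1, h2, h3⟩, s, s1, s2, s3, s4, s5, s6⟩ := hb h ht.2.2 hn.2.1
      have hi := h3 _ (minLeaf_mem u)
      have hm : s.minLeaf = b.minLeaf := by rw [← s5, minLeaf_graft_minLeaf]
      refine ⟨⟨h1, h2, fun j hj => by simp [leaves, h3 j hj]⟩, nu a s,
        ⟨hm ▸ ht.1, ht.2.1, s1⟩, nodup_nu.2 ⟨hn.1, s2, fun j hj hj' => hn.2.2 hj (s6 j hj')⟩,
        by simp [leaves, s3], ?_, ?_, ?_⟩
      · intro j hj hji hju
        rcases List.mem_append.1 hj with hj | hj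
        · exact hn.2.2 hj (h3 j hju)
        · exact s4 j hj hji hju
      · have := graft_of_notMem (fun h => hn.2.2 h hi) u
        unfold graft at s5 this ⊢
        rw [Tree.bind, s5, this]
      · intro j hj
        rcases List.mem_append.1 hj with hj | hj
        · simp [leaves, hj]
        · simp [leaves, s6 j hj]
  | mu a b c ha hb hc =>
    rcases h with rfl | h | h | h
    · exact self _ ht hn
    · rw [nodup_mu] at hn
      obtain ⟨hn, hab, hac, hbc⟩ := hn
      obtain ⟨⟨h1, h2, h3⟩, s, s1, s2, s3, s4, s5, s6⟩ := ha h ht.2.2.1 hn.1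
      have hi := h3 _ (minLeaf_mem u)
      have hm : s.minLeaf = a.minLeaf := by rw [← s5, minLeaf_graft_minLeaf]
      refine ⟨⟨h1, h2, fun j hj => by simp [leaves, h3 j hj]⟩, mu s b c,
        ⟨hm ▸ ht.1, ht.2.1, s1, ht.2.2.2⟩, nodup_mu.2 ⟨⟨s2, hn.2⟩, fun j hj => hab (s6 j hj),
          fun j hj => hac (s6 j hj), hbc⟩, by simp [leaves, s3], ?_, ?_, ?_⟩
      · intro j hj hji hju
        simp only [leaves, List.mem_append] at hj
        rcases hj with (hj | hj) | hj
        · exact s4 j hj hji hju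
        · exact hab (h3 j hju) hj
        · exact hac (h3 j hju) hj
      · have e1 := graft_of_notMem (hab hi) u
        have e2 := graft_of_notMem (hac hi) u
        unfold graft at s5 e1 e2 ⊢
        rw [Tree.bind, s5, e1, e2]
      · intro j hj
        simp only [leaves, List.mem_append] at hj ⊢
        exact hj.imp_left (Or.imp_left (s6 j))
    · rw [nodup_mu] at hn
      obtain ⟨hn, hab, hac, hbc⟩ := hn
      obtain ⟨⟨h1, h2, h3⟩, s, s1, s2, s3, s4, s5, s6⟩ := hb h ht.2.2.2.1 hn.2.1
      have hi := h3 _ (minLeaf_mem u)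
      have hm : s.minLeaf = b.minLeaf := by rw [← s5, minLeaf_graft_minLeaf]
      refine ⟨⟨h1, h2, fun j hj => by simp [leaves, h3 j hj]⟩, mu a s c,
        ⟨hm ▸ ht.1, hm ▸ ht.2.1, ht.2.2.1, s1, ht.2.2.2.2⟩, nodup_mu.2 ⟨⟨hn.1, s2, hn.2.2⟩,
          fun j hj hj' => hab hj (s6 j hj'), hac, fun j hj => hbc (s6 j hj)⟩,
        by simp [leaves, s3], ?_, ?_, ?_⟩
      · intro j hj hji hju
        simp only [leaves, List.mem_append] at hj
        rcases hj with (hj | hj) | hj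
        · exact hab hj (h3 j hju)
        · exact s4 j hj hji hju
        · exact hbc (h3 j hju) hj
      · have e1 := graft_of_notMem (fun h => hab h hi) u
        have e2 := graft_of_notMem (hbc hi) u
        unfold graft at s5 e1 e2 ⊢
        rw [Tree.bind, s5, e1, e2]
      · intro j hj
        simp only [leaves, List.mem_append] at hj ⊢
        exact hj.imp_left (Or.imp_right (s6 j))
    · rw [nodup_mu] at hn
      obtain ⟨hn, hab, hac, hbc⟩ := hn
      obtain ⟨⟨h1, h2, h3⟩, s, s1, s2, s3, s4, s5, s6⟩ := hc h ht.2.2.2.2 hn.2.2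
      have hi := h3 _ (minLeaf_mem u)
      have hm : s.minLeaf = c.minLeaf := by rw [← s5, minLeaf_graft_minLeaf]
      refine ⟨⟨h1, h2, fun j hj => by simp [leaves, h3 j hj]⟩, mu a b s,
        ⟨ht.1, hm ▸ ht.2.1, ht.2.2.1, ht.2.2.2.1, s1⟩, nodup_mu.2 ⟨⟨hn.1, hn.2.1, s2⟩, hab,
          fun j hj hj' => hac hj (s6 j hj'), fun j hj hj' => hbc hj (s6 j hj')⟩,
        by simp [leaves, s3], ?_, ?_, ?_⟩
      · intro j hj hji hju
        simp only [leaves, List.mem_append] at hj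
        rcases hj with (hj | hj) | hj
        · exact hac hj (h3 j hju)
        · exact hbc hj (h3 j hju)
        · exact s4 j hj hji hju
      · have e1 := graft_of_notMem (fun h => hac h hi) u
        have e2 := graft_of_notMem (fun h => hbc h hi) u
        unfold graft at s5 e1 e2 ⊢
        rw [Tree.bind, s5, e1, e2]
      · intro j hj
        simp only [leaves, List.mem_append] at hj ⊢
        exact hj.imp_right (s6 j)

lemma isShuffle_of_bind {f : ℕ → Tree} {t : Tree} (h : (t.bind f).IsShuffle) :
    ∀ j ∈ t.leaves, (f j).IsShuffle := by
  induction t with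
  | leaf i => intro j hj; obtain rfl : j = i := by simpa [leaves] using hj
              exact h
  | nu a b ha hb =>
    intro j hj
    rcases List.mem_append.1 hj with hj | hj
    exacts [ha h.2.1 j hj, hb h.2.2 j hj]
  | mu a b c ha hb hc =>
    intro j hj
    simp only [leaves, List.mem_append] at hj
    rcases hj with (hj | hj) | hj
    exacts [ha h.2.2.1 j hj, hb h.2.2.2.1 j hj, hc h.2.2.2.2 j hj]

end Tree

/-- Every vertex has at least two inputs with disjoint nonempty label sets, so the subtrees at the
root have strictly smaller label sets. Finiteness is what makes rewriting terminate. -/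
lemma finite_treeMonomials (S : Finset ℕ) : (treeMonomials S).Finite := by
  induction S using Finset.strongInduction with
  | H S ih =>
  have sub : ∀ A ∈ S.ssubsets, (treeMonomials A).Finite := fun A hA =>
    ih A (mem_ssubsets.1 hA)
  have hU : (⋃ A ∈ S.ssubsets, treeMonomials A).Finite := S.ssubsets.finite_toSet.biUnion sub
  set T := ⋃ A ∈ S.ssubsets, treeMonomials A
  refine ((S.finite_toSet.image leaf).union ((hU.image2 nu hU).union
    ((hU.prod (hU.prod hU)).image fun x => mu x.1 x.2.1 x.2.2))).subset fun t ht => ?_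
  have mem : ∀ a : Tree, a.leaves.Nodup → (∀ j ∈ a.leaves, j ∈ S) → (∃ j ∈ S, j ∉ a.leaves) →
      a ∈ T := by
    rintro a ha h ⟨j, hj, hja⟩
    refine Set.mem_biUnion (x := a.labels) ?_ ⟨ha, rfl⟩
    refine mem_ssubsets.2 (Finset.ssubset_iff_of_subset ?_ |>.2 ⟨j, hj, by simpa using hja⟩)
    exact fun i hi => h i (mem_labels.1 hi)
  have hm : ∀ j, j ∈ S ↔ j ∈ t.leaves := fun j => by rw [← ht.2, mem_labels]
  cases t with
  | leaf i => exact .inl ⟨i, (hm i).2 (by simp [leaves]), rfl⟩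
  | nu a b =>
    obtain ⟨h1, h2, h3⟩ := nodup_nu.1 ht.1
    refine .inr (.inl ⟨a, mem a h1 ?_ ⟨b.minLeaf, ?_, ?_⟩, b, mem b h2 ?_ ⟨a.minLeaf, ?_, ?_⟩, rfl⟩)
    · intro j hj; simp [hm, leaves, hj]
    · simp [hm, leaves, minLeaf_mem]
    · exact fun h => h3 h (minLeaf_mem b)
    · intro j hj; simp [hm, leaves, hj]
    · simp [hm, leaves, minLeaf_mem]
    · exact fun h => h3 (minLeaf_mem a) h
  | mu a b c =>
    obtain ⟨⟨h1, h2, h3⟩, h4, h5, h6⟩ := nodup_mu.1 ht.1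
    refine .inr (.inr ⟨(a, b, c), ⟨mem a h1 ?_ ⟨b.minLeaf, ?_, ?_⟩, mem b h2 ?_ ⟨a.minLeaf, ?_, ?_⟩,
      mem c h3 ?_ ⟨a.minLeaf, ?_, ?_⟩⟩, rfl⟩)
    · intro j hj; simp [hm, leaves, hj]
    · simp [hm, leaves, minLeaf_mem]
    · exact fun h => h4 h (minLeaf_mem b)
    · intro j hj; simp [hm, leaves, hj]
    · simp [hm, leaves, minLeaf_mem]
    · exact fun h => h4 (minLeaf_mem a) h
    · intro j hj; simp [hm, leaves, hj]
    · simp [hm, leaves, minLeaf_mem]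
    · exact fun h => h5 (minLeaf_mem a) h

/-- The shuffle tree monomials that are smaller than `t`. -/
def lowerMonomials (S : Finset ℕ) (t : Tree) : Set Tree :=
  {u | u ∈ shuffleMonomials S ∧ degPathLex u t}

/-! ### Rewriting modulo the ideal, and what independence of normal forms implies -/

section Reduction

variable {K : Type*} [Field K]

lemma shuffleRelations_mem_presIdeal {n : ℕ} {g : Tree →₀ K} (hg : g ∈ shuffleRelations K n) :
    g ∈ presIdeal K (std n) := by
  obtain ⟨-, r, hr, σ, hσ, h⟩ := hg
  have h1 := isOperadIdeal_presIdeal.relabel_mem σ (std n) r (subset_operadIdeal (.inr hr))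
  rw [hσ] at h1
  simpa using Submodule.add_mem _ (symmetryIdeal_le_presIdeal _ h) h1

lemma mapDomain_mem_supported {A B : Set Tree} {g : Tree → Tree} (hg : ∀ t ∈ A, g t ∈ B)
    {p : Tree →₀ K} (hp : p ∈ Finsupp.supported K K A) :
    p.mapDomain g ∈ Finsupp.supported K K B := by
  rw [Finsupp.mapDomain]
  exact Submodule.sum_mem _ fun t ht => Finsupp.single_mem_supported K _
    (hg t ((Finsupp.mem_supported K p).1 hp ht))

lemma mem_sup_supported_mono {I : Submodule K (Tree →₀ K)} {A B : Set Tree} (h : A ⊆ B)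
    {p : Tree →₀ K} (hp : p ∈ I ⊔ Finsupp.supported K K A) : p ∈ I ⊔ Finsupp.supported K K B :=
  sup_le_sup_left (Finsupp.supported_mono h) I hp

/-- One rewriting step at the root: substituting into `g` gives an element of the ideal, and
order-preserving substitution is monotone, so the leading term of `g` becomes the leading term of
the result. -/
lemma mon_bind_mem {n : ℕ} {g : Tree →₀ K} (hg : g ∈ shuffleRelations K n) {s : Tree}
    (hs : IsLeading degPathLex g s) {f : ℕ → Tree}
    (hf : ∀ i ∈ s.labels, ∀ j ∈ s.labels, i < j → (f i).minLeaf < (f j).minLeaf) {S : Finset ℕ}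
    (ht : s.bind f ∈ shuffleMonomials S) :
    mon (s.bind f) ∈ presIdeal K S ⊔ Finsupp.supported K K (lowerMonomials S (s.bind f)) := by
  have hsup : ∀ u ∈ g.support, u ∈ shuffleMonomials (std n) :=
    fun u hu => (Finsupp.mem_supported K g).1 hg.1 hu
  have hsn := hsup s hs.1
  have hm : ∀ j, j ∈ s.leaves ↔ j ∈ std n := fun j => by rw [← hsn.1.2, mem_labels]
  have hnd := ht.1.1
  rw [leaves_bind, List.nodup_flatMap] at hnd
  have hfm : ∀ j ∈ std n, f j ∈ shuffleMonomials (f j).labels := fun j hj =>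
    ⟨⟨hnd.1 j ((hm j).2 hj), rfl⟩, isShuffle_of_bind ht.2 j ((hm j).2 hj)⟩
  have hfd : ∀ i ∈ std n, ∀ j ∈ std n, i ≠ j → Disjoint (f i).labels (f j).labels := by
    intro i hi j hj hij
    refine disjoint_labels ?_
    have : Std.Symm (Function.onFun List.Disjoint fun j => (f j).leaves) :=
      ⟨fun _ _ h => List.Disjoint.symm h⟩
    exact hnd.2.forall ((hm i).2 hi) ((hm j).2 hj) hij
  have hS : (std n).biUnion (fun j => (f j).labels) = S := by
    rw [← ht.1.2, labels_bind, hsn.1.2]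
  rw [hsn.1.2] at hf
  have h1 := isOperadIdeal_presIdeal.bind_mem (shuffleRelations_mem_presIdeal hg)
    (fun j hj => (hfm j hj).1) hfd
  rw [hS] at h1
  have h2 : (g.erase s).mapDomain (Tree.bind f)
      ∈ Finsupp.supported K K (lowerMonomials S (s.bind f)) := by
    refine mapDomain_mem_supported (A := {u | u ∈ shuffleMonomials (std n) ∧ degPathLex u s})
      ?_ ?_
    · rintro u ⟨hu, hus⟩
      refine ⟨?_, degPathLex_bind hu hsn hfm hfd hf hus⟩
      rw [← hS]
      exact bind_mem_shuffleMonomials hu hfm hfd hf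
    · rw [Finsupp.mem_supported]
      intro u hu
      classical
      rw [Finsupp.support_erase, SetLike.mem_coe, Finset.mem_erase] at hu
      exact ⟨hsup u hu.2, hs.2 u hu.2 hu.1⟩
  have hc : g s ≠ 0 := Finsupp.mem_support_iff.1 hs.1
  have e : g.mapDomain (Tree.bind f)
      = g s • mon (s.bind f) + (g.erase s).mapDomain (Tree.bind f) := by
    conv_lhs => rw [← Finsupp.single_add_erase s g]
    rw [Finsupp.mapDomain_add, Finsupp.mapDomain_single, mon, Finsupp.smul_single, smul_eq_mul,
      mul_one]
  refine (Submodule.smul_mem_iff _ hc).1 ?_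
  rw [← sub_eq_iff_eq_add] at e
  rw [← e]
  exact Submodule.sub_mem _ (Submodule.mem_sup_left h1) (Submodule.mem_sup_right h2)

/-- A rewriting step inside a tree: the rewritten subtrees have the labels, hence the smallest
label, of `u`, so grafting them back is a shuffle composition and preserves the order. -/
lemma mon_mem_of_isSubtree {u t : Tree} (h : IsSubtree u t) {S : Finset ℕ}
    (ht : t ∈ shuffleMonomials S)
    (hu : mon u ∈ presIdeal K u.labels ⊔ Finsupp.supported K K (lowerMonomials u.labels u)) :
    mon t ∈ presIdeal K S ⊔ Finsupp.supported K K (lowerMonomials S t) := by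
  obtain ⟨⟨u1, u2, -⟩, s, s1, s2, s3, s4, rfl, -⟩ := exists_graft_of_isSubtree h ht.2 ht.1.1
  have hi : u.minLeaf ∈ s.labels := mem_labels.2 s3
  have hd : Disjoint (s.labels.erase u.minLeaf) u.labels := by
    rw [Finset.disjoint_left]
    intro j hj hj'
    rw [mem_erase, mem_labels] at hj
    exact s4 j hj.2 hj.1 (mem_labels.1 hj')
  have hs : s ∈ treeMonomials s.labels := ⟨s2, rfl⟩
  have hum : u ∈ treeMonomials u.labels := ⟨u2, rfl⟩
  obtain rfl : s.labels.erase u.minLeaf ∪ u.labels = S := by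
    rw [← ht.1.2]; exact (graft_mem_treeMonomials hi hd hs hum).2.symm
  obtain ⟨x, hx, y, hy, hxy⟩ := Submodule.mem_sup.1 hu
  rw [← mapDomain_mon, ← hxy, Finsupp.mapDomain_add]
  refine Submodule.add_mem_sup (isOperadIdeal_presIdeal.graft_mem hi hd hs hx)
    (mapDomain_mem_supported ?_ hy)
  rintro v ⟨hv, hvu⟩
  have hmin : v.minLeaf = u.minLeaf := minLeaf_eq_of_labels_eq hv.1.2
  refine ⟨graft_mem_shuffleMonomials hi hd ⟨hs, s1⟩ hv fun j _ => by rw [hmin], ?_⟩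
  exact degPathLex_graft_right hi hd hs hv.1 hum hvu

variable (K) in
/-- The shuffle tree monomials that are not divisible by a leading monomial of a relation. -/
def normalForms (S : Finset ℕ) : Set Tree :=
  {t | t ∈ shuffleMonomials S ∧ ∀ s, IsLeadingRelation K s → ¬ s.Divides t}

/-- Rewriting terminates since there are finitely many shuffle monomials on `S`. The bound by `t` on
the normal forms is kept because the Gröbner property needs it. -/
lemma mon_mem_normalForms {S : Finset ℕ} {t : Tree} (ht : t ∈ shuffleMonomials S) :
    mon t ∈ presIdeal K S ⊔
      Finsupp.supported K K {u | u ∈ normalForms K S ∧ (u = t ∨ degPathLex u t)} := by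
  have : IsStrictOrder Tree degPathLex :=
    { irrefl := fun _ => lt_irrefl (treeKey _), trans := fun _ _ _ => lt_trans }
  have hfin : (shuffleMonomials S).Finite := (finite_treeMonomials S).subset fun _ h => h.1
  refine (hfin.wellFoundedOn (r := degPathLex)).induction ht
    (P := fun t => mon t ∈ presIdeal K S ⊔
      Finsupp.supported K K {u | u ∈ normalForms K S ∧ (u = t ∨ degPathLex u t)}) ?_
  intro t ht ih
  by_cases hnf : ∀ s, IsLeadingRelation K s → ¬ s.Divides t
  · exact Submodule.mem_sup_right (Finsupp.single_mem_supported K 1 ⟨⟨ht, hnf⟩, .inl rfl⟩)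
  · push Not at hnf
    obtain ⟨s, ⟨n, g, hg, hgs⟩, f, hf, hsub⟩ := hnf
    have hu := (exists_graft_of_isSubtree hsub ht.2 ht.1.1).1
    have h1 := mon_mem_of_isSubtree hsub ht (mon_bind_mem hg hgs hf ⟨⟨hu.2.1, rfl⟩, hu.1⟩)
    refine (sup_le le_sup_left ?_ : presIdeal K S ⊔
      Finsupp.supported K K (lowerMonomials S t) ≤ _) h1
    rw [Finsupp.supported_eq_span_single, Submodule.span_le]
    rintro _ ⟨u, ⟨hu, hut⟩, rfl⟩
    refine mem_sup_supported_mono ?_ (ih u hu hut)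
    rintro v ⟨hv, hvu⟩
    refine ⟨hv, .inr ?_⟩
    rcases hvu with rfl | hvu
    · exact hut
    · exact lt_trans hvu hut

lemma mem_sup_normalForms {S : Finset ℕ} {p : Tree →₀ K} (hp : p ∈ multilin K S) :
    p ∈ presIdeal K S ⊔ Finsupp.supported K K (normalForms K S) := by
  have h1 := symmetryIdeal_le_presIdeal S (sub_sortLin_mem hp)
  have h2 : sortLin K p ∈ shuffleSpan K S :=
    sortLin_mem_supported (fun _ => sortTree_mem_shuffleMonomials) hp
  have h3 : shuffleSpan K S ≤ presIdeal K S ⊔ Finsupp.supported K K (normalForms K S) := by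
    rw [shuffleSpan, Finsupp.supported_eq_span_single, Submodule.span_le]
    rintro _ ⟨u, hu, rfl⟩
    exact mem_sup_supported_mono (fun v hv => hv.1) (mon_mem_normalForms hu)
  have := Submodule.add_mem _ (Submodule.mem_sup_left h1) (h3 h2)
  rwa [sub_add_cancel] at this

/-- Linear independence of the values of the normal forms gives the presentation. -/
lemma mem_presIdeal_iff [CharZero K] {S : Finset ℕ}
    (hli : LinearIndepOn K (evalTree K) (normalForms K S)) {p : Tree →₀ K}
    (hp : p ∈ multilin K S) : evalAs K p = 0 ↔ p ∈ presIdeal K S := by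
  refine ⟨fun h => ?_, evalAs_eq_zero_of_mem_presIdeal⟩
  -- The part `y` in normal form also evaluates to zero, so independence forces it to vanish.
  obtain ⟨x, hx, y, hy, rfl⟩ := Submodule.mem_sup.1 (mem_sup_normalForms hp)
  rw [map_add, evalAs_eq_zero_of_mem_presIdeal hx, zero_add] at h
  rw [linearIndepOn_iff.1 hli y hy h, add_zero]
  exact hx

lemma exists_isLeading {S : Finset ℕ} {f : Tree →₀ K} (hf : f ∈ shuffleSpan K S) (h0 : f ≠ 0) :
    ∃ t, IsLeading degPathLex f t := by
  obtain ⟨t, ht, hmax⟩ := Finset.exists_max_image f.support treeKey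
    (Finsupp.support_nonempty_iff.2 h0)
  refine ⟨t, ht, fun s hs hst => lt_of_le_of_ne (hmax s hs) fun e => hst ?_⟩
  exact treeKey_injOn ((Finsupp.mem_supported K f).1 hf hs).1
    ((Finsupp.mem_supported K f).1 hf ht).1 e

/-- If the leading monomial `t` of an element of the ideal were normal, reducing all lower terms
would leave a combination of normal forms with an untouched nonzero coefficient at `t` and value
zero, contrary to independence. -/
lemma isGroebnerBasis_of_linearIndepOn [CharZero K]
    (hli : ∀ S, LinearIndepOn K (evalTree K) (normalForms K S)) :
    IsGroebnerBasis degPathLex (shuffleRelations K) (presIdeal K) := by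
  refine ⟨fun n g hg => ⟨hg.1, shuffleRelations_mem_presIdeal hg⟩, fun n f hf hI h0 => ?_⟩
  obtain ⟨t, ht⟩ := exists_isLeading hf h0
  refine ⟨t, ht, ?_⟩
  by_contra hdiv
  have hsup : ∀ u ∈ f.support, u ∈ shuffleMonomials (std n) :=
    fun u hu => (Finsupp.mem_supported K f).1 hf hu
  have hnf : t ∈ normalForms K (std n) :=
    ⟨hsup t ht.1, fun s ⟨k, g, hg, hgs⟩ hst => hdiv ⟨k, g, hg, s, hgs, hst⟩⟩
  -- Every remaining monomial of `f` is below `t`, and reduction only goes down, so `t` cannot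
  -- reappear.
  have h1 : f.erase t ∈ presIdeal K (std n) ⊔
      Finsupp.supported K K {u | u ∈ normalForms K (std n) ∧ degPathLex u t} := by
    rw [← Finsupp.sum_single (f.erase t)]
    refine Submodule.sum_mem _ fun u hu => ?_
    classical
    rw [Finsupp.support_erase, Finset.mem_erase] at hu
    have e : Finsupp.single u (f.erase t u) = f.erase t u • mon u := by simp [mon]
    rw [e]
    refine Submodule.smul_mem _ _ ?_
    refine mem_sup_supported_mono ?_ (mon_mem_normalForms (hsup u hu.2))
    rintro v ⟨hv, rfl | hvu⟩
    · exact ⟨hv, ht.2 _ hu.2 hu.1⟩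
    · exact ⟨hv, lt_trans hvu (ht.2 u hu.2 hu.1)⟩
  obtain ⟨x, hx, y, hy, hxy⟩ := Submodule.mem_sup.1 h1
  have hz : Finsupp.single t (f t) + y ∈ Finsupp.supported K K (normalForms K (std n)) :=
    Submodule.add_mem _ (Finsupp.single_mem_supported K _ hnf)
      (Finsupp.supported_mono (fun v hv => hv.1) hy)
  have e : f = x + (Finsupp.single t (f t) + y) := by
    conv_lhs => rw [← Finsupp.single_add_erase t f, ← hxy]
    abel
  have hev : evalAs K (Finsupp.single t (f t) + y) = 0 := by
    have := evalAs_eq_zero_of_mem_presIdeal hI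
    rw [e, map_add, evalAs_eq_zero_of_mem_presIdeal hx, zero_add] at this
    convert this using 4
  have hzero := linearIndepOn_iff.1 (hli _) _ hz hev
  have hyt : y t = 0 := by
    by_contra hne
    exact lt_irrefl (treeKey t)
      ((Finsupp.mem_supported K y).1 hy (Finsupp.mem_support_iff.2 hne)).2
  have := DFunLike.congr_fun hzero t
  rw [Finsupp.add_apply, Finsupp.single_eq_same, hyt, add_zero] at this
  exact Finsupp.mem_support_iff.1 ht.1 this

lemma span_normalForms [CharZero K] (S : Finset ℕ) :
    Submodule.span K (evalTree K '' normalForms K S) = image K S := by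
  refine le_antisymm ?_ ?_
  · rw [image_eq_span]
    exact Submodule.span_mono (Set.image_mono fun t ht => ht.1.1)
  · rintro _ ⟨p, hp, rfl⟩
    obtain ⟨x, hx, y, hy, rfl⟩ := Submodule.mem_sup.1 (mem_sup_normalForms hp)
    rw [map_add, evalAs_eq_zero_of_mem_presIdeal hx, zero_add]
    exact (Finsupp.mem_span_image_iff_linearCombination K).2 ⟨y, hy, rfl⟩

end Reduction

/-! ### The shape of normal forms -/

namespace Tree

/-- Normal forms of Lie monomials. -/
def IsLieNormal : Tree → Prop
  | leaf _ => True
  | nu a b => a.IsLieNormal ∧ b.IsLieNormal ∧ a.minLeaf < b.minLeaf ∧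
      ∀ x y, a = nu x y → b.minLeaf < y.minLeaf
  | mu _ _ _ => False

/-- Left-nested towers of ternary vertices on normal Lie monomials with increasing minima. -/
def IsNormal : Tree → Prop
  | leaf _ => True
  | nu a b => (nu a b).IsLieNormal
  | mu a b c => a.IsNormal ∧ b.IsLieNormal ∧ c.IsLieNormal ∧ a.minLeaf < b.minLeaf ∧
      b.minLeaf < c.minLeaf ∧ ∀ x y z, a = mu x y z → z.minLeaf < b.minLeaf

lemma IsNormal.isLieNormal {t : Tree} (h : t.IsNormal) (hm : ∀ x y z, t ≠ mu x y z) :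
    t.IsLieNormal := by
  cases t with
  | leaf i => trivial
  | nu a b => exact h
  | mu a b c => exact (hm _ _ _ rfl).elim

/-- The substitution of five trees for the labels `1, …, 5`. -/
def subst (a b c d e : Tree) : ℕ → Tree
  | 1 => a
  | 2 => b
  | 3 => c
  | 4 => d
  | _ => e

/-- Divisibility at the root; for labels `1, …, n` it is enough to compare consecutive minima. -/
lemma divides_of {n : ℕ} {s t : Tree} (hs : s.labels = std n) {f : ℕ → Tree}
    (hf : ∀ i, 1 ≤ i → i < n → (f i).minLeaf < (f (i + 1)).minLeaf) (h : s.bind f = t) :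
    s.Divides t := by
  refine ⟨f, ?_, h ▸ isSubtree_refl _⟩
  intro i hi j hj hij
  rw [hs, std, mem_Icc] at hi hj
  have key : ∀ k, i + 1 ≤ k → k ≤ n → (f i).minLeaf < (f k).minLeaf := by
    intro k hk
    induction k, hk using Nat.le_induction with
    | base => intro hkn; exact hf i hi.1 hkn
    | succ k hk ih => intro hkn; exact (ih (by omega)).trans (hf k (by omega) (by omega))
  exact key j hij hj.2

lemma Divides.of_isSubtree {s u t : Tree} (h : s.Divides u)
    (hut : ∀ v, IsSubtree v u → IsSubtree v t) : s.Divides t := by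
  obtain ⟨f, hf, hs⟩ := h
  exact ⟨f, hf, hut _ hs⟩

end Tree

/-- Any violation of the normal shape is a two-vertex configuration, and the order of the minima of
its inputs selects one of the leading monomials found above. The converse is not needed: only an
upper bound on the number of normal forms matters. -/
lemma isNormal_of_not_divides (K : Type*) [Field K] {t : Tree} (ht : t.IsShuffle)
    (hn : t.leaves.Nodup) (h : ∀ s, IsLeadingRelation K s → ¬ s.Divides t) : t.IsNormal := by
  have div : ∀ {s} (_ : IsLeadingRelation K s) {n : ℕ} (_ : s.labels = std n) (f : ℕ → Tree),
      (∀ i, 1 ≤ i → i < n → (f i).minLeaf < (f (i + 1)).minLeaf) → s.bind f = t → False :=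
    fun hs _ hsn f hf hst => h _ hs (divides_of hsn hf hst)
  induction t with
  | leaf i => trivial
  | nu a b ha hb =>
    obtain ⟨na, nb, hab⟩ := nodup_nu.1 hn
    obtain ⟨sab, sa, sb⟩ := ht
    have h1 : ∀ s, IsLeadingRelation K s → ¬ s.Divides a := fun s hs hd =>
      h s hs (hd.of_isSubtree fun v hv => .inr (.inl hv))
    have h2 : ∀ s, IsLeadingRelation K s → ¬ s.Divides b := fun s hs hd =>
      h s hs (hd.of_isSubtree fun v hv => .inr (.inr hv))
    replace ha := ha sa na h1 fun hs _ hsn f hf hst => h1 _ hs (divides_of hsn hf hst)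
    replace hb := hb sb nb h2 fun hs _ hsn f hf hst => h2 _ hs (divides_of hsn hf hst)
    refine ⟨ha.isLieNormal ?_, hb.isLieNormal ?_, sab, ?_⟩
    · rintro x y z rfl
      obtain ⟨sxy, syz, srest⟩ := sa
      have hx : (mu x y z).minLeaf = x.minLeaf := IsShuffle.minLeaf_mu ⟨sxy, syz, srest⟩
      rw [hx] at sab
      have hyb : y.minLeaf ≠ b.minLeaf := minLeaf_ne_of_disjoint fun i hi hi' =>
        hab (by simp [leaves, hi]) hi'
      have hzb : z.minLeaf ≠ b.minLeaf := minLeaf_ne_of_disjoint fun i hi hi' =>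
        hab (by simp [leaves, hi]) hi'
      -- The minimum of `b` exceeds that of `x`, so it can fall in three places relative to `y` and
      -- `z`; each has its own Leibniz leading term. The fifth value given to `subst` is a dummy.
      rcases lt_or_gt_of_ne hzb with h3 | h3
      · exact div isLeadingRelation_nu_mu_4 (n := 4) (by decide) (subst x y z b b)
          (by intro i _ _; interval_cases i <;> assumption) rfl
      rcases lt_or_gt_of_ne hyb with h4 | h4
      · exact div isLeadingRelation_nu_mu_3 (n := 4) (by decide) (subst x y b z z)
          (by intro i _ _; interval_cases i <;> assumption) rfl
      · exact div isLeadingRelation_nu_mu_2 (n := 4) (by decide) (subst x b y z z)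
          (by intro i _ _; interval_cases i <;> assumption) rfl
    · rintro x y z rfl
      obtain ⟨sxy, syz, srest⟩ := sb
      have hx : (mu x y z).minLeaf = x.minLeaf := IsShuffle.minLeaf_mu ⟨sxy, syz, srest⟩
      rw [hx] at sab
      exact div isLeadingRelation_nu_mu_1 (n := 4) (by decide) (subst a x y z z)
          (by intro i _ _; interval_cases i <;> assumption) rfl
    · rintro x y rfl
      have hyb : y.minLeaf ≠ b.minLeaf := minLeaf_ne_of_disjoint fun i hi hi' =>
        hab (by simp [leaves, hi]) hi'
      by_contra hlt
      have h3 : y.minLeaf < b.minLeaf := by omega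
      have h4 := sa.1
      exact div isLeadingRelation_nu_nu (n := 3) (by decide) (subst x y b b b)
          (by intro i _ _; interval_cases i <;> assumption) rfl
  | mu a b c ha hb hc =>
    obtain ⟨⟨na, nb, nc⟩, hab, hac, hbc⟩ := nodup_mu.1 hn
    obtain ⟨sab, sbc, sa, sb, sc⟩ := ht
    have h1 : ∀ s, IsLeadingRelation K s → ¬ s.Divides a := fun s hs hd =>
      h s hs (hd.of_isSubtree fun v hv => .inr (.inl hv))
    have h2 : ∀ s, IsLeadingRelation K s → ¬ s.Divides b := fun s hs hd =>
      h s hs (hd.of_isSubtree fun v hv => .inr (.inr (.inl hv)))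
    have h3 : ∀ s, IsLeadingRelation K s → ¬ s.Divides c := fun s hs hd =>
      h s hs (hd.of_isSubtree fun v hv => .inr (.inr (.inr hv)))
    replace ha := ha sa na h1 fun hs _ hsn f hf hst => h1 _ hs (divides_of hsn hf hst)
    replace hb := hb sb nb h2 fun hs _ hsn f hf hst => h2 _ hs (divides_of hsn hf hst)
    replace hc := hc sc nc h3 fun hs _ hsn f hf hst => h3 _ hs (divides_of hsn hf hst)
    refine ⟨ha, hb.isLieNormal ?_, hc.isLieNormal ?_, sab, sbc, ?_⟩
    · rintro x y z rfl
      obtain ⟨sxy, syz, srest⟩ := sb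
      have hx : (mu x y z).minLeaf = x.minLeaf := IsShuffle.minLeaf_mu ⟨sxy, syz, srest⟩
      rw [hx] at sab sbc
      have hyc : y.minLeaf ≠ c.minLeaf := minLeaf_ne_of_disjoint fun i hi hi' =>
        hbc (by simp [leaves, hi]) hi'
      have hzc : z.minLeaf ≠ c.minLeaf := minLeaf_ne_of_disjoint fun i hi hi' =>
        hbc (by simp [leaves, hi]) hi'
      rcases lt_or_gt_of_ne hzc with h3 | h3
      · exact div isLeadingRelation_mu_mu_234 (n := 5) (by decide) (subst a x y z c)
          (by intro i _ _; interval_cases i <;> assumption) rfl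
      rcases lt_or_gt_of_ne hyc with h4 | h4
      · exact div isLeadingRelation_mu_mu_235 (n := 5) (by decide) (subst a x y c z)
          (by intro i _ _; interval_cases i <;> assumption) rfl
      · exact div isLeadingRelation_mu_mu_245 (n := 5) (by decide) (subst a x c y z)
          (by intro i _ _; interval_cases i <;> assumption) rfl
    · rintro x y z rfl
      obtain ⟨sxy, syz, srest⟩ := sc
      have hx : (mu x y z).minLeaf = x.minLeaf := IsShuffle.minLeaf_mu ⟨sxy, syz, srest⟩
      rw [hx] at sbc
      exact div isLeadingRelation_mu_mu_345 (n := 5) (by decide) (subst a b x y z)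
          (by intro i _ _; interval_cases i <;> assumption) rfl
    · rintro x y z rfl
      obtain ⟨sxy, syz, srest⟩ := sa
      have hx : (mu x y z).minLeaf = x.minLeaf := IsShuffle.minLeaf_mu ⟨sxy, syz, srest⟩
      rw [hx] at sab
      have hyb : y.minLeaf ≠ b.minLeaf := minLeaf_ne_of_disjoint fun i hi hi' =>
        hab (by simp [leaves, hi]) hi'
      have hzb : z.minLeaf ≠ b.minLeaf := minLeaf_ne_of_disjoint fun i hi hi' =>
        hab (by simp [leaves, hi]) hi'
      have hyc : y.minLeaf ≠ c.minLeaf := minLeaf_ne_of_disjoint fun i hi hi' =>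
        hac (by simp [leaves, hi]) hi'
      have hzc : z.minLeaf ≠ c.minLeaf := minLeaf_ne_of_disjoint fun i hi hi' =>
        hac (by simp [leaves, hi]) hi'
      -- With the minimum of `b` below that of `z`, the possible interleavings of `y < z` with `b <
      -- c` are exactly the five left-nested shuffles other than `μ(μ(1,2,3),4,5)`.
      by_contra hlt
      have hbz : b.minLeaf < z.minLeaf := by omega
      rcases lt_or_gt_of_ne hyb with h4 | h4
      · rcases lt_or_gt_of_ne hzc with h5 | h5
        · exact div isLeadingRelation_mu_mu_124 (n := 5) (by decide) (subst x y b z c)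
            (by intro i _ _; interval_cases i <;> assumption) rfl
        · exact div isLeadingRelation_mu_mu_125 (n := 5) (by decide) (subst x y b c z)
            (by intro i _ _; interval_cases i <;> assumption) rfl
      · rcases lt_or_gt_of_ne hyc with h5 | h5
        · rcases lt_or_gt_of_ne hzc with h6 | h6
          · exact div isLeadingRelation_mu_mu_134 (n := 5) (by decide) (subst x b y z c)
              (by intro i _ _; interval_cases i <;> assumption) rfl
          · exact div isLeadingRelation_mu_mu_135 (n := 5) (by decide) (subst x b y c z)
              (by intro i _ _; interval_cases i <;> assumption) rfl
        · exact div isLeadingRelation_mu_mu_145 (n := 5) (by decide) (subst x b c y z)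
            (by intro i _ _; interval_cases i <;> assumption) rfl

/-! ### Counting normal forms -/

namespace Tree

lemma IsLieNormal.isShuffle {t : Tree} (h : t.IsLieNormal) : t.IsShuffle := by
  induction t with
  | leaf i => trivial
  | nu a b ha hb => exact ⟨h.2.2.1, ha h.1, hb h.2.1⟩
  | mu a b c => exact h.elim

lemma IsNormal.isShuffle {t : Tree} (h : t.IsNormal) : t.IsShuffle := by
  induction t with
  | leaf i => trivial
  | nu a b => exact IsLieNormal.isShuffle h
  | mu a b c ha =>
    exact ⟨h.2.2.2.1, h.2.2.2.2.1, ha h.1, h.2.1.isShuffle, h.2.2.1.isShuffle⟩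

/-- The normality condition makes the right-hand minima decrease on the way from the innermost left
bracket to the root, so the outermost `b` contains the second smallest label. -/
lemma IsLieNormal.minLeaf_le_tail {a b : Tree} (h : (nu a b).IsLieNormal) :
    ∀ y ∈ a.leaves.tail ++ b.leaves, b.minLeaf ≤ y := by
  induction a generalizing b with
  | leaf i => intro y hy; exact minLeaf_le (by simpa [leaves] using hy)
  | nu x z ihx =>
    intro y hy
    rcases List.mem_append.1 hy with hy | hy
    · rw [leaves, List.tail_append_of_ne_nil (leaves_ne_nil x)] at hy
      exact (h.2.2.2 x z rfl).le.trans (ihx h.1 y hy)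
    · exact minLeaf_le hy
  | mu => exact h.1.elim

lemma append_cons_inj {m : ℕ} {l l' r r' : List ℕ} (h : l ++ m :: r = l' ++ m :: r')
    (hl : m ∉ l) (hl' : m ∉ l') : l = l' ∧ r = r' := by
  induction l generalizing l' with
  | nil => cases l' with
    | nil => simpa using h
    | cons b l' => simp at h; simp [h.1] at hl'
  | cons a l ih => cases l' with
    | nil => simp at h; simp [h.1] at hl
    | cons b l' =>
      simp only [List.cons_append, List.cons.injEq] at h
      obtain ⟨h1, h2⟩ := ih h.2 (fun h => hl (by simp [h])) (fun h => hl' (by simp [h]))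
      exact ⟨by rw [h.1, h1], h2⟩

/-- The bracketing can be read off the word: the right factor begins at the smallest letter after
the first one, by `minLeaf_le_tail`. -/
lemma IsLieNormal.eq_of_leaves_eq {t t' : Tree} (h : t.IsLieNormal) (h' : t'.IsLieNormal)
    (hn : t.leaves.Nodup) (e : t.leaves = t'.leaves) : t = t' := by
  induction t generalizing t' with
  | leaf i =>
    cases t' with
    | leaf j => simp [leaves] at e; rw [e]
    | nu a b =>
      have := congrArg List.length e
      have h1 := List.length_pos_of_ne_nil (leaves_ne_nil a)
      have h2 := List.length_pos_of_ne_nil (leaves_ne_nil b)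
      simp [leaves] at this; omega
    | mu => exact h'.elim
  | nu a b iha ihb =>
    cases t' with
    | leaf j =>
      have := congrArg List.length e
      have h1 := List.length_pos_of_ne_nil (leaves_ne_nil a)
      have h2 := List.length_pos_of_ne_nil (leaves_ne_nil b)
      simp [leaves] at this; omega
    | mu => exact h'.elim
    | nu a' b' =>
      have hn' := hn
      rw [e] at hn'
      rw [nodup_nu] at hn hn'
      simp only [leaves] at e
      have et : a.leaves.tail ++ b.leaves = a'.leaves.tail ++ b'.leaves := by
        rw [← List.tail_append_of_ne_nil (leaves_ne_nil a), e,
          List.tail_append_of_ne_nil (leaves_ne_nil a')]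
      have hm : b.minLeaf = b'.minLeaf := by
        refine le_antisymm (h.minLeaf_le_tail _ ?_) (h'.minLeaf_le_tail _ ?_)
        · rw [et]; exact List.mem_append_right _ (minLeaf_mem b')
        · rw [← et]; exact List.mem_append_right _ (minLeaf_mem b)
      obtain ⟨r, hr⟩ := h.2.1.isShuffle.exists_leaves_eq
      obtain ⟨r', hr'⟩ := h'.2.1.isShuffle.exists_leaves_eq
      have e' := e
      rw [hr, hr', hm] at e'
      obtain ⟨e1, e2⟩ := append_cons_inj e' (fun h => hn.2.2 h (hm ▸ minLeaf_mem b))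
        (fun h => hn'.2.2 h (minLeaf_mem b'))
      rw [iha h.1 h'.1 hn.1 e1, ihb h.2.1 h'.2.1 hn.2.1 (by rw [hr, hr', hm, e2])]
  | mu => exact h.elim

/-- The word of a normal form: the leaves of the Lie monomials, the last ones first. -/
def word : Tree → List ℕ
  | leaf i => [i]
  | nu a b => a.leaves ++ b.leaves
  | mu a b c => c.leaves ++ (b.leaves ++ a.word)

/-- The first letter of the word of a normal form. -/
def top : Tree → ℕ
  | leaf i => i
  | nu a b => (nu a b).minLeaf
  | mu _ _ c => c.minLeaf

lemma word_perm (t : Tree) : t.word.Perm t.leaves := by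
  induction t with
  | leaf i => rfl
  | nu a b => rfl
  | mu a b c ha =>
    rw [← Multiset.coe_eq_coe] at *
    simp only [word, leaves, ← Multiset.coe_add, ha]
    ac_rfl

lemma IsNormal.word_eq {t : Tree} (h : t.IsNormal) : ∃ r, t.word = t.top :: r := by
  cases t with
  | leaf i => exact ⟨[], rfl⟩
  | nu a b => exact IsShuffle.exists_leaves_eq h.isShuffle
  | mu a b c =>
    obtain ⟨r, hr⟩ := h.2.2.1.isShuffle.exists_leaves_eq
    exact ⟨r ++ (b.leaves ++ a.word), by rw [word, hr]; rfl⟩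

/-- With the inequality between the minima of `b` and `c`, this says that the first letters of
consecutive blocks of the word decrease. -/
lemma IsNormal.top_lt {a b c : Tree} (h : (mu a b c).IsNormal) : a.top < b.minLeaf := by
  cases a with
  | leaf i => exact h.2.2.2.1
  | nu x y => exact h.2.2.2.1
  | mu x y z => exact h.2.2.2.2.2 x y z rfl

/-- The cut between two blocks is the first place where a letter drops below `m`. -/
lemma block_inj {m : ℕ} {r r' s s' : List ℕ} (hr : ∀ x ∈ r, m ≤ x) (hr' : ∀ x ∈ r', m ≤ x)
    (hs : ∀ x ∈ s.head?, x < m) (hs' : ∀ x ∈ s'.head?, x < m) (h : r ++ s = r' ++ s') :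
    r = r' ∧ s = s' := by
  induction r generalizing r' with
  | nil => cases r' with
    | nil => simpa using h
    | cons b r' =>
      have := hr' b (by simp)
      have h2 := hs b (by rw [List.nil_append] at h; rw [h]; simp)
      omega
  | cons a r ih => cases r' with
    | nil =>
      have := hr a (by simp)
      have h2 := hs' a (by rw [List.nil_append] at h; rw [← h]; simp)
      omega
    | cons b r' =>
      simp only [List.cons_append, List.cons.injEq] at h
      obtain ⟨h1, h2⟩ := ih (fun x hx => hr x (by simp [hx])) (fun x hx => hr' x (by simp [hx])) h.2
      exact ⟨by rw [h.1, h1], h2⟩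

lemma IsLieNormal.block_inj {c c' : Tree} (h : c.IsLieNormal) (h' : c'.IsLieNormal)
    (hn : c.leaves.Nodup) {s s' : List ℕ} (hs : ∀ x ∈ s.head?, x < c.minLeaf)
    (hs' : ∀ x ∈ s'.head?, x < c'.minLeaf) (e : c.leaves ++ s = c'.leaves ++ s') :
    c = c' ∧ s = s' := by
  obtain ⟨r, hr⟩ := h.isShuffle.exists_leaves_eq
  obtain ⟨r', hr'⟩ := h'.isShuffle.exists_leaves_eq
  have hm : c.minLeaf = c'.minLeaf := by
    rw [hr, hr', List.cons_append, List.cons_append] at e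
    exact (List.cons.inj e).1
  obtain ⟨e1, e2⟩ := Tree.block_inj (m := c.minLeaf) (fun x hx => minLeaf_le hx)
    (fun x hx => hm ▸ minLeaf_le hx) hs (hm ▸ hs') e
  exact ⟨h.eq_of_leaves_eq h' hn e1, e2⟩

lemma IsNormal.head_lt {a b c : Tree} (h : (mu a b c).IsNormal) :
    (∀ x ∈ (b.leaves ++ a.word).head?, x < c.minLeaf) ∧ ∀ x ∈ a.word.head?, x < b.minLeaf := by
  obtain ⟨r, hr⟩ := h.2.1.isShuffle.exists_leaves_eq
  obtain ⟨r', hr'⟩ := h.1.word_eq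
  rw [hr, hr']
  constructor
  · intro x hx
    obtain rfl : b.minLeaf = x := by simpa using hx
    exact h.2.2.2.2.1
  · intro x hx
    obtain rfl : a.top = x := by simpa using hx
    exact h.top_lt

/-- The blocks are cut off one at a time by `IsLieNormal.block_inj`, which also recovers each
bracketing. -/
lemma IsNormal.eq_of_word_eq {t t' : Tree} (h : t.IsNormal) (h' : t'.IsNormal)
    (hn : t.leaves.Nodup) (hn' : t'.leaves.Nodup) (e : t.word = t'.word) : t = t' := by
  -- A single block cannot equal the word of a tower, since cutting off the first block there leaves
  -- letters over.
  have aux : ∀ {t a b c : Tree}, t.IsLieNormal → (mu a b c).IsNormal → t.leaves.Nodup →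
      t.leaves ≠ (mu a b c).word := by
    intro t a b c ht hm hn e
    rw [← List.append_nil t.leaves, word] at e
    have := (ht.block_inj hm.2.2.1 hn (by simp) hm.head_lt.1 e).2
    exact leaves_ne_nil b (List.append_eq_nil_iff.1 this.symm).1
  induction t generalizing t' with
  | leaf i =>
    cases t' with
    | mu a b c => exact (aux (t := leaf i) trivial h' hn e).elim
    | leaf j => exact IsLieNormal.eq_of_leaves_eq (t := leaf i) (t' := leaf j) trivial trivial hn e
    | nu a b => exact IsLieNormal.eq_of_leaves_eq (t := leaf i) trivial h' hn e
  | nu x y =>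
    cases t' with
    | mu a b c => exact (aux (t := nu x y) h h' hn e).elim
    | leaf j => exact IsLieNormal.eq_of_leaves_eq (t := nu x y) (t' := leaf j) h trivial hn e
    | nu a b => exact IsLieNormal.eq_of_leaves_eq (t := nu x y) h h' hn e
  | mu a b c iha =>
    cases t' with
    | leaf j => exact (aux (t := leaf j) trivial h hn' e.symm).elim
    | nu x y => exact (aux (t := nu x y) h' h hn' e.symm).elim
    | mu a' b' c' =>
      obtain ⟨⟨na, nb, nc⟩, -⟩ := nodup_mu.1 hn
      obtain ⟨⟨na', nb', nc'⟩, -⟩ := nodup_mu.1 hn'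
      obtain ⟨rfl, e1⟩ := h.2.2.1.block_inj h'.2.2.1 nc h.head_lt.1 h'.head_lt.1 e
      obtain ⟨rfl, e2⟩ := h.2.1.block_inj h'.2.1 nb h.head_lt.2 h'.head_lt.2 e1
      rw [iha h.1 h'.1 na na' e2]

end Tree

/-- The number of records (entries smaller than `m` and all preceding entries) of a list. -/
def records : ℕ → List ℕ → ℕ
  | _, [] => 0
  | m, x :: l => if x < m then records x l + 1 else records m l

lemma records_append_of_le {m : ℕ} {l : List ℕ} (h : ∀ x ∈ l, m ≤ x) (s : List ℕ) :
    records m (l ++ s) = records m s := by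
  induction l with
  | nil => rfl
  | cons a l ih =>
    rw [List.cons_append, records, if_neg (not_lt.2 (h a (by simp))),
      ih fun x hx => h x (by simp [hx])]

lemma records_leaves_append {t : Tree} (h : t.IsShuffle) {m : ℕ} (hm : t.minLeaf < m)
    (s : List ℕ) : records m (t.leaves ++ s) = records t.minLeaf s + 1 := by
  obtain ⟨r, hr⟩ := h.exists_leaves_eq
  rw [hr, List.cons_append, records, if_pos hm, records_append_of_le]
  intro x hx
  exact minLeaf_le (by rw [hr]; simp [hx])

/-- Each block contributes exactly one record, its first letter; the innermost tree gives one block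
and every `μ` adds two. -/
lemma odd_records_word {t : Tree} (h : t.IsNormal) {m : ℕ} (hm : t.top < m) :
    Odd (records m t.word) := by
  induction t generalizing m with
  | leaf i => simp [word, records, show i < m from hm]
  | nu a b =>
    have := records_leaves_append (t := nu a b) h.isShuffle hm []
    rw [List.append_nil] at this
    change Odd (records m (nu a b).leaves)
    rw [this]; simp [records]
  | mu a b c iha =>
    rw [word, records_leaves_append h.2.2.1.isShuffle hm,
      records_leaves_append h.2.1.isShuffle h.2.2.2.2.1]
    have := iha h.1 h.top_lt
    rw [Nat.odd_iff] at this ⊢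
    omega

/-- Exchanging the first two entries. -/
def swapHead : List ℕ → List ℕ
  | a :: b :: l => b :: a :: l
  | l => l

lemma swapHead_swapHead (l : List ℕ) : swapHead (swapHead l) = l := by
  match l with
  | [] => rfl
  | [_] => rfl
  | _ :: _ :: _ => rfl

lemma swapHead_perm (l : List ℕ) : (swapHead l).Perm l := by
  match l with
  | [] => rfl
  | [_] => rfl
  | a :: b :: l => exact List.Perm.swap a b l

/-- The first entry is always a record and the second is one exactly when it is smaller; afterwards
the running minimum does not depend on their order. So the exchange changes the count by one. -/
lemma odd_records_swapHead {l : List ℕ} (hl : 2 ≤ l.length) (hn : l.Nodup) {m : ℕ}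
    (hm : ∀ x ∈ l, x < m) : Odd (records m (swapHead l)) ↔ ¬ Odd (records m l) := by
  match l with
  | a :: b :: l =>
    have ha := hm a (by simp)
    have hb := hm b (by simp)
    have hab : a ≠ b := by rintro rfl; simp at hn
    simp only [swapHead, records, if_pos ha, if_pos hb]
    rcases lt_or_gt_of_ne hab with h | h
    · rw [if_pos h, if_neg h.not_gt]; simp only [Nat.odd_iff]; omega
    · rw [if_pos h, if_neg h.not_gt]; simp only [Nat.odd_iff]; omega

/-- The words in which every element of `S` occurs once. -/
def words (S : Finset ℕ) : Finset (List ℕ) := S.toList.permutations.toFinset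

lemma mem_words {S : Finset ℕ} {l : List ℕ} : l ∈ words S ↔ l.Nodup ∧ l.toFinset = S := by
  rw [words, List.mem_toFinset, List.mem_permutations]
  constructor
  · intro h
    exact ⟨h.nodup_iff.2 S.nodup_toList, by rw [List.toFinset_eq_of_perm _ _ h, S.toList_toFinset]⟩
  · rintro ⟨h, rfl⟩
    exact List.perm_of_nodup_nodup_toFinset_eq h (Finset.nodup_toList _) (by simp)

/-! ### The dimension count -/

section Counting

variable (K : Type*) [Field K]

lemma finite_normalForms (S : Finset ℕ) : (normalForms K S).Finite :=
  (finite_treeMonomials S).subset fun _ h => h.1.1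

/-- The words of normal forms have an odd number of records and their images under `swapHead` an
even number, so these are two disjoint sets of permutations of the same size. -/
lemma two_mul_card_normalForms_le {S : Finset ℕ} (hS : 2 ≤ S.card) :
    2 * (finite_normalForms K S).toFinset.card ≤ (words S).card := by
  set N := (finite_normalForms K S).toFinset
  have hN : ∀ t ∈ N, t ∈ treeMonomials S ∧ t.IsNormal := fun t ht => by
    have ht := (finite_normalForms K S).mem_toFinset.1 ht
    exact ⟨ht.1.1, isNormal_of_not_divides K ht.1.2 ht.1.1.1 ht.2⟩
  have hw : ∀ t ∈ N, t.word ∈ words S := fun t ht => by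
    have h := (hN t ht).1
    rw [mem_words]
    exact ⟨(word_perm t).nodup_iff.2 h.1,
      by rw [List.toFinset_eq_of_perm _ _ (word_perm t)]; exact h.2⟩
  have c1 : (N.image word).card = N.card := by
    refine Finset.card_image_of_injOn fun s hs t ht e => ?_
    exact (hN s hs).2.eq_of_word_eq (hN t ht).2 (hN s hs).1.1 (hN t ht).1.1 e
  have c2 : ((N.image word).image swapHead).card = N.card := by
    rw [Finset.card_image_of_injective _ (Function.LeftInverse.injective swapHead_swapHead), c1]
  -- A start value above all letters, so that the first letter counts as a record.
  set m := S.sup id + 1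
  have hm : ∀ l ∈ words S, ∀ x ∈ l, x < m := fun l hl x hx => by
    have hx : x ∈ S := by rw [← (mem_words.1 hl).2]; simpa using hx
    exact Nat.lt_succ_of_le (Finset.le_sup (f := id) hx)
  have odd : ∀ l ∈ N.image word, Odd (records m l) := fun l hl => by
    obtain ⟨t, ht, rfl⟩ := mem_image.1 hl
    refine odd_records_word (hN t ht).2 (hm _ (hw t ht) _ ?_)
    obtain ⟨r, hr⟩ := (hN t ht).2.word_eq
    rw [hr]; simp
  have sub : N.image word ⊆ words S := fun l hl => by
    obtain ⟨t, ht, rfl⟩ := mem_image.1 hl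
    exact hw t ht
  have hd : Disjoint (N.image word) ((N.image word).image swapHead) := by
    rw [Finset.disjoint_left]
    intro l hl hl'
    obtain ⟨l', h', rfl⟩ := mem_image.1 hl'
    have hw' := mem_words.1 (sub h')
    refine (odd_records_swapHead ?_ hw'.1 (hm _ (sub h'))).1 (odd _ hl) (odd _ h')
    rw [← List.toFinset_card_of_nodup hw'.1, hw'.2]
    exact hS
  rw [two_mul]
  nth_rewrite 1 [← c1]
  rw [← c2, ← Finset.card_union_of_disjoint hd]
  refine Finset.card_le_card (Finset.union_subset sub fun l hl => ?_)
  obtain ⟨l', hl', rfl⟩ := mem_image.1 hl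
  have := mem_words.1 (sub hl')
  rw [mem_words]
  exact ⟨(swapHead_perm l').nodup_iff.2 this.1,
    by rw [List.toFinset_eq_of_perm _ _ (swapHead_perm l'), this.2]⟩

/-- The words that are lexicographically smaller than their reversals. -/
def halfWords (S : Finset ℕ) : Finset (List ℕ) := (words S).filter fun l => l < l.reverse

lemma reverse_mem_words {S : Finset ℕ} {l : List ℕ} (h : l ∈ words S) : l.reverse ∈ words S := by
  rw [mem_words] at h ⊢
  exact ⟨List.nodup_reverse.2 h.1, by rw [List.toFinset_reverse, h.2]⟩

lemma card_words_le {S : Finset ℕ} (hS : 2 ≤ S.card) :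
    (words S).card ≤ 2 * (halfWords S).card := by
  have : words S ⊆ halfWords S ∪ (halfWords S).image List.reverse := by
    intro l hl
    have hne : l ≠ l.reverse := by
      intro e
      have hw := mem_words.1 hl
      have hlen : 2 ≤ l.length := by
        rw [← List.toFinset_card_of_nodup hw.1, hw.2]; exact hS
      match l, hlen with
      | a :: b :: r, _ =>
        have hn := hw.1
        -- A word equal to its reversal would have its first letter `a` again as last letter, which
        -- lies in the tail.
        have h1 : a ∈ (b :: r).reverse := by
          obtain ⟨c, q, hq⟩ := List.exists_cons_of_ne_nil
            (show (b :: r).reverse ≠ [] by simp)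
          rw [List.reverse_cons, hq, List.cons_append] at e
          rw [hq, (List.cons.inj e).1]; simp
        rw [List.mem_reverse] at h1
        exact (List.nodup_cons.1 hn).1 h1
    rw [mem_union, mem_image]
    rcases lt_or_gt_of_ne hne with h | h
    · exact .inl (mem_filter.2 ⟨hl, h⟩)
    · exact .inr ⟨l.reverse, mem_filter.2 ⟨reverse_mem_words hl, by rwa [List.reverse_reverse]⟩,
        List.reverse_reverse l⟩
  refine (Finset.card_le_card this).trans ((Finset.card_union_le _ _).trans ?_)
  have := Finset.card_image_le (s := halfWords S) (f := List.reverse)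
  omega

/-- The coefficient of a word. -/
def wordCoeff (l : List ℕ) : FreeAlgebra K ℕ →ₗ[K] K :=
  (FreeAlgebra.basisFreeMonoid K ℕ).coord (FreeMonoid.ofList l)

lemma wordCoeff_prod (l l' : List ℕ) :
    wordCoeff K l (l'.map (X K)).prod = if l' = l then 1 else 0 := by
  have : (l'.map (X K)).prod = FreeAlgebra.basisFreeMonoid K ℕ (FreeMonoid.ofList l') := by
    refine (FreeAlgebra.equivMonoidAlgebraFreeMonoid (R := K) (X := ℕ)).injective ?_
    have e : ∀ l : List ℕ, FreeAlgebra.equivMonoidAlgebraFreeMonoid (l.map (X K)).prod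
        = MonoidAlgebra.of K (FreeMonoid ℕ) (FreeMonoid.ofList l) := by
      intro l
      induction l with
      | nil => simp; rfl
      | cons a l ih =>
        rw [List.map_cons, List.prod_cons, map_mul, ih, FreeMonoid.ofList_cons, map_mul]
        congr 1
        simp [FreeAlgebra.equivMonoidAlgebraFreeMonoid, X]
    rw [e]
    simp [FreeAlgebra.basisFreeMonoid]
  rw [this, wordCoeff, Module.Basis.coord_apply, Module.Basis.repr_self]
  split_ifs with h
  · rw [h, Finsupp.single_eq_same]
  · exact Finsupp.single_eq_of_ne fun e => h (FreeMonoid.ofList.injective e).symm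

variable {K}

lemma flipSum_leaf_mem_image [CharZero K] {S : Finset ℕ} {l : List ℕ} (hl : l ∈ words S)
    (hS : S.Nonempty) : flipSum K (l.map leaf) ∈ image K S := by
  have hw := mem_words.1 hl
  have e : listLeaves (l.map leaf) = l := by
    rw [listLeaves, List.flatMap_map]; exact List.flatMap_singleton' l
  refine flipSum_mem_image (l.length - 1) S _ ?_ (by rw [e]; exact hw.1) (by rw [e]; exact hw.2)
  rw [List.length_map, ← List.toFinset_card_of_nodup hw.1, hw.2]
  have := hS.card_pos
  omega

/-- The coefficient functionals of the half words are dual to this family: the reversal of a half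
word is never a half word, so each coefficient sees only the first summand. -/
lemma linearIndependent_flipSum (S : Finset ℕ) :
    LinearIndependent K fun l : halfWords S => flipSum K (l.1.map leaf) := by
  have key : ∀ l l' : halfWords S, wordCoeff K l.1 (flipSum K (l'.1.map leaf))
      = if l'.1 = l.1 then 1 else 0 := by
    intro l l'
    have hl := (mem_filter.1 l.2).2
    have hl' := (mem_filter.1 l'.2).2
    have hne : l'.1.reverse ≠ l.1 := by
      intro e
      rw [← e, List.reverse_reverse] at hl
      exact lt_asymm hl' hl
    rw [flipSum, ← List.map_reverse, treeProd_map_leaf, treeProd_map_leaf, map_add, map_smul,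
      wordCoeff_prod, wordCoeff_prod, if_neg hne, smul_zero, add_zero]
  refine LinearIndependent.of_pairwise_dual_eq_zero_one _ (fun l => wordCoeff K l.1) ?_ ?_
  · intro l l' hll'
    rw [key, if_neg fun e => hll' (Subtype.ext e.symm)]
  · intro l
    rw [key, if_pos rfl]

lemma finiteDimensional_image (S : Finset ℕ) : FiniteDimensional K (image K S) := by
  rw [image_eq_span]
  exact FiniteDimensional.span_of_finite K ((finite_treeMonomials S).image _)

lemma card_halfWords_le [CharZero K] {S : Finset ℕ} (hS : S.Nonempty) :
    (halfWords S).card ≤ Module.finrank K (image K S) := by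
  have := finiteDimensional_image (K := K) S
  have hli : LinearIndependent K fun l : halfWords S =>
      (⟨flipSum K (l.1.map leaf), flipSum_leaf_mem_image (mem_filter.1 l.2).1 hS⟩ : image K S) :=
    LinearIndependent.of_comp (image K S).subtype (linearIndependent_flipSum S)
  simpa using hli.fintype_card_le_finrank

/-- The values span the image, and their number is at most half the number of words, which is at
most the dimension of the image; hence they are independent. -/
theorem linearIndepOn_normalForms [CharZero K] (S : Finset ℕ) :
    LinearIndepOn K (evalTree K) (normalForms K S) := by
  rcases S.eq_empty_or_nonempty with rfl | hne
  · have : normalForms K ∅ = ∅ := by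
      refine Set.eq_empty_of_forall_notMem fun t ht => ?_
      have := minLeaf_mem_of_mem ht.1.1
      simp at this
    rw [this]
    exact linearIndepOn_empty K _
  have := (finite_normalForms K S).fintype
  rw [LinearIndepOn, linearIndependent_iff_card_le_finrank_span, Set.finrank, ← Set.image_eq_range,
    span_normalForms, ← Set.toFinset_card]
  have hcard : (normalForms K S).toFinset = (finite_normalForms K S).toFinset := by
    ext; simp
  rw [hcard]
  rcases Nat.lt_or_ge 1 S.card with h | h
  · have h1 := two_mul_card_normalForms_le K h
    have h2 := card_words_le h
    have h3 := card_halfWords_le (K := K) hne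
    omega
  -- In arity one the halving argument fails, as the only word is its own reversal. The only tree is
  -- the leaf, and its value is nonzero.
  · obtain ⟨i, rfl⟩ := Finset.card_eq_one.1 (le_antisymm h hne.card_pos)
    have hleaf : ∀ t ∈ (finite_normalForms K {i}).toFinset, t = leaf i := by
      intro t ht
      have ht := ((finite_normalForms K {i}).mem_toFinset.1 ht).1.1
      have hlen := length_leaves ht
      rw [Finset.card_singleton] at hlen
      cases t with
      | leaf j =>
        have := ht.2
        rw [labels_leaf, Finset.singleton_inj] at this
        rw [this]
      | nu a b =>
        have h1 := List.length_pos_of_ne_nil (leaves_ne_nil a)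
        have h2 := List.length_pos_of_ne_nil (leaves_ne_nil b)
        simp [leaves] at hlen; omega
      | mu a b c =>
        have h1 := List.length_pos_of_ne_nil (leaves_ne_nil a)
        have h2 := List.length_pos_of_ne_nil (leaves_ne_nil b)
        simp [leaves] at hlen; omega
    have := finiteDimensional_image (K := K) {i}
    refine (Finset.card_le_one.2 fun s hs t ht => (hleaf s hs).trans (hleaf t ht).symm).trans ?_
    refine Submodule.one_le_finrank_iff.2 fun h0 => ?_
    have := evalTree_mem_image (K := K) (leaf_mem i)
    rw [h0, Submodule.mem_bot] at this
    have h1 := wordCoeff_prod K [i] [i]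
    simp only [List.map_cons, List.map_nil, List.prod_cons, List.prod_nil, mul_one] at h1
    rw [show X K i = evalTree K (leaf i) from rfl, this] at h1
    simp at h1

end Counting

end FlipOperad

end

/-! ### Conclusion -/

theorem mainTheorem9 (K : Type*) [Field K] [CharZero K] :
    -- the suboperad generated by the two operations is the operad of invariants
    (∀ S : Finset ℕ, FlipOperad.suboperadGen K (FlipOperad.generators K) S
      = FlipOperad.asInv K S) ∧
    -- presentation: the morphism from the free operad is onto the operad of invariants, and
    -- its kernel is the operadic ideal generated by the relations
    (∀ S : Finset ℕ, (FlipOperad.multilin K S).map (FlipOperad.evalAs K)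
      = FlipOperad.asInv K S) ∧
    (∀ S : Finset ℕ, ∀ p ∈ FlipOperad.multilin K S,
      FlipOperad.evalAs K p = 0 ↔ p ∈ FlipOperad.presIdeal K S) ∧
    -- the relations form a Gröbner basis
    FlipOperad.IsMonomialOrder FlipOperad.degPathLex ∧
    FlipOperad.IsGroebnerBasis FlipOperad.degPathLex (FlipOperad.shuffleRelations K)
      (FlipOperad.presIdeal K) := by
  have hli := fun S => FlipOperad.linearIndepOn_normalForms (K := K) S
  exact ⟨FlipOperad.suboperadGen_eq_asInv, FlipOperad.image_eq_asInv,
    fun S _ hp => FlipOperad.mem_presIdeal_iff (hli S) hp,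
    FlipOperad.isMonomialOrder_degPathLex, FlipOperad.isGroebnerBasis_of_linearIndepOn hli⟩
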